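/- Let $\sigma,l,\gamma>0$ and let $\Omega\subset\mathbb R^2$ be a bounded open set with diameter $d_\Omega$. There is a constant $C>0$, depending only on $\sigma,l,\Omega,\gamma$, such that the following holds. **Field and mesh.** Let $a(x,\theta)$ be a jointly measurable centred Gaussian field on $\Omega$ over a probability space $(\Theta,P)$ with covariance $C(x,y)=\sigma^2\exp(-\|x-y\|_2^2/l)$. Let $\epsilon>0$ and $h>h_0>0$. Let $\mathcal T_h$ be a finite conforming triangulation of $\Omega$ (so $\Omega$ is the interior of the union of the closed triangles) with mesh size $h$, the largest element diameter. Assume it is quasi-uniform and shape regular with constant $\gamma$: every element $K$ has diameter at least $\gamma h$ and contains a disc of radius $\gamma\,\mathrm{diam}\,K$. Let $\Omega^{(i)}$ be a subdomain, i.e. the interior of the union of a nonempty set of elements. **KL expansions.** Let $(\lambda_m,a_m)_{m\ge1}$ be the eigenpairs of the integral operator on $L^2(\Omega)$ with kernel $C$: the eigenvalues are in descending order with multiplicity, and the eigenfunctions form a complete orthonormal system satisfying the eigenvalue equation at every point. Let $(\lambda^{(i)}_m,a^{(i)}_m)_{m\ge1}$ be those of the operator on $L^2(\Omega^{(i)})$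 with the same kernel. Put $$\xi_m=\lambda_m^{-1/2}\int_\Omega a\,a_m\,dx,\qquad \xi^{(i)}_m=(\lambda_m^{(i)})^{-1/2}\int_{\Omega^{(i)}}a\,a^{(i)}_m\,dx,\qquad a_{M_{KL}}=\sum_{m=1}^{M_{KL}}\sqrt{\lambda_m}\,a_m\,\xi_m ,$$ and $a^{(i)}_{M_{KL}}=\sum_{m=1}^{M^{(i)}_{KL}}\sqrt{\lambda^{(i)}_m}\,a^{(i)}_m\,\hat\xi^{(i)}_m$. Here the random vector $\hat\xi^{(i)}$ is either a measurable choice of minimizer, for almost every $\theta$, of $$v\mapsto\int_{\Omega^{(i)}}\Big(\exp(a_{M_{KL}}(x,\theta))-\exp\Big(\sum_{m=1}^{M^{(i)}_{KL}}\sqrt{\lambda^{(i)}_m}\,a^{(i)}_m(x)\,v_m\Big)\Big)^2dx,\qquad v\in\mathbb R^{M^{(i)}_{KL}},$$ or simply $\hat\xi^{(i)}_m=\xi^{(i)}_m$ for $m\le M^{(i)}_{KL}$. **Local matrices and PC approximation.** Let $\phi_s$ be the continuous piecewise linear nodal basis functions of $\mathcal T_h$. Let $R,S$ be sets of vertices in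 $\overline{\Omega^{(i)}}\setminus\partial\Omega$ (interior and interface nodes), and put $$A^{(i)}_L=\Big(\int_{\Omega^{(i)}}e^{a_{M_{KL}}}\,\nabla\phi_s\cdot\nabla\phi_t\,dx\Big)_{s\in R,\,t\in S},\qquad B=\Big(\int_{\Omega^{(i)}}e^{a^{(i)}_{M_{KL}}}\,\nabla\phi_s\cdot\nabla\phi_t\,dx\Big)_{s\in R,\,t\in S}.$$ For $d\in\mathbb N_0$ let $\mathscr S^{(i)}=\mathbb N_0^{M^{(i)}_{KL}}$ and $\mathscr S^{(i)}_d=\{\alpha\in\mathscr S^{(i)}:|\alpha|\le d\}$. Let $\psi_\alpha=\prod_m\psi_{\alpha_m}(\xi^{(i)}_m)$, where $\psi_n$ is the Hermite polynomial of degree $n$, orthonormal for $N(0,1)$. Let $$A^{(i)}_{L,PC_d}=\sum_{\alpha\in\mathscr S^{(i)}_d}E(B\,\psi_\alpha)\,\psi_\alpha .$$ **Assumption.** Let $c_0=E\,e^{a(x,\cdot)}=e^{\sigma^2/2}$, and assume $$\sum_{m>M_{KL}}\lambda_m\|a_m\|_{L^2(\Omega)}^2\le\epsilon^2h_0^2\Big(\frac{h_0}{d_\Omega}\Big)^6,\qquad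 \sum_{m>M^{(i)}_{KL}}\lambda^{(i)}_m\|a^{(i)}_m\|_{L^2(\Omega^{(i)})}^2\le\epsilon^2h_0^2\Big(\frac{h_0}{d_\Omega}\Big)^6,$$ $$\sum_{\alpha\in\mathscr S^{(i)}\setminus\mathscr S^{(i)}_d}c_0^2\,\frac{(2\ln c_0)^{|\alpha|}}{\alpha!}\le\frac{\epsilon}{d_\Omega^2}.$$ **Conclusion.** All entries of $B\,\psi_\alpha$ ($\alpha\in\mathscr S^{(i)}$) are integrable, $\|A^{(i)}_L-A^{(i)}_{L,PC_d}\|_2^2$ (spectral norm) is integrable, and $$E\,\|A^{(i)}_L-A^{(i)}_{L,PC_d}\|_2^2\le C\,\epsilon .$$ -/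

import Mathlib

open MeasureTheory ProbabilityTheory Set Filter Topology
open scoped Matrix.Norms.L2Operator Gradient

noncomputable section

namespace StochBDDC

/-- The Euclidean plane. -/
abbrev Plane : Type := EuclideanSpace ℝ (Fin 2)

/-! ### Triangulations and the piecewise linear nodal basis -/

/-- The elements (closed triangles, given by their three vertices) of a triangulation.
A `Geometry.SimplicialComplex` is conforming: two faces meet in a common face or not at all. -/
def elements (T : Geometry.SimplicialComplex ℝ Plane) : Set (Finset Plane) :=
  {K | K ∈ T.faces ∧ K.card = 3}

/-- `T` is a finite conforming triangulation of `Ω` with mesh size `h` (the largest element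
diameter), which is shape regular and quasi-uniform with constant `γ`. -/
structure IsTriangulation (T : Geometry.SimplicialComplex ℝ Plane) (Ω : Set Plane)
    (γ h : ℝ) : Prop where
  finite : T.faces.Finite
  /-- every vertex and every edge belongs to a triangle -/
  pure : ∀ s ∈ T.faces, ∃ K ∈ elements T, s ⊆ K
  /-- `Ω` is the open polygonal region covered by the triangles -/
  covers : Ω = interior T.space
  diam_le : ∀ K ∈ elements T, Metric.diam (convexHull ℝ (K : Set Plane)) ≤ h
  diam_attained : ∃ K ∈ elements T, Metric.diam (convexHull ℝ (K : Set Plane)) = h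
  quasi_uniform : ∀ K ∈ elements T, γ * h ≤ Metric.diam (convexHull ℝ (K : Set Plane))
  /-- every element contains a disc whose radius is comparable to the element's diameter -/
  shape_regular : ∀ K ∈ elements T, ∃ c : Plane,
    Metric.closedBall c (γ * Metric.diam (convexHull ℝ (K : Set Plane)))
      ⊆ convexHull ℝ (K : Set Plane)

/-- `t` is the barycentric coordinate of `x` with respect to the vertex `v`, in some element
that contains `x` (it is `0` if `v` is not a vertex of that element). -/
def IsNodalValue (T : Geometry.SimplicialComplex ℝ Plane) (v x : Plane) (t : ℝ) : Prop :=
  ∃ K ∈ elements T, ∃ w : Plane → ℝ,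
    (∀ y ∈ K, 0 ≤ w y) ∧ (∀ y, y ∉ K → w y = 0) ∧
    ∑ y ∈ K, w y = 1 ∧ ∑ y ∈ K, w y • y = x ∧ w v = t

open Classical in
/-- The nodal basis ("hat") function of the vertex `v`: continuous on the triangulated region,
affine on each triangle, equal to `1` at `v` and to `0` at all other vertices. -/
def hat (T : Geometry.SimplicialComplex ℝ Plane) (v x : Plane) : ℝ :=
  if h : ∃ t, IsNodalValue T v x t then h.choose else 0

/-- The open subdomain made up of a set `S` of elements. -/
def subdomain (S : Set (Finset Plane)) : Set Plane :=
  interior (⋃ K ∈ S, convexHull ℝ (K : Set Plane))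

/-- The degrees of freedom of a subdomain `D`: the vertices in its closure that do not lie on
the Dirichlet boundary `∂Ω` (interior and interface nodes of `D`). -/
def dofs (T : Geometry.SimplicialComplex ℝ Plane) (Ω D : Set Plane) : Set Plane :=
  {v | v ∈ T.vertices ∧ v ∈ closure D ∧ v ∉ frontier Ω}

/-- A subdomain local matrix for the coefficient `κ`: the block with rows `R` and columns `S`
of the stiffness matrix `(∫_D κ ∇φ_s · ∇φ_t)` of the subdomain `D`. -/
def localMatrix (T : Geometry.SimplicialComplex ℝ Plane) (D : Set Plane) (R S : Finset Plane)
    (κ : Plane → ℝ) : Matrix R S ℝ :=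
  Matrix.of fun s t => ∫ x in D, κ x * inner ℝ (∇ (hat T s) x) (∇ (hat T t) x)

/-! ### The Gaussian field and its Karhunen-Loève expansions -/

/-- The covariance function `σ² exp(-‖x - y‖² / l)`. -/
def covKernel (σ l : ℝ) (x y : Plane) : ℝ := σ ^ 2 * Real.exp (-‖x - y‖ ^ 2 / l)

/-- `a` is a (jointly measurable) centred Gaussian field on `Ω` with covariance `covKernel σ l`.
Values of `a` off `Ω` play no role. -/
structure IsGaussianField {Θ : Type*} [MeasurableSpace Θ] (P : Measure Θ) (σ l : ℝ)
    (Ω : Set Plane) (a : Plane → Θ → ℝ) : Prop where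
  measurable : Measurable (Function.uncurry a)
  gaussian : IsGaussianProcess (fun x : Ω => a x) P
  centred : ∀ x ∈ Ω, ∫ θ, a x θ ∂P = 0
  covariance : ∀ x ∈ Ω, ∀ y ∈ Ω, ∫ θ, a x θ * a y θ ∂P = covKernel σ l x y

/-- `(lam m, e m)`, `m = 0, 1, 2, …`, are all the eigenpairs of the covariance operator on
`L²(D)`: the eigenvalues, repeated according to multiplicity, are in descending order, and the
eigenfunctions form a complete orthonormal system of `L²(D)`. -/
structure IsKLSystem (σ l : ℝ) (D : Set Plane) (lam : ℕ → ℝ) (e : ℕ → Plane → ℝ) : Prop where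
  pos : ∀ m, 0 < lam m
  antitone : Antitone lam
  memLp : ∀ m, MemLp (e m) 2 (volume.restrict D)
  orthonormal : ∀ m n, ∫ x in D, e m x * e n x = if m = n then 1 else 0
  complete : ∀ f : Plane → ℝ, MemLp f 2 (volume.restrict D) →
    (∀ m, ∫ x in D, f x * e m x = 0) → f =ᵐ[volume.restrict D] 0
  eigen : ∀ m, ∀ y ∈ D, ∫ x in D, covKernel σ l x y * e m x = lam m * e m y

/-- The KL random variables `ξ_m(θ) = λ_m^{-1/2} ∫_D a(x,θ) e_m(x) dx`. -/
def klVar {Θ : Type*} (D : Set Plane) (lam : ℕ → ℝ) (e : ℕ → Plane → ℝ) (a : Plane → Θ → ℝ)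
    (m : ℕ) (θ : Θ) : ℝ :=
  (Real.sqrt (lam m))⁻¹ * ∫ x in D, a x θ * e m x

/-- The truncated KL sum `∑_{m < M} √λ_m e_m(x) v_m`. -/
def klSum (lam : ℕ → ℝ) (e : ℕ → Plane → ℝ) {M : ℕ} (v : Fin M → ℝ) (x : Plane) : ℝ :=
  ∑ m : Fin M, Real.sqrt (lam m) * e m x * v m

/-- The KL truncation error `∑_{m ≥ M} λ_m ‖e_m‖²_{L²(D)}`. -/
def klTail (D : Set Plane) (lam : ℕ → ℝ) (e : ℕ → Plane → ℝ) (M : ℕ) : ℝ :=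
  ∑' m : ℕ, lam (M + m) * ∫ x in D, e (M + m) x ^ 2

/-- `v` minimizes `∫_D (exp b - exp (∑_m √λ_m e_m v_m))²`. -/
def IsLeastSquaresFit (D : Set Plane) (lam : ℕ → ℝ) (e : ℕ → Plane → ℝ) {M : ℕ}
    (b : Plane → ℝ) (v : Fin M → ℝ) : Prop :=
  IsMinOn (fun u : Fin M → ℝ => ∫ x in D, (Real.exp (b x) - Real.exp (klSum lam e u x)) ^ 2)
    Set.univ v

/-! ### Polynomial chaos -/

/-- The orthonormal univariate Hermite polynomial of degree `n` (for the law `N(0,1)`). -/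
def hermiteFun (n : ℕ) (x : ℝ) : ℝ :=
  Polynomial.aeval x (Polynomial.hermite n) / Real.sqrt (n.factorial : ℝ)

/-- The multivariate Hermite polynomial `ψ_α(ξ) = ∏_m ψ_{α_m}(ξ_m)`. -/
def psi {M : ℕ} (α : Fin M → ℕ) (ξ : Fin M → ℝ) : ℝ := ∏ m, hermiteFun (α m) (ξ m)

/-- The multi-indices of total degree at most `d`. -/
def multiIdx (M d : ℕ) : Finset (Fin M → ℕ) :=
  (Fintype.piFinset fun _ : Fin M => Finset.range (d + 1)).filter fun α => ∑ m, α m ≤ d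

theorem mem_multiIdx {M d : ℕ} {α : Fin M → ℕ} : α ∈ multiIdx M d ↔ ∑ m, α m ≤ d := by
  simp only [multiIdx, Finset.mem_filter, Fintype.mem_piFinset, Finset.mem_range,
    and_iff_right_iff_imp]
  intro h m
  exact Nat.lt_succ_of_le ((Finset.single_le_sum (f := α) (fun _ _ => Nat.zero_le _)
    (Finset.mem_univ m)).trans h)

/-- The truncated PC expansion `∑_{|α| ≤ d} ⟨B ψ_α(ξ)⟩ ψ_α(ξ(θ))` of a random matrix `B`;
the coefficients `⟨B ψ_α(ξ)⟩` are entrywise expectations. -/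
def pcTrunc {Θ : Type*} [MeasurableSpace Θ] (P : Measure Θ) {R S : Finset Plane} {M : ℕ}
    (d : ℕ) (ξ : Θ → Fin M → ℝ) (B : Θ → Matrix R S ℝ) (θ : Θ) : Matrix R S ℝ :=
  ∑ α ∈ multiIdx M d, psi α (ξ θ) • Matrix.of fun s t => ∫ ω, B ω s t * psi α (ξ ω) ∂P

/-- `c₀ = E exp(a(x,·)) = exp(σ²/2)`. -/
def c0 (σ : ℝ) : ℝ := Real.exp (σ ^ 2 / 2)

/-- The chaos tail `∑_{|α| > d} c₀² (2 ln c₀)^{|α|} / α!` over multi-indices `α ∈ ℕ^M`. -/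
def pcTail (σ : ℝ) (M d : ℕ) : ℝ :=
  ∑' α : {α : Fin M → ℕ // α ∉ multiIdx M d},
    c0 σ ^ 2 * ((2 * Real.log (c0 σ)) ^ (∑ m, α.1 m) / ∏ m, ((α.1 m).factorial : ℝ))

end StochBDDC

end

/-! Let `Bξ` be the local matrix built from the local KL variables `ξ` themselves. The error splits
into `A - Bξ`, the chaos remainder of `Bξ`, and the chaos projection of `Bξ - B`; they are summed in
`IsTriangulation.integral_norm_sub_pcTrunc_sq_le`.

The first and third terms are controlled by coefficient errors in L²(D × Θ). The Frobenius norm of a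
local matrix is at most const/h times the L² norm of its coefficient
(`IsTriangulation.sum_sq_localMatrix_le`), and the chaos projection contracts every entry in L²(P)
by Bessel's inequality. A least squares fit is no further from exp(aM) than the coefficient built
from `ξ`, so passing from `ξ` to `η` costs a factor 4. The global and local truncations are both
compared with exp(a): where the truncated variance is v(x), Gaussian moments give a mean square
error of at most (3/2) exp(2σ²)(σ² - v(x)), and the integral of σ² - v is exactly the eigenvalue
tail, by the trace formula `hasSum_eigenvalues`. That tail is bounded both by the assumption,
quadratic in ε, and by σ²|Ω|; the geometric mean of the two bounds is O(ε h²), which absorbs the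
factor h⁻² (`le_of_le_sq_of_le_mesh`).

The chaos remainder has no power of h to spare, since its tail is only assumed to be O(ε). Here the
Schur test bounds the spectral norm without loss in h (`IsTriangulation.norm_localMatrix_le`), but
it needs a bound on the coefficient that is uniform in x. `exists_expRem_bound` provides it: for
|g|² ≤ σ², Cauchy-Schwarz with weights A^|α| separates the remainder of exp(g · y) into a factor c₀²
`expTail d (A * σ ^ 2)` and a series in y that does not involve g. For A = M ≥ 2 the first factor is
exactly `pcTail`, and the second has mean at most (1 - 1/M)^(-M) ≤ e². The case M = 1 uses A = 2.

Independence of the KL variables comes from the Gaussian Hilbert space: they lie in the closed span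
of the field in L²(P), whose elements are all centred Gaussian, and they are orthonormal
(`map_klVar`). -/

noncomputable section

namespace StochBDDC

/-! ### Hermite polynomials -/

open Polynomial in
-- The generating function is entire in t, so its Taylor series at 0 converges everywhere; complex
-- analysis spares any growth estimate for Hermite polynomials.
theorem hasSum_hermite_mul_pow (x t : ℝ) :
    HasSum (fun n : ℕ => aeval x (hermite n) * t ^ n / (n.factorial : ℝ))
      (Real.exp (t * x - t ^ 2 / 2)) := by
  let f : ℂ → ℂ := fun z => Complex.exp (z * x - z ^ 2 / 2)
  -- The shift x - z makes the induction close: differentiating reproduces the recurrence He_{n+1} =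
  -- X He_n - He_n'.
  have hderiv (n : ℕ) : iteratedDeriv n f = fun z => aeval ((x : ℂ) - z) (hermite n) * f z := by
    induction n with
    | zero => ext z; simp
    | succ n ih =>
      rw [iteratedDeriv_succ, ih]
      ext z
      have h1 : HasDerivAt f (f z * (x - z)) z := by
        have h := (((hasDerivAt_id z).mul_const (x : ℂ)).sub
          (((hasDerivAt_id z).pow 2).div_const 2)).cexp
        refine h.congr_deriv ?_
        simp [f]
      have h2 : HasDerivAt (fun z : ℂ => aeval ((x : ℂ) - z) (hermite n))
          (-aeval ((x : ℂ) - z) (derivative (hermite n))) z := by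
        have h := (Polynomial.hasDerivAt_aeval (hermite n) ((x : ℂ) - z)).comp z
          ((hasDerivAt_id z).const_sub (x : ℂ))
        refine h.congr_deriv (by simp)
      refine (h2.mul h1).deriv.trans ?_
      rw [hermite_succ]
      simp
      ring
  have hf : Differentiable ℂ f := by fun_prop
  have h := Complex.hasSum_taylorSeries_of_entire hf 0 (t : ℂ)
  rw [← Complex.hasSum_ofReal]
  convert! h using 1
  · ext n
    rw [hderiv]
    have h0 : aeval (x : ℂ) (hermite n) = ((aeval x (hermite n) : ℝ) : ℂ) := by
      have := Polynomial.aeval_algebraMap_apply ℂ x (hermite n)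
      simpa using this
    simp [f, ← h0]
    ring
  · simp only [f]
    push_cast
    ring_nf

theorem hasSum_hermiteFun (x t : ℝ) :
    HasSum (fun n : ℕ => Real.exp (t ^ 2 / 2) * (t ^ n / Real.sqrt (n.factorial : ℝ)) *
      hermiteFun n x) (Real.exp (t * x)) := by
  have h := (hasSum_hermite_mul_pow x t).mul_left (Real.exp (t ^ 2 / 2))
  rw [← Real.exp_add] at h
  convert! h using 1
  · ext n
    have hn : (0 : ℝ) < n.factorial := by positivity
    simp only [hermiteFun]
    have := Real.mul_self_sqrt hn.le
    have h2 : Real.sqrt (n.factorial : ℝ) ≠ 0 := by positivity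
    field_simp
    rw [Real.sq_sqrt hn.le]
    field_simp
  · congr 1; ring

open Polynomial in
theorem integrable_aeval_mul_exp_gaussian (p : ℝ[X]) (g : ℝ) :
    Integrable (fun z => p.eval z * Real.exp (g * z)) (gaussianReal 0 1) := by
  induction p using Polynomial.induction_on' with
  | add p q hp hq => simpa only [eval_add, add_mul] using! hp.add hq
  | monomial n c =>
    have h : g ∈ interior (integrableExpSet id (gaussianReal 0 1)) := by
      simp
    have := (integrable_pow_mul_exp_of_mem_interior_integrableExpSet h n).const_mul c
    simpa [mul_assoc] using this

open Polynomial in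
/-- Gaussian integration by parts. -/
theorem integral_stein (p : ℝ[X]) (g : ℝ) :
    ∫ z, (X * p).eval z * Real.exp (g * z) ∂(gaussianReal 0 1) =
      ∫ z, (derivative p + C g * p).eval z * Real.exp (g * z) ∂(gaussianReal 0 1) := by
  rw [← sub_eq_zero, ← integral_sub (integrable_aeval_mul_exp_gaussian _ _)
    (integrable_aeval_mul_exp_gaussian _ _)]
  have hpdf (z : ℝ) : HasDerivAt (gaussianPDFReal 0 1) (-z * gaussianPDFReal 0 1 z) z := by
    simp only [gaussianPDFReal_def]
    have h := ((((hasDerivAt_id z).sub_const (0:ℝ)).pow 2).neg.div_const (2 * ((1 : NNReal) : ℝ))).exp.const_mul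
      ((Real.sqrt (2 * Real.pi * ((1 : NNReal) : ℝ)))⁻¹)
    refine h.congr_deriv ?_
    simp
    ring
  have conv (q : ℝ[X]) : Integrable (fun z => gaussianPDFReal 0 1 z * (q.eval z * Real.exp (g * z))) := by
    have h := integrable_aeval_mul_exp_gaussian q g
    rw [gaussianReal_of_var_ne_zero _ one_ne_zero, integrable_withDensity_iff_integrable_smul₀'
      (by fun_prop) (by simp [gaussianPDF])] at h
    simpa [gaussianPDF, ENNReal.toReal_ofReal (gaussianPDFReal_nonneg _ _ _)] using h
  rw [integral_gaussianReal_eq_integral_smul one_ne_zero]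
  -- The integral over the line of the derivative of density · p · exp(g z) vanishes.
  have key := integral_eq_zero_of_hasDerivAt_of_integrable
    (f := fun z => gaussianPDFReal 0 1 z * (p.eval z * Real.exp (g * z)))
    (f' := fun z => gaussianPDFReal 0 1 z * ((derivative p + C g * p - X * p).eval z * Real.exp (g * z)))
    (fun z => ?_) (conv _) (conv _)
  · rw [← neg_eq_zero, ← integral_neg]
    refine (integral_congr_ae (.of_forall fun z => ?_)).trans key
    simp
    ring
  · have h := (hpdf z).mul ((p.hasDerivAt z).mul (((hasDerivAt_id z).const_mul g).exp))
    refine h.congr_deriv ?_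
    simp
    ring

open Polynomial in
-- Stein's identity applied to He_n · q; the term with He_n' cancels against the Hermite recurrence.
-- The case q = 1 yields the exponential moments, the case g = 0 the orthogonality relations.
theorem integral_hermite_succ (n : ℕ) (q : ℝ[X]) (g : ℝ) :
    ∫ z, aeval z (hermite (n + 1)) * (q.eval z * Real.exp (g * z)) ∂(gaussianReal 0 1) =
      ∫ z, aeval z (hermite n) * ((derivative q + C g * q).eval z * Real.exp (g * z))
        ∂(gaussianReal 0 1) := by
  let H : ℝ[X] := (hermite n).map (Int.castRingHom ℝ)
  have hH (z : ℝ) : aeval z (hermite n) = H.eval z := by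
    simp [H, aeval_def, eval_map]
  have hH' (z : ℝ) : aeval z (hermite (n + 1)) = (X * H - derivative H).eval z := by
    rw [hermite_succ]
    simp [H, aeval_def, eval_map, derivative_map]
  have h := integral_stein (H * q) g
  simp_rw [hH, hH', ← mul_assoc, ← eval_mul]
  have e1 : (X * H - derivative H) * q = X * (H * q) - derivative H * q := by ring
  have e2 : H * (derivative q + C g * q) =
    derivative (H * q) + C g * (H * q) - derivative H * q := by rw [derivative_mul]; ring
  rw [e1, e2]
  have e3 (A B : ℝ[X]) : ∫ z, (A - B).eval z * Real.exp (g * z) ∂(gaussianReal 0 1) =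
      ∫ z, A.eval z * Real.exp (g * z) ∂(gaussianReal 0 1) -
      ∫ z, B.eval z * Real.exp (g * z) ∂(gaussianReal 0 1) := by
    rw [← integral_sub (integrable_aeval_mul_exp_gaussian _ _)
      (integrable_aeval_mul_exp_gaussian _ _)]
    simp [sub_mul]
  rw [e3, e3, h]

open Polynomial in
theorem integral_hermite_mul_exp (n : ℕ) (g : ℝ) :
    ∫ z, aeval z (hermite n) * Real.exp (g * z) ∂(gaussianReal 0 1) =
      g ^ n * Real.exp (g ^ 2 / 2) := by
  induction n with
  | zero =>
    have h := congrFun (mgf_fun_id_gaussianReal (μ := 0) (v := 1)) g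
    simp [mgf] at h
    simp [h]
  | succ n ih =>
    have h := integral_hermite_succ n 1 g
    simp only [eval_one, one_mul, derivative_one, zero_add, mul_one, eval_C] at h
    rw [h]
    simp_rw [mul_left_comm _ g]
    rw [integral_const_mul, ih]
    ring

open Polynomial in
theorem integral_hermite_mul_poly (n : ℕ) (q : ℝ[X]) :
    ∫ z, aeval z (hermite n) * q.eval z ∂(gaussianReal 0 1) =
      ∫ z, (derivative^[n] q).eval z ∂(gaussianReal 0 1) := by
  induction n generalizing q with
  | zero => simp
  | succ n ih =>
    have h := integral_hermite_succ n q 0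
    simp only [zero_mul, Real.exp_zero, mul_one, C_0, add_zero] at h
    rw [h, ih, Function.iterate_succ_apply]

open Polynomial in
-- For n ≤ m, move m derivatives from He_m onto He_n: they annihilate it if n < m and leave the
-- constant n! if n = m.
theorem integral_hermiteFun_mul (m n : ℕ) :
    ∫ z, hermiteFun m z * hermiteFun n z ∂(gaussianReal 0 1) = if m = n then 1 else 0 := by
  wlog hmn : n ≤ m generalizing m n
  · simp_rw [mul_comm (hermiteFun m _), eq_comm (a := m)]
    exact this n m (by omega)
  have hH (z : ℝ) : aeval z (hermite n) = ((hermite n).map (Int.castRingHom ℝ)).eval z := by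
    simp [aeval_def, eval_map]
  have hm : (0 : ℝ) < m.factorial := by positivity
  have hd : ((hermite n).map (Int.castRingHom ℝ)).natDegree ≤ n :=
    natDegree_map_le.trans natDegree_hermite.le
  simp only [hermiteFun, div_mul_div_comm, integral_div]
  have hE : ∫ z, aeval z (hermite m) * aeval z (hermite n) ∂(gaussianReal 0 1) =
      ∫ z, (derivative^[m] ((hermite n).map (Int.castRingHom ℝ))).eval z ∂(gaussianReal 0 1) := by
    rw [← integral_hermite_mul_poly]
    exact integral_congr_ae (.of_forall fun z => by simp [hH])
  rw [hE]
  rcases hmn.eq_or_lt with rfl | h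
  · have h0 : derivative^[n] ((hermite n).map (Int.castRingHom ℝ)) = C (n.factorial : ℝ) := by
      rw [eq_C_of_natDegree_le_zero ((natDegree_iterate_derivative _ _).trans (by omega)),
        coeff_iterate_derivative]
      simp [Nat.descFactorial_self, coeff_hermite_self]
    have hm : (0 : ℝ) < n.factorial := by positivity
    rw [h0, Real.mul_self_sqrt hm.le]
    simp [hm.ne']
  · rw [iterate_derivative_eq_zero (by omega)]
    simp [h.ne']

open Polynomial in
theorem memLp_hermiteFun (n : ℕ) : MemLp (hermiteFun n) 2 (gaussianReal 0 1) := by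
  have hH (z : ℝ) : aeval z (hermite n) = ((hermite n).map (Int.castRingHom ℝ)).eval z := by
    simp [aeval_def, eval_map]
  have hc : Continuous (hermiteFun n) := by
    unfold hermiteFun
    simp_rw [hH]
    fun_prop
  rw [memLp_two_iff_integrable_sq hc.aestronglyMeasurable]
  have h := (integrable_aeval_mul_exp_gaussian
    (((hermite n).map (Int.castRingHom ℝ)) ^ 2) 0).div_const (Real.sqrt n.factorial ^ 2)
  simpa [hermiteFun, div_pow, hH] using h

theorem integral_exp_mul_hermiteFun (n : ℕ) (g : ℝ) :
    ∫ z, Real.exp (g * z) * hermiteFun n z ∂(gaussianReal 0 1) =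
      Real.exp (g ^ 2 / 2) * (g ^ n / Real.sqrt (n.factorial : ℝ)) := by
  have h := integral_hermite_mul_exp n g
  simp only [hermiteFun, mul_div_assoc', integral_div]
  simp_rw [mul_comm (Real.exp _)]
  rw [h]

/-! ### Polynomial chaos of the exponential of a Gaussian vector -/

/-- Split off one coordinate at a time; real summable series are absolutely summable, so their
products may be multiplied out. -/
theorem hasSum_pi_prod {M : ℕ} (f : Fin M → ℕ → ℝ) (s : Fin M → ℝ)
    (hs : ∀ m, HasSum (f m) (s m)) :
    HasSum (fun α : Fin M → ℕ => ∏ m, f m (α m)) (∏ m, s m) := by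
  induction M with
  | zero => simp
  | succ M ih =>
    have h1 := ih (fun m => f m.succ) (fun m => s m.succ) (fun m => hs _)
    have h0 : Summable fun n => ‖f 0 n‖ := (hs 0).summable.norm
    have h1' : Summable fun α : Fin M → ℕ => ‖∏ m, f m.succ (α m)‖ := h1.summable.norm
    have hs2 : Summable fun x : ℕ × (Fin M → ℕ) => f 0 x.1 * ∏ m, f m.succ (x.2 m) := by
      apply summable_mul_of_summable_norm h0 h1'
    have h2 := (hs 0).mul h1 hs2
    rw [← (Fin.consEquiv fun _ : Fin (M + 1) => ℕ).hasSum_iff]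
    rw [Fin.prod_univ_succ]
    refine h2.congr_fun fun α => ?_
    simp [Fin.prod_univ_succ, Fin.consEquiv]

/-- The tail `∑_{n > d} S ^ n / n!` of the exponential series. -/
def expTail (d : ℕ) (S : ℝ) : ℝ := ∑' n : ℕ, S ^ (n + (d + 1)) / ((n + (d + 1)).factorial : ℝ)

theorem hasSum_expTail (d : ℕ) (S : ℝ) :
    HasSum (fun n : ℕ => S ^ (n + (d + 1)) / ((n + (d + 1)).factorial : ℝ)) (expTail d S) :=
  ((summable_nat_add_iff (d + 1)).2 (Real.summable_pow_div_factorial S)).hasSum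

theorem hasSum_exp (S : ℝ) : HasSum (fun n : ℕ => S ^ n / (n.factorial : ℝ)) (Real.exp S) := by
  rw [Real.exp_eq_exp_ℝ]
  exact NormedSpace.expSeries_div_hasSum_exp S

theorem expTail_eq (d : ℕ) (S : ℝ) :
    expTail d S = Real.exp S - ∑ n ∈ Finset.range (d + 1), S ^ n / (n.factorial : ℝ) := by
  have h := (hasSum_nat_add_iff' (d + 1)).2 (hasSum_exp S)
  exact (hasSum_expTail d S).unique h

theorem expTail_mono (d : ℕ) {S S' : ℝ} (h0 : 0 ≤ S) (h : S ≤ S') : expTail d S ≤ expTail d S' :=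
  hasSum_le (fun n => by gcongr) (hasSum_expTail d S) (hasSum_expTail d S')

theorem expTail_nonneg (d : ℕ) {S : ℝ} (h0 : 0 ≤ S) : 0 ≤ expTail d S :=
  tsum_nonneg fun n => by positivity

/-- Both sides are compared with the leading term of the tail: (d+1)! n! ≤ (n+d+1)! bounds the left
tail by its leading term times the exponential, and the right tail dominates its own leading term.
-/
theorem expTail_two_mul_le (d : ℕ) {S : ℝ} (h0 : 0 ≤ S) :
    expTail d (2 * S) ≤ 2 ^ (d + 1) * Real.exp (2 * S) * expTail d S := by
  have h1 : S ^ (d + 1) / ((d + 1).factorial : ℝ) ≤ expTail d S := by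
    have := (hasSum_expTail d S).summable.le_tsum 0 (fun n _ => by positivity)
    simpa using! this
  have h2 : expTail d (2 * S) ≤ (2 * S) ^ (d + 1) / ((d + 1).factorial : ℝ) * Real.exp (2 * S) := by
    refine hasSum_le (fun n => ?_) (hasSum_expTail d (2 * S))
      ((hasSum_exp (2 * S)).mul_left _)
    rw [div_mul_div_comm, pow_add, mul_comm ((2 * S) ^ n)]
    have : ((d + 1).factorial : ℝ) * n.factorial ≤ (n + (d + 1)).factorial := by
      rw [add_comm n]
      exact_mod_cast Nat.le_of_dvd (Nat.factorial_pos _) (Nat.factorial_mul_factorial_dvd_factorial_add _ _)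
    gcongr
  calc _ ≤ _ := h2
    _ = 2 ^ (d + 1) * Real.exp (2 * S) * (S ^ (d + 1) / ((d + 1).factorial : ℝ)) := by
      rw [mul_pow]; ring
    _ ≤ _ := by gcongr

/-- The multinomial theorem, one total degree at a time. It collapses chaos tails over multi-indices
to a one-variable exponential tail. -/
theorem sum_multiIdx_prod {M d : ℕ} (x : Fin M → ℝ) :
    ∑ α ∈ multiIdx M d, ∏ m, x m ^ α m / ((α m).factorial : ℝ) =
      ∑ n ∈ Finset.range (d + 1), (∑ m, x m) ^ n / (n.factorial : ℝ) := by
  rw [← Finset.sum_fiberwise_of_maps_to (g := fun α : Fin M → ℕ => ∑ m, α m)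
    (t := Finset.range (d + 1)) (fun α hα => by
      rw [mem_multiIdx] at hα
      simpa [Nat.lt_succ_iff] using hα)]
  refine Finset.sum_congr rfl fun n hn => ?_
  have hset : (multiIdx M d).filter (fun α => ∑ m, α m = n) =
      Finset.piAntidiag Finset.univ n := by
    ext α
    simp only [Finset.mem_filter, mem_multiIdx, Finset.mem_piAntidiag, Finset.mem_univ,
      implies_true, and_true, and_iff_right_iff_imp, Finset.mem_range] at hn ⊢
    omega
  rw [hset, Finset.sum_pow_eq_sum_piAntidiag, Finset.sum_div]
  refine Finset.sum_congr rfl fun α hα => ?_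
  rw [Finset.prod_div_distrib]
  have hs := Nat.multinomial_spec Finset.univ α
  rw [(Finset.mem_piAntidiag.1 hα).1] at hs
  rw [← hs]
  have h1 : (∏ m, ((α m).factorial : ℝ)) ≠ 0 :=
    Finset.prod_ne_zero_iff.2 fun m _ => by positivity
  have h2 : (Nat.multinomial Finset.univ α : ℝ) ≠ 0 := by
    exact_mod_cast (Nat.multinomial_pos _ _).ne'
  push_cast
  field_simp

theorem hasSum_compl_multiIdx {M d : ℕ} (x : Fin M → ℝ) :
    HasSum (fun α : {α : Fin M → ℕ // α ∉ multiIdx M d} =>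
      ∏ m, x m ^ α.1 m / ((α.1 m).factorial : ℝ)) (expTail d (∑ m, x m)) := by
  rw [expTail_eq, ← sum_multiIdx_prod, Real.exp_sum]
  have h := hasSum_pi_prod (fun m n => x m ^ n / (n.factorial : ℝ)) (fun m => Real.exp (x m))
    (fun m => hasSum_exp _)
  rw [← sub_add_cancel (∏ m, Real.exp (x m))
    (∑ α ∈ multiIdx M d, ∏ m, x m ^ α m / ((α m).factorial : ℝ))] at h
  exact (Finset.hasSum_compl_iff
    (f := fun α : Fin M → ℕ => ∏ m, x m ^ α m / ((α m).factorial : ℝ)) _).2 h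

theorem two_mul_log_c0 (σ : ℝ) : 2 * Real.log (c0 σ) = σ ^ 2 := by
  rw [c0, Real.log_exp]; ring

theorem c0_sq (σ : ℝ) : c0 σ ^ 2 = Real.exp (σ ^ 2) := by
  rw [c0, ← Real.exp_nat_mul]; congr 1; push_cast; ring

/-- Since 2 ln c₀ = σ², every coordinate contributes σ², whence the argument Mσ². This is the value
that the weight A = M must reproduce in `exists_expRem_bound`. -/
theorem pcTail_eq (σ : ℝ) (M d : ℕ) : pcTail σ M d = c0 σ ^ 2 * expTail d (M * σ ^ 2) := by
  have h := (hasSum_compl_multiIdx (d := d) (fun _ : Fin M => σ ^ 2)).mul_left (c0 σ ^ 2)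
  rw [pcTail, two_mul_log_c0]
  simp only [Finset.prod_div_distrib, Finset.prod_pow_eq_pow_sum] at h
  simpa using h.tsum_eq

theorem pcTail_nonneg (σ : ℝ) (M d : ℕ) : 0 ≤ pcTail σ M d := by
  rw [pcTail_eq]
  have := expTail_nonneg d (S := M * σ ^ 2) (by positivity)
  positivity

/-- The law of `M` independent standard normal variables. -/
abbrev stdGaussianPi (M : ℕ) : Measure (Fin M → ℝ) := Measure.pi fun _ => gaussianReal 0 1

theorem continuous_hermiteFun (n : ℕ) : Continuous (hermiteFun n) := by
  unfold hermiteFun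
  fun_prop

theorem continuous_psi {M : ℕ} (α : Fin M → ℕ) : Continuous (psi α) := by
  unfold psi
  have := continuous_hermiteFun
  fun_prop

theorem integral_psi_mul_psi {M : ℕ} (α β : Fin M → ℕ) :
    ∫ y, psi α y * psi β y ∂(stdGaussianPi M) = if α = β then 1 else 0 := by
  simp only [psi, ← Finset.prod_mul_distrib]
  rw [integral_fintype_prod_eq_prod (fun m z => hermiteFun (α m) z * hermiteFun (β m) z)]
  simp only [integral_hermiteFun_mul, Finset.prod_ite_zero]
  simp [funext_iff]

theorem memLp_psi {M : ℕ} (α : Fin M → ℕ) : MemLp (psi α) 2 (stdGaussianPi M) := by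
  rw [memLp_two_iff_integrable_sq (continuous_psi α).aestronglyMeasurable]
  simp only [psi, ← Finset.prod_pow]
  exact Integrable.fintype_prod (fun m => (memLp_hermiteFun (α m)).integrable_sq)

/-- The chaos coefficient `E (exp (g · ξ) ψ_α(ξ))`. -/
def expCoeff {M : ℕ} (α : Fin M → ℕ) (g : Fin M → ℝ) : ℝ :=
  ∏ m, Real.exp (g m ^ 2 / 2) * (g m ^ α m / Real.sqrt ((α m).factorial : ℝ))

theorem integral_exp_mul_psi {M : ℕ} (α : Fin M → ℕ) (g : Fin M → ℝ) :
    ∫ y, Real.exp (∑ m, g m * y m) * psi α y ∂(stdGaussianPi M) = expCoeff α g := by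
  simp only [psi, Real.exp_sum, ← Finset.prod_mul_distrib]
  rw [integral_fintype_prod_eq_prod (fun m z => Real.exp (g m * z) * hermiteFun (α m) z)]
  simp only [integral_exp_mul_hermiteFun, expCoeff]

theorem hasSum_expCoeff_mul_psi {M : ℕ} (g y : Fin M → ℝ) :
    HasSum (fun α => expCoeff α g * psi α y) (Real.exp (∑ m, g m * y m)) := by
  have h := hasSum_pi_prod _ _ (fun m => hasSum_hermiteFun (y m) (g m))
  simpa only [expCoeff, psi, ← Finset.prod_mul_distrib, Real.exp_sum] using h

theorem expCoeff_sq {M : ℕ} (α : Fin M → ℕ) (g : Fin M → ℝ) :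
    expCoeff α g ^ 2 =
      Real.exp (∑ m, g m ^ 2) * ∏ m, (g m ^ 2) ^ α m / ((α m).factorial : ℝ) := by
  rw [expCoeff, ← Finset.prod_pow, Real.exp_sum, ← Finset.prod_mul_distrib]
  refine Finset.prod_congr rfl fun m _ => ?_
  rw [mul_pow, div_pow, Real.sq_sqrt (by positivity), ← Real.exp_nat_mul, ← pow_mul, ← pow_mul,
    mul_comm 2 (α m)]
  congr 2
  push_cast
  ring

/-- The remainder of the truncated chaos expansion of `exp (g · y)`. -/
def expRem {M : ℕ} (d : ℕ) (g y : Fin M → ℝ) : ℝ :=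
  Real.exp (∑ m, g m * y m) - ∑ α ∈ multiIdx M d, expCoeff α g * psi α y

/-- A weighted square function of the chaos of order larger than `d`. -/
def chaosSq (M d : ℕ) (A : ℝ) (y : Fin M → ℝ) : ENNReal :=
  ∑' α : {α : Fin M → ℕ // α ∉ multiIdx M d}, ENNReal.ofReal (psi α.1 y ^ 2 * ∏ m, (A⁻¹) ^ α.1 m)

/-- Cauchy-Schwarz on finite partial sums of the remainder, with A^|α| on the squared coefficients
and A^(-|α|) on the squared polynomials, followed by a limit. All dependence on g is confined to the
first factor, where monotonicity replaces |g|² by σ². -/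
theorem ofReal_expRem_sq_le {M : ℕ} (d : ℕ) {σ A : ℝ} (hA : 0 < A) {g : Fin M → ℝ}
    (hg : ∑ m, g m ^ 2 ≤ σ ^ 2) (y : Fin M → ℝ) :
    ENNReal.ofReal (expRem d g y ^ 2) ≤
      ENNReal.ofReal (c0 σ ^ 2 * expTail d (A * σ ^ 2)) * chaosSq M d A y := by
  have hsum : HasSum (fun α : {α : Fin M → ℕ // α ∉ multiIdx M d} =>
      expCoeff α.1 g * psi α.1 y) (expRem d g y) := by
    have h := hasSum_expCoeff_mul_psi g y
    rw [← sub_add_cancel (Real.exp _) (∑ α ∈ multiIdx M d, expCoeff α g * psi α y)] at h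
    exact (Finset.hasSum_compl_iff (f := fun α : Fin M → ℕ => expCoeff α g * psi α y) _).2 h
  have hS0 : 0 ≤ ∑ m, g m ^ 2 := Finset.sum_nonneg fun m _ => sq_nonneg _
  refine le_of_tendsto (ENNReal.tendsto_ofReal (hsum.pow 2)) (.of_forall fun F => ?_)
  have hcs := Finset.sum_sq_le_sum_mul_sum_of_sq_le_mul F
    (r := fun α => expCoeff α.1 g * psi α.1 y)
    (f := fun α => expCoeff α.1 g ^ 2 * ∏ m, A ^ α.1 m)
    (g := fun α => psi α.1 y ^ 2 * ∏ m, (A⁻¹) ^ α.1 m)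
    (fun α _ => by positivity) (fun α _ => by positivity) (fun α _ => le_of_eq <| by
      have : (∏ m, A ^ α.1 m) * ∏ m, (A⁻¹) ^ α.1 m = 1 := by
        rw [← Finset.prod_mul_distrib]
        exact Finset.prod_eq_one fun m _ => by
          rw [← mul_pow, mul_inv_cancel₀ hA.ne', one_pow]
      rw [mul_pow, mul_mul_mul_comm, this, mul_one])
  refine (ENNReal.ofReal_le_ofReal hcs).trans ?_
  rw [ENNReal.ofReal_mul (Finset.sum_nonneg fun α _ => by positivity)]
  refine mul_le_mul' (ENNReal.ofReal_le_ofReal ?_) ?_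
  · have h := (hasSum_compl_multiIdx (d := d) (fun m => A * g m ^ 2)).mul_left
      (Real.exp (∑ m, g m ^ 2))
    have hle := sum_le_hasSum F (fun α _ => by positivity) h
    refine le_trans (Finset.sum_le_sum fun α _ => le_of_eq ?_) (hle.trans ?_)
    · rw [expCoeff_sq, mul_assoc, ← Finset.prod_mul_distrib]
      congr 1
      refine Finset.prod_congr rfl fun m _ => ?_
      rw [mul_pow]; ring
    · rw [c0_sq, ← Finset.mul_sum]
      gcongr
      · exact expTail_nonneg d (by positivity)
      · exact expTail_mono d (by positivity) (by gcongr)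
  · rw [ENNReal.ofReal_sum_of_nonneg fun α _ => by positivity]
    exact ENNReal.sum_le_tsum F

theorem measurable_chaosSq (M d : ℕ) (A : ℝ) : Measurable (chaosSq M d A) := by
  unfold chaosSq
  refine Measurable.tsum fun α => ?_
  have := (continuous_psi α.1).measurable
  fun_prop

theorem lintegral_chaosSq {M d : ℕ} {A : ℝ} (hA : 0 < A) :
    ∫⁻ y, chaosSq M d A y ∂(stdGaussianPi M) =
      ∑' α : {α : Fin M → ℕ // α ∉ multiIdx M d}, ENNReal.ofReal (∏ m, (A⁻¹) ^ α.1 m) := by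
  unfold chaosSq
  rw [lintegral_tsum fun α => by
    have := (continuous_psi α.1).measurable
    fun_prop]
  congr 1
  ext α
  rw [← ofReal_integral_eq_lintegral_ofReal
    ((memLp_psi α.1).integrable_sq.mul_const _) (.of_forall fun y => by positivity),
    integral_mul_const]
  have := integral_psi_mul_psi α.1 α.1
  simp only [if_true, ← sq] at this
  rw [this, one_mul]

/-- A bound for the chaos remainder that is uniform in the coefficients `g`. -/
theorem exists_expRem_bound (σ : ℝ) (M d : ℕ) :
    ∃ G : (Fin M → ℝ) → ENNReal, Measurable G ∧
      (∀ g : Fin M → ℝ, ∑ m, g m ^ 2 ≤ σ ^ 2 → ∀ y, ENNReal.ofReal (expRem d g y ^ 2) ≤ G y) ∧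
      ∫⁻ y, G y ∂(stdGaussianPi M) ≤
        ENNReal.ofReal ((2 * Real.exp (2 * σ ^ 2) + Real.exp 2) * pcTail σ M d) := by
  -- A weight A is admissible once K bounds the mean of the square function and the product of both
  -- factors stays below the target.
  have key (A K : ℝ) (hA : 0 < A) (hK : 0 ≤ K)
      (h1 : ∑' α : {α : Fin M → ℕ // α ∉ multiIdx M d}, ENNReal.ofReal (∏ m, (A⁻¹) ^ α.1 m) ≤
        ENNReal.ofReal K)
      (h2 : expTail d (A * σ ^ 2) * K ≤
        (2 * Real.exp (2 * σ ^ 2) + Real.exp 2) * expTail d (M * σ ^ 2)) :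
      ∃ G : (Fin M → ℝ) → ENNReal, Measurable G ∧
      (∀ g : Fin M → ℝ, ∑ m, g m ^ 2 ≤ σ ^ 2 → ∀ y, ENNReal.ofReal (expRem d g y ^ 2) ≤ G y) ∧
      ∫⁻ y, G y ∂(stdGaussianPi M) ≤
        ENNReal.ofReal ((2 * Real.exp (2 * σ ^ 2) + Real.exp 2) * pcTail σ M d) := by
    refine ⟨_, (measurable_chaosSq M d A).const_mul _, fun g hg y =>
      ofReal_expRem_sq_le d hA hg y, ?_⟩
    rw [lintegral_const_mul _ (measurable_chaosSq M d A), lintegral_chaosSq hA]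
    refine (mul_le_mul' le_rfl h1).trans ?_
    have := expTail_nonneg d (S := A * σ ^ 2) (by positivity)
    rw [← ENNReal.ofReal_mul (by positivity), pcTail_eq]
    refine ENNReal.ofReal_le_ofReal ?_
    calc _ = c0 σ ^ 2 * (expTail d (A * σ ^ 2) * K) := by ring
      _ ≤ c0 σ ^ 2 * ((2 * Real.exp (2 * σ ^ 2) + Real.exp 2) * expTail d (M * σ ^ 2)) := by gcongr
      _ = _ := by ring
  rcases Nat.lt_or_ge M 2 with hM | hM
  -- For M = 1 the weight A = M would make the geometric series diverge. With A = 2 the sum over n >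
  -- d is 2^(-d), which compensates the 2^(d+1) of `expTail_two_mul_le`. For M = 0 no index is left,
  -- matching the factor M in K.
  · refine key 2 (2⁻¹ ^ d * M) two_pos (by positivity) ?_ ?_
    · interval_cases M
      · have : IsEmpty {α : Fin 0 → ℕ // α ∉ multiIdx 0 d} := ⟨fun α => α.2 (by simp [mem_multiIdx])⟩
        simp
      · have h := (hasSum_geometric_of_lt_one (r := (2⁻¹ : ℝ)) (by norm_num) (by norm_num)).mul_left
          (2⁻¹ ^ (d + 1))
        let e : ℕ ≃ {α : Fin 1 → ℕ // α ∉ multiIdx 1 d} :=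
          { toFun := fun n => ⟨fun _ => n + (d + 1), by simp [mem_multiIdx]; omega⟩
            invFun := fun α => α.1 0 - (d + 1)
            left_inv := fun n => by simp
            right_inv := fun α => by
              obtain ⟨α, hα⟩ := α
              simp only [mem_multiIdx, Fin.sum_univ_one, not_le] at hα
              ext i
              fin_cases i
              simp
              omega }
        rw [← e.tsum_eq, ← ENNReal.ofReal_tsum_of_nonneg (fun n => by positivity)]
        · refine ENNReal.ofReal_le_ofReal (le_of_eq ?_)
          rw [show (2⁻¹ : ℝ) ^ d * (1 : ℕ) = 2⁻¹ ^ (d + 1) * (1 - 2⁻¹)⁻¹ by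
            rw [pow_succ]; norm_num; ring, ← h.tsum_eq]
          congr 1
          ext n
          simp [e, pow_add, mul_comm]
        · refine h.summable.congr fun n => ?_
          simp [e, pow_add, mul_comm]
    · interval_cases M
      · simp
        have := expTail_nonneg d (S := (0 : ℝ)) le_rfl
        positivity
      · have h := expTail_two_mul_le d (sq_nonneg σ)
        have h0 := expTail_nonneg d (sq_nonneg σ)
        have h2 : (2 : ℝ)⁻¹ ^ d * 2 ^ (d + 1) = 2 := by
          rw [pow_succ, ← mul_assoc, ← mul_pow]; norm_num
        calc _ ≤ (2 ^ (d + 1) * Real.exp (2 * σ ^ 2) * expTail d (σ ^ 2)) * (2⁻¹ ^ d * (1 : ℕ)) := by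
              gcongr
          _ = (2⁻¹ ^ d * 2 ^ (d + 1)) * Real.exp (2 * σ ^ 2) * expTail d (σ ^ 2) := by
              push_cast; ring
          _ ≤ _ := by
              rw [h2]
              push_cast
              rw [one_mul]
              gcongr
              linarith [Real.exp_pos 2]
  · have hM' : (2 : ℝ) ≤ M := by exact_mod_cast hM
    have hr : (M : ℝ)⁻¹ < 1 := inv_lt_one_of_one_lt₀ (by linarith)
    have hM0 : (0 : ℝ) < M := by linarith
    -- With A = M the exponential tail is already the one in `pcTail`. The geometric sum is (1 -
    -- 1/M)^(-M), and 1/(1 - 1/M) = 1 + 1/(M-1) ≤ 1 + 2/M ≤ exp(2/M) because M ≥ 2.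
    refine key M (Real.exp 2) hM0 (by positivity) ?_ ?_
    · have h := hasSum_pi_prod (fun _ : Fin M => fun n => ((M : ℝ)⁻¹) ^ n)
        (fun _ => (1 - (M : ℝ)⁻¹)⁻¹) (fun _ => hasSum_geometric_of_lt_one (by positivity) hr)
      have hinj : Function.Injective
        (Subtype.val : {α : Fin M → ℕ // α ∉ multiIdx M d} → Fin M → ℕ) := Subtype.val_injective
      rw [← ENNReal.ofReal_tsum_of_nonneg (fun α => Finset.prod_nonneg fun m _ => by positivity)
        (h.summable.comp_injective hinj :)]
      refine ENNReal.ofReal_le_ofReal ?_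
      refine (tsum_comp_le_tsum_of_inj h.summable (fun α => by positivity) hinj).trans ?_
      rw [h.tsum_eq]
      simp only [Finset.prod_const, Finset.card_univ, Fintype.card_fin]
      have h1 : (1 - (M : ℝ)⁻¹)⁻¹ ≤ Real.exp (2 / M) := by
        have hx : (1 - (M : ℝ)⁻¹)⁻¹ = 1 / (M - 1) + 1 := by
          have : (M : ℝ) - 1 ≠ 0 := by linarith
          field_simp
          ring
        rw [hx]
        refine le_trans ?_ (Real.add_one_le_exp _)
        gcongr ?_ + 1
        rw [div_le_div_iff₀ (by linarith) hM0]
        linarith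
      calc _ ≤ Real.exp (2 / M) ^ M := pow_le_pow_left₀ (inv_nonneg.2 (by linarith)) h1 _
        _ = Real.exp 2 := by
          rw [← Real.exp_nat_mul]; congr 1; field_simp
    · have := expTail_nonneg d (S := M * σ ^ 2) (by positivity)
      rw [mul_comm]
      gcongr
      linarith [Real.exp_pos (2 * σ ^ 2)]

/-! ### Gradients of the nodal basis -/

section Mesh

variable {T : Geometry.SimplicialComplex ℝ Plane}

/-- The vertices of an element form an affine basis of the plane. -/
def elementBasis {K : Finset Plane} (hK : K ∈ elements T) : AffineBasis K ℝ Plane :=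
  ⟨((↑) : K → Plane), T.indep hK.1, by
    rw [(T.indep hK.1).affineSpan_eq_top_iff_card_eq_finrank_add_one]
    simp [hK.2]⟩

theorem elementBasis_apply {K : Finset Plane} (hK : K ∈ elements T) (i : K) :
    elementBasis hK i = (i : Plane) := rfl

theorem range_elementBasis {K : Finset Plane} (hK : K ∈ elements T) :
    range (elementBasis hK) = (K : Set Plane) := by
  ext x
  simp [elementBasis_apply]

theorem mem_interior_element_iff {K : Finset Plane} (hK : K ∈ elements T) {x : Plane} :
    x ∈ interior (convexHull ℝ (K : Set Plane)) ↔ ∀ i, 0 < (elementBasis hK).coord i x := by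
  rw [← range_elementBasis hK, AffineBasis.interior_convexHull]
  rfl

theorem mem_element_iff {K : Finset Plane} (hK : K ∈ elements T) {x : Plane} :
    x ∈ convexHull ℝ (K : Set Plane) ↔ ∀ i, 0 ≤ (elementBasis hK).coord i x := by
  rw [← range_elementBasis hK, AffineBasis.convexHull_eq_nonneg_coord]
  rfl

theorem coord_eq_of_sum_eq {K : Finset Plane} (hK : K ∈ elements T) {w : Plane → ℝ} {x : Plane}
    (h1 : ∑ y ∈ K, w y = 1) (h2 : ∑ y ∈ K, w y • y = x) (i : K) :
    (elementBasis hK).coord i x = w i := by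
  have hs : ∑ j : K, w j = 1 := by rw [Finset.sum_coe_sort K w]; exact h1
  have h := (elementBasis hK).coord_apply_combination_of_mem (Finset.mem_univ i)
    (w := fun j : K => w j) hs
  rw [Finset.affineCombination_eq_linear_combination _ _ _ hs] at h
  simp only [elementBasis_apply] at h
  rw [Finset.sum_coe_sort K (fun y => w y • y), h2] at h
  exact h

open Classical in
/-- The barycentric coordinate of `v` in the element `K`, zero if `v` is not a vertex of `K`. -/
def baryCoord {K : Finset Plane} (hK : K ∈ elements T) (v x : Plane) : ℝ :=
  if h : v ∈ K then (elementBasis hK).coord ⟨v, h⟩ x else 0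

/-- Conformity puts a common point in the hull of the common vertices. If the triangles differ, some
vertex of `K` is missing there, so its barycentric coordinate vanishes, which is impossible in the
interior. -/
theorem eq_of_mem_interior_element {K K' : Finset Plane} (hK : K ∈ elements T)
    (hK' : K' ∈ elements T) {x : Plane} (hx : x ∈ interior (convexHull ℝ (K : Set Plane)))
    (hx' : x ∈ convexHull ℝ (K' : Set Plane)) : K = K' := by
  by_contra hne
  obtain ⟨y, hyK, hyK'⟩ : ∃ y ∈ K, y ∉ K' := by
    by_contra! hsub
    exact hne (Finset.eq_of_subset_of_card_le hsub (by rw [hK.2, hK'.2]))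
  have hmem := T.inter_subset_convexHull hK.1 hK'.1 ⟨interior_subset hx, hx'⟩
  have hzero : convexHull ℝ ((K : Set Plane) ∩ K') ⊆
      (elementBasis hK).coord ⟨y, hyK⟩ ⁻¹' {0} := by
    refine convexHull_min (fun z hz => ?_) ((convex_singleton 0).affine_preimage _)
    have hzy : (⟨y, hyK⟩ : K) ≠ ⟨z, hz.1⟩ := fun h => hyK' (by
      have := congrArg Subtype.val h
      simp only at this
      rw [this]; exact hz.2)
    have h := (elementBasis hK).coord_apply_ne hzy
    rw [elementBasis_apply] at h
    rwa [mem_preimage, mem_singleton_iff]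
  have h0 : (elementBasis hK).coord ⟨y, hyK⟩ x = 0 := hzero hmem
  exact ((mem_interior_element_iff hK).1 hx ⟨y, hyK⟩).ne' h0

theorem IsNodalValue.eq_baryCoord {K : Finset Plane} (hK : K ∈ elements T) {x v : Plane} {t : ℝ}
    (hx : x ∈ interior (convexHull ℝ (K : Set Plane))) (h : IsNodalValue T v x t) :
    t = baryCoord hK v x := by
  obtain ⟨K', hK', w, w0, wn, w1, wx, rfl⟩ := h
  have hx' : x ∈ convexHull ℝ (K' : Set Plane) := by
    refine (mem_element_iff hK').2 fun i => ?_
    rw [coord_eq_of_sum_eq hK' w1 wx]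
    exact w0 _ i.2
  obtain rfl := eq_of_mem_interior_element hK hK' hx hx'
  unfold baryCoord
  split_ifs with hv
  · exact (coord_eq_of_sum_eq hK w1 wx ⟨v, hv⟩).symm
  · exact wn v hv

theorem isNodalValue_baryCoord {K : Finset Plane} (hK : K ∈ elements T) {x : Plane} (v : Plane)
    (hx : x ∈ convexHull ℝ (K : Set Plane)) : IsNodalValue T v x (baryCoord hK v x) := by
  refine ⟨K, hK, fun y => baryCoord hK y x, fun y hy => ?_, fun y hy => ?_, ?_, ?_, rfl⟩
  · simp only [baryCoord, hy, dif_pos]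
    exact (mem_element_iff hK).1 hx _
  · simp [baryCoord, hy]
  · rw [← Finset.sum_coe_sort]
    simpa [baryCoord] using (elementBasis hK).sum_coord_apply_eq_one x
  · rw [← Finset.sum_coe_sort]
    simpa [baryCoord] using! (elementBasis hK).linear_combination_coord_eq_self x

/-- Inside an element the nodal value is unique, so the choice made in `hat` is harmless. On shared
edges, a null set, no statement is needed. -/
theorem hat_eq_baryCoord {K : Finset Plane} (hK : K ∈ elements T) {x : Plane} (v : Plane)
    (hx : x ∈ interior (convexHull ℝ (K : Set Plane))) : hat T v x = baryCoord hK v x := by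
  have h : ∃ t, IsNodalValue T v x t := ⟨_, isNodalValue_baryCoord hK v (interior_subset hx)⟩
  rw [hat, dif_pos h]
  exact h.choose_spec.eq_baryCoord hK hx

/-- An affine function with values in `[0, 1]` on a disc of radius `ρ` has slope at most `1/ρ`. -/
theorem abs_affine_sub_le {f : Plane →ᵃ[ℝ] ℝ} {c : Plane} {ρ : ℝ} (hρ : 0 < ρ)
    (hf : ∀ y ∈ Metric.closedBall c ρ, f y ∈ Icc (0 : ℝ) 1) (x y : Plane) :
    |f x - f y| ≤ ρ⁻¹ * ‖x - y‖ := by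
  have hL (u v : Plane) : f u - f v = f.linear (u - v) := by
    simpa using (f.linearMap_vsub u v).symm
  rw [hL]
  set u := x - y
  rcases eq_or_ne u 0 with hu | hu
  · simp [hu]
  have hu' : 0 < ‖u‖ := norm_pos_iff.2 hu
  -- Step from the centre to the boundary of the disc in the direction u: the value changes by at
  -- most 1 over a distance ρ.
  have h1 := hf (c + (ρ / ‖u‖) • u) (by
    rw [Metric.mem_closedBall, dist_eq_norm, add_sub_cancel_left, norm_smul, Real.norm_eq_abs,
      abs_of_pos (by positivity)]
    field_simp
    rfl)
  have h2 := hf c (Metric.mem_closedBall_self hρ.le)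
  have h3 := hL (c + (ρ / ‖u‖) • u) c
  rw [add_sub_cancel_left, map_smul, smul_eq_mul] at h3
  have h4 : |ρ / ‖u‖ * f.linear u| ≤ 1 := by
    rw [← h3, abs_le]
    constructor <;> linarith [h1.1, h1.2, h2.1, h2.2]
  rw [abs_mul, abs_of_pos (by positivity)] at h4
  rw [inv_mul_eq_div, le_div_iff₀ hρ]
  have h5 : ρ / ‖u‖ * |f.linear u| = (|f.linear u| * ρ) / ‖u‖ := by ring
  rw [h5, div_le_one hu'] at h4
  exact h4

theorem norm_gradient (f : Plane → ℝ) (x : Plane) : ‖∇ f x‖ = ‖fderiv ℝ f x‖ := by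
  simp [gradient]

variable {Ω : Set Plane} {γ h : ℝ}

open Classical in
-- Barycentric coordinates take values in [0, 1] on the inscribed disc, whose radius is at least γ ·
-- γh by shape regularity and quasi-uniformity.
theorem IsTriangulation.norm_gradient_hat_le (hT : IsTriangulation T Ω γ h) (hγ : 0 < γ)
    (hh : 0 < h) {K : Finset Plane} (hK : K ∈ elements T) {x : Plane}
    (hx : x ∈ interior (convexHull ℝ (K : Set Plane))) (v : Plane) :
    ‖∇ (hat T v) x‖ ≤ if v ∈ K then (γ ^ 2 * h)⁻¹ else 0 := by
  rw [norm_gradient]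
  have hev : hat T v =ᶠ[𝓝 x] baryCoord hK v := by
    filter_upwards [isOpen_interior.mem_nhds hx] with y hy using hat_eq_baryCoord hK v hy
  rw [hev.fderiv_eq]
  split_ifs with hv
  · refine norm_fderiv_le_of_lip' ℝ (by positivity) (.of_forall fun y => ?_)
    obtain ⟨c, hc⟩ := hT.shape_regular K hK
    have hq := hT.quasi_uniform K hK
    have hρ : 0 < γ ^ 2 * h := by positivity
    have hρ' : γ ^ 2 * h ≤ γ * Metric.diam (convexHull ℝ (K : Set Plane)) := by
      calc γ ^ 2 * h = γ * (γ * h) := by ring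
        _ ≤ _ := by gcongr
    have hball (y : Plane) (hy : y ∈ Metric.closedBall c (γ ^ 2 * h)) :
        (elementBasis hK).coord ⟨v, hv⟩ y ∈ Icc (0 : ℝ) 1 := by
      have hy' := (mem_element_iff hK).1 (hc (Metric.closedBall_subset_closedBall hρ' hy))
      refine ⟨hy' _, ?_⟩
      rw [← (elementBasis hK).sum_coord_apply_eq_one y]
      exact Finset.single_le_sum (fun i _ => hy' i) (Finset.mem_univ _)
    simpa [baryCoord, hv] using abs_affine_sub_le hρ hball y x
  · have : baryCoord hK v = fun _ => 0 := by
      ext y; simp [baryCoord, hv]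
    simp [this]

theorem IsTriangulation.subdomain_subset (hT : IsTriangulation T Ω γ h)
    {E : Set (Finset Plane)} (hE : E ⊆ elements T) : subdomain E ⊆ Ω := by
  rw [hT.covers]
  refine interior_mono (iUnion₂_subset fun K hK => ?_)
  exact T.convexHull_subset_space (hE hK).1

/-- The largest element lies in the closure of Ω: it is convex with nonempty interior, hence
contained in the closure of its interior, and that interior is part of Ω. -/
theorem IsTriangulation.le_diam (hT : IsTriangulation T Ω γ h) (hγ : 0 < γ) (hh : 0 < h)
    (hΩ : Bornology.IsBounded Ω) : h ≤ Metric.diam Ω := by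
  obtain ⟨K, hK, hKh⟩ := hT.diam_attained
  obtain ⟨c, hc⟩ := hT.shape_regular K hK
  rw [hKh] at hc
  have hint : (interior (convexHull ℝ (K : Set Plane))).Nonempty :=
    ⟨c, interior_mono hc (by
      rw [interior_closedBall _ (by positivity)]
      exact Metric.mem_ball_self (by positivity))⟩
  have hsub : convexHull ℝ (K : Set Plane) ⊆ closure Ω := by
    refine subset_closure.trans ?_
    rw [← (convex_convexHull ℝ _).closure_interior_eq_closure_of_nonempty_interior hint, hT.covers]
    exact closure_mono (interior_mono (T.convexHull_subset_space hK.1))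
  rw [← hKh, ← Metric.diam_closure Ω]
  exact Metric.diam_mono hsub hΩ.closure

open Classical in
-- Boundaries of convex sets are null, so almost every point of the subdomain is interior to one of
-- its finitely many elements.
theorem IsTriangulation.ae_norm_gradient_hat_le (hT : IsTriangulation T Ω γ h) (hγ : 0 < γ)
    (hh : 0 < h) {E : Set (Finset Plane)} (hE : E ⊆ elements T) :
    ∀ᵐ x ∂volume.restrict (subdomain E), ∃ K ∈ elements T, x ∈ convexHull ℝ (K : Set Plane) ∧
      ∀ v, ‖∇ (hat T v) x‖ ≤ if v ∈ K then (γ ^ 2 * h)⁻¹ else 0 := by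
  have hfin : E.Finite := hT.finite.subset fun K hK => (hE hK).1
  have hnull : ∀ᵐ x ∂volume, ∀ K ∈ E, x ∉ frontier (convexHull ℝ (K : Set Plane)) :=
    (ae_ball_iff hfin.countable).2 fun K _ =>
      measure_eq_zero_iff_ae_notMem.1 ((convex_convexHull ℝ _).addHaar_frontier volume)
  filter_upwards [ae_restrict_of_ae hnull, ae_restrict_mem isOpen_interior.measurableSet]
    with x hx hxD
  obtain ⟨K, hK, hxK⟩ := mem_iUnion₂.1 (interior_subset hxD)
  have hxi : x ∈ interior (convexHull ℝ (K : Set Plane)) := by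
    by_contra hc
    exact hx K hK ⟨subset_closure hxK, hc⟩
  exact ⟨K, hE hK, hxK, hT.norm_gradient_hat_le hγ hh (hE hK) hxi⟩

theorem IsTriangulation.ae_sum_norm_gradient_le (hT : IsTriangulation T Ω γ h) (hγ : 0 < γ)
    (hh : 0 < h) {E : Set (Finset Plane)} (hE : E ⊆ elements T) (R : Finset Plane) :
    ∀ᵐ x ∂volume.restrict (subdomain E), ∑ s : R, ‖∇ (hat T s) x‖ ≤ 3 * (γ ^ 2 * h)⁻¹ := by
  classical
  filter_upwards [hT.ae_norm_gradient_hat_le hγ hh hE] with x ⟨K, hK, _, hn⟩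
  rw [Finset.sum_coe_sort R fun s => ‖∇ (hat T s) x‖]
  refine (Finset.sum_le_sum fun s _ => hn s).trans ?_
  rw [← Finset.sum_filter, Finset.sum_const, nsmul_eq_mul]
  have hc : (R.filter (· ∈ K)).card ≤ 3 := by
    rw [← hK.2]
    exact Finset.card_le_card fun s hs => (Finset.mem_filter.1 hs).2
  gcongr
  exact_mod_cast hc

theorem IsTriangulation.ae_norm_gradient_le_indicator (hT : IsTriangulation T Ω γ h) (hγ : 0 < γ)
    (hh : 0 < h) {E : Set (Finset Plane)} (hE : E ⊆ elements T) (s : Plane) :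
    ∀ᵐ x ∂volume.restrict (subdomain E),
      ‖∇ (hat T s) x‖ ≤ (Metric.closedBall s h).indicator (fun _ => (γ ^ 2 * h)⁻¹) x := by
  classical
  filter_upwards [hT.ae_norm_gradient_hat_le hγ hh hE] with x ⟨K, hK, hx, hn⟩
  refine (hn s).trans ?_
  split_ifs with hs
  · rw [indicator_of_mem]
    rw [Metric.mem_closedBall]
    exact (Metric.dist_le_diam_of_mem (isBounded_convexHull.2 K.finite_toSet.isBounded) hx
      (subset_convexHull ℝ _ hs)).trans (hT.diam_le K hK)
  · exact indicator_nonneg (fun _ _ => by positivity) _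

theorem measurable_gradient_hat (s : Plane) : Measurable (∇ (hat T s)) := by
  have h : Measurable (fderiv ℝ (hat T s)) := measurable_fderiv ℝ _
  exact (InnerProductSpace.toDual ℝ Plane).symm.continuous.measurable.comp h

/-- The gradient is at most 1/(γ²h) and lives, up to a null set, in the disc of radius h about the
vertex, of area πh². No count of the elements meeting at a vertex is required. -/
theorem IsTriangulation.integral_norm_gradient_le (hT : IsTriangulation T Ω γ h) (hγ : 0 < γ)
    (hh : 0 < h) {E : Set (Finset Plane)} (hE : E ⊆ elements T) (s : Plane) :
    Integrable (fun x => ‖∇ (hat T s) x‖) (volume.restrict (subdomain E)) ∧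
    ∫ x in subdomain E, ‖∇ (hat T s) x‖ ≤ Real.pi * h / γ ^ 2 := by
  have hint : Integrable ((Metric.closedBall s h).indicator fun _ => (γ ^ 2 * h)⁻¹)
      (volume : Measure Plane) := by
    rw [integrable_indicator_iff measurableSet_closedBall]
    exact integrableOn_const measure_closedBall_lt_top.ne
  have hae := hT.ae_norm_gradient_le_indicator hγ hh hE s
  have hi : Integrable (fun x => ‖∇ (hat T s) x‖) (volume.restrict (subdomain E)) :=
    hint.restrict.mono' (measurable_gradient_hat s).norm.aestronglyMeasurable (by
      filter_upwards [hae] with x hx using by simpa using hx)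
  refine ⟨hi, (integral_mono_ae hi hint.restrict hae).trans ?_⟩
  refine (setIntegral_le_integral hint (.of_forall fun x =>
    indicator_nonneg (fun _ _ => by positivity) _)).trans (le_of_eq ?_)
  rw [integral_indicator measurableSet_closedBall, setIntegral_const, smul_eq_mul, measureReal_def,
    EuclideanSpace.volume_closedBall_fin_two]
  simp [ENNReal.toReal_ofReal hh.le, ENNReal.toReal_ofReal Real.pi_pos.le]
  field_simp

end Mesh

/-! ### Bounds for the local matrices -/

/-- The integral of (t f + g)² is a nonnegative quadratic in t, so its discriminant is nonpositive.
-/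
theorem sq_integral_mul_le {X : Type*} [MeasurableSpace X] {μ : Measure X} {f g : X → ℝ}
    (hf : MemLp f 2 μ) (hg : MemLp g 2 μ) :
    (∫ x, f x * g x ∂μ) ^ 2 ≤ (∫ x, f x ^ 2 ∂μ) * ∫ x, g x ^ 2 ∂μ := by
  have hfg : Integrable (fun x => f x * g x) μ := hf.integrable_mul hg
  have h (t : ℝ) : 0 ≤ (∫ x, f x ^ 2 ∂μ) * (t * t) + (2 * ∫ x, f x * g x ∂μ) * t +
      ∫ x, g x ^ 2 ∂μ := by
    have h0 : 0 ≤ ∫ x, (t * f x + g x) ^ 2 ∂μ := integral_nonneg fun x => sq_nonneg _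
    have h1 : ∫ x, (t * f x + g x) ^ 2 ∂μ =
        ∫ x, ((t * t) * f x ^ 2 + (2 * t) * (f x * g x)) + g x ^ 2 ∂μ := by
      congr 1; ext x; ring
    rw [h1, integral_add (f := fun x => (t * t) * f x ^ 2 + (2 * t) * (f x * g x))
      ((hf.integrable_sq.const_mul _).add (hfg.const_mul _)) hg.integrable_sq,
      integral_add (hf.integrable_sq.const_mul _) (hfg.const_mul _), integral_const_mul,
      integral_const_mul] at h0
    linarith
  have := discrim_le_zero h
  rw [discrim] at this
  linarith

section MatrixNorm

variable {m n : Type*} [Fintype m] [Fintype n] [DecidableEq n]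

theorem norm_matrix_le_of_mulVec (A : Matrix m n ℝ) {c : ℝ} (hc : 0 ≤ c)
    (h : ∀ v : n → ℝ, ∑ i, (∑ j, A i j * v j) ^ 2 ≤ c ^ 2 * ∑ j, v j ^ 2) : ‖A‖ ≤ c := by
  rw [Matrix.l2_opNorm_def]
  refine ContinuousLinearMap.opNorm_le_bound _ hc fun x => ?_
  rw [EuclideanSpace.norm_eq, EuclideanSpace.norm_eq]
  refine Real.sqrt_le_iff.2 ⟨by positivity, ?_⟩
  rw [mul_pow, Real.sq_sqrt (Finset.sum_nonneg fun _ _ => sq_nonneg _)]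
  simpa [Matrix.mulVec, dotProduct] using! h x

theorem norm_matrix_sq_le_sum_sq (A : Matrix m n ℝ) : ‖A‖ ^ 2 ≤ ∑ i, ∑ j, A i j ^ 2 := by
  have h0 : 0 ≤ ∑ i, ∑ j, A i j ^ 2 :=
    Finset.sum_nonneg fun _ _ => Finset.sum_nonneg fun _ _ => sq_nonneg _
  have h : ‖A‖ ≤ Real.sqrt (∑ i, ∑ j, A i j ^ 2) := by
    refine norm_matrix_le_of_mulVec A (Real.sqrt_nonneg _) fun v => ?_
    rw [Real.sq_sqrt h0, Finset.sum_mul]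
    exact Finset.sum_le_sum fun i _ => Finset.sum_mul_sq_le_sq_mul_sq _ _ _
  calc ‖A‖ ^ 2 ≤ Real.sqrt (∑ i, ∑ j, A i j ^ 2) ^ 2 := by gcongr
    _ = _ := Real.sq_sqrt h0

/-- The Schur test. -/
theorem norm_matrix_le_of_row_col (A : Matrix m n ℝ) {c : ℝ} (hc : 0 ≤ c)
    (hrow : ∀ i, ∑ j, |A i j| ≤ c) (hcol : ∀ j, ∑ i, |A i j| ≤ c) : ‖A‖ ≤ c := by
  refine norm_matrix_le_of_mulVec A hc fun v => ?_
  calc ∑ i, (∑ j, A i j * v j) ^ 2 ≤ ∑ i, c * ∑ j, |A i j| * v j ^ 2 := by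
        refine Finset.sum_le_sum fun i _ => ?_
        have h := Finset.sum_sq_le_sum_mul_sum_of_sq_le_mul Finset.univ
          (r := fun j => A i j * v j) (f := fun j => |A i j|) (g := fun j => |A i j| * v j ^ 2)
          (fun j _ => abs_nonneg _) (fun j _ => by positivity) (fun j _ => by
            rw [← mul_assoc, abs_mul_abs_self, mul_pow, sq])
        refine h.trans ?_
        gcongr
        exact hrow i
    _ = c * ∑ j, (∑ i, |A i j|) * v j ^ 2 := by
        rw [← Finset.mul_sum, Finset.sum_comm]
        simp_rw [Finset.sum_mul]
    _ ≤ c * ∑ j, c * v j ^ 2 := by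
        gcongr with j
        exact hcol j
    _ = _ := by rw [← Finset.mul_sum]; ring

end MatrixNorm

section Mesh

variable {T : Geometry.SimplicialComplex ℝ Plane} {Ω : Set Plane} {γ h : ℝ}
  {E : Set (Finset Plane)}

/-- The integrand `∇φ_s · ∇φ_t` of the stiffness matrix. -/
def gradProd (T : Geometry.SimplicialComplex ℝ Plane) (s t x : Plane) : ℝ :=
  inner ℝ (∇ (hat T s) x) (∇ (hat T t) x)

theorem measurable_gradProd (s t : Plane) : Measurable (gradProd T s t) :=
  (measurable_gradient_hat s).inner (measurable_gradient_hat t)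

theorem abs_gradProd_le (s t x : Plane) :
    |gradProd T s t x| ≤ ‖∇ (hat T s) x‖ * ‖∇ (hat T t) x‖ := abs_real_inner_le_norm _ _

theorem IsTriangulation.ae_norm_gradient_le (hT : IsTriangulation T Ω γ h) (hγ : 0 < γ)
    (hh : 0 < h) (hE : E ⊆ elements T) (s : Plane) :
    ∀ᵐ x ∂volume.restrict (subdomain E), ‖∇ (hat T s) x‖ ≤ (γ ^ 2 * h)⁻¹ := by
  classical
  filter_upwards [hT.ae_norm_gradient_hat_le hγ hh hE] with x ⟨K, hK, hx, hn⟩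
  refine (hn s).trans ?_
  split_ifs
  · exact le_rfl
  · positivity

theorem IsTriangulation.ae_abs_gradProd_le (hT : IsTriangulation T Ω γ h) (hγ : 0 < γ)
    (hh : 0 < h) (hE : E ⊆ elements T) (s t : Plane) :
    ∀ᵐ x ∂volume.restrict (subdomain E), |gradProd T s t x| ≤ ((γ ^ 2 * h)⁻¹) ^ 2 := by
  filter_upwards [hT.ae_norm_gradient_le hγ hh hE s, hT.ae_norm_gradient_le hγ hh hE t]
    with x h1 h2
  refine (abs_gradProd_le s t x).trans ?_
  rw [sq]
  gcongr

theorem IsTriangulation.integral_abs_gradProd_le (hT : IsTriangulation T Ω γ h) (hγ : 0 < γ)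
    (hh : 0 < h) (hE : E ⊆ elements T) (s t : Plane) :
    ∫ x in subdomain E, |gradProd T s t x| ≤ Real.pi / γ ^ 4 := by
  obtain ⟨hi, hle⟩ := hT.integral_norm_gradient_le hγ hh hE s
  calc ∫ x in subdomain E, |gradProd T s t x|
      ≤ ∫ x in subdomain E, ‖∇ (hat T s) x‖ * (γ ^ 2 * h)⁻¹ := by
        refine integral_mono_of_nonneg (.of_forall fun x => abs_nonneg _) (hi.mul_const _) ?_
        filter_upwards [hT.ae_norm_gradient_le hγ hh hE t] with x h2
        exact (abs_gradProd_le s t x).trans (by gcongr)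
    _ ≤ (Real.pi * h / γ ^ 2) * (γ ^ 2 * h)⁻¹ := by
        rw [integral_mul_const]
        gcongr
    _ = _ := by field_simp

/-- Apply Cauchy-Schwarz to each entry with the weight |∇φ_s · ∇φ_t|, whose total mass is at most
π/γ⁴. Summed over s and t, the weights are pointwise at most (3/(γ²h))², because only three
gradients are nonzero at almost every point. -/
theorem IsTriangulation.sum_sq_localMatrix_le (hT : IsTriangulation T Ω γ h) (hγ : 0 < γ)
    (hh : 0 < h) (hE : E ⊆ elements T) (R S : Finset Plane) {κ : Plane → ℝ}
    (hκ : MemLp κ 2 (volume.restrict (subdomain E))) :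
    ∑ s, ∑ t, localMatrix T (subdomain E) R S κ s t ^ 2 ≤
      9 * Real.pi / γ ^ 8 / h ^ 2 * ∫ x in subdomain E, κ x ^ 2 := by
  have hbd (s t : Plane) := hT.ae_abs_gradProd_le hγ hh hE s t
  have hi (s t : Plane) : Integrable (fun x => κ x ^ 2 * |gradProd T s t x|)
      (volume.restrict (subdomain E)) :=
    hκ.integrable_sq.mul_bdd (c := ((γ ^ 2 * h)⁻¹) ^ 2)
      (measurable_gradProd s t).abs.aestronglyMeasurable (by
        filter_upwards [hbd s t] with x hx
        simpa using hx)
  have hw (s t : Plane) : Integrable (fun x => |gradProd T s t x|)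
      (volume.restrict (subdomain E)) := by
    obtain ⟨hi, -⟩ := hT.integral_norm_gradient_le hγ hh hE s
    refine (hi.mul_const (γ ^ 2 * h)⁻¹).mono' (measurable_gradProd s t).abs.aestronglyMeasurable ?_
    filter_upwards [hT.ae_norm_gradient_le hγ hh hE t] with x h2
    rw [Real.norm_eq_abs, abs_abs]
    exact (abs_gradProd_le s t x).trans (by gcongr)
  have hentry (s t : Plane) : (∫ x in subdomain E, κ x * gradProd T s t x) ^ 2 ≤
      (∫ x in subdomain E, κ x ^ 2 * |gradProd T s t x|) * (Real.pi / γ ^ 4) := by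
    have hm1 : MemLp (fun x => Real.sqrt |gradProd T s t x|) 2
        (volume.restrict (subdomain E)) := by
      rw [memLp_two_iff_integrable_sq
        (measurable_gradProd s t).abs.sqrt.aestronglyMeasurable]
      simpa [Real.sq_sqrt (abs_nonneg _)] using hw s t
    have hm2 : MemLp (fun x => |κ x| * Real.sqrt |gradProd T s t x|) 2
        (volume.restrict (subdomain E)) := by
      refine (memLp_two_iff_integrable_sq (hκ.1.norm.mul
        (measurable_gradProd s t).abs.sqrt.aestronglyMeasurable)).2 ?_
      simpa [mul_pow, Real.sq_sqrt (abs_nonneg _)] using hi s t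
    have h := sq_integral_mul_le hm2 hm1
    simp only [mul_assoc, mul_pow, Real.sq_sqrt (abs_nonneg _), Real.mul_self_sqrt (abs_nonneg _),
      sq_abs] at h
    calc _ ≤ (∫ x in subdomain E, |κ x| * |gradProd T s t x|) ^ 2 := by
          rw [← sq_abs (∫ x in subdomain E, κ x * gradProd T s t x)]
          gcongr
          simpa only [abs_mul] using
            abs_integral_le_integral_abs (f := fun x => κ x * gradProd T s t x)
      _ ≤ _ := h
      _ ≤ _ := by
          gcongr
          exact hT.integral_abs_gradProd_le hγ hh hE s t
  calc _ ≤ ∑ s : R, ∑ t : S, (∫ x in subdomain E, κ x ^ 2 * |gradProd T s t x|) *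
        (Real.pi / γ ^ 4) :=
        Finset.sum_le_sum fun s _ => Finset.sum_le_sum fun t _ => hentry s t
    _ = (∫ x in subdomain E, ∑ s : R, ∑ t : S, κ x ^ 2 * |gradProd T s t x|) *
        (Real.pi / γ ^ 4) := by
        rw [integral_finsetSum _ fun (s : R) _ => integrable_finsetSum _ fun (t : S) _ => hi s t,
          Finset.sum_mul]
        refine Finset.sum_congr rfl fun s _ => ?_
        rw [integral_finsetSum _ fun (t : S) _ => hi s t, Finset.sum_mul]
    _ ≤ (∫ x in subdomain E, κ x ^ 2 * (3 * (γ ^ 2 * h)⁻¹) ^ 2) * (Real.pi / γ ^ 4) := by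
        refine mul_le_mul_of_nonneg_right ?_ (by positivity)
        refine integral_mono_ae (integrable_finsetSum _ fun (s : R) _ =>
          integrable_finsetSum _ fun (t : S) _ => hi s t) (hκ.integrable_sq.mul_const _) ?_
        filter_upwards [hT.ae_sum_norm_gradient_le hγ hh hE R,
          hT.ae_sum_norm_gradient_le hγ hh hE S] with x h1 h2
        simp_rw [← Finset.mul_sum]
        gcongr
        calc _ ≤ ∑ s : R, ∑ t : S, ‖∇ (hat T s) x‖ * ‖∇ (hat T t) x‖ :=
              Finset.sum_le_sum fun s _ => Finset.sum_le_sum fun t _ => abs_gradProd_le _ _ _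
          _ = (∑ s : R, ‖∇ (hat T s) x‖) * ∑ t : S, ‖∇ (hat T t) x‖ := by
              rw [Finset.sum_mul_sum]
          _ ≤ _ := by
              rw [sq]
              gcongr
    _ = _ := by
        rw [integral_mul_const]
        field_simp
        ring

/-- In a row sum, the mass πh/γ² of one gradient meets the pointwise bound 3/(γ²h) for the sum of
the others, so h cancels. Column sums are treated alike, and the Schur test applies. -/
theorem IsTriangulation.norm_localMatrix_le (hT : IsTriangulation T Ω γ h) (hγ : 0 < γ)
    (hh : 0 < h) (hE : E ⊆ elements T) (R S : Finset Plane) {κ : Plane → ℝ} {k : ℝ}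
    (hk : 0 ≤ k) (hκ : ∀ x ∈ subdomain E, |κ x| ≤ k) :
    ‖localMatrix T (subdomain E) R S κ‖ ≤ 3 * Real.pi / γ ^ 4 * k := by
  have hi (s : Plane) : Integrable (fun x => ‖∇ (hat T s) x‖) (volume.restrict (subdomain E)) :=
    (hT.integral_norm_gradient_le hγ hh hE s).1
  have hprod (s t : Plane) : Integrable (fun x => ‖∇ (hat T s) x‖ * ‖∇ (hat T t) x‖)
      (volume.restrict (subdomain E)) :=
    (hi s).mul_bdd (c := (γ ^ 2 * h)⁻¹) (measurable_gradient_hat t).norm.aestronglyMeasurable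
      (by simpa using hT.ae_norm_gradient_le hγ hh hE t)
  have hentry (s t : Plane) : |∫ x in subdomain E, κ x * gradProd T s t x| ≤
      ∫ x in subdomain E, k * (‖∇ (hat T s) x‖ * ‖∇ (hat T t) x‖) := by
    rw [← Real.norm_eq_abs]
    refine norm_integral_le_of_norm_le ((hprod s t).const_mul k) ?_
    filter_upwards [ae_restrict_mem (s := subdomain E) isOpen_interior.measurableSet] with x hx
    rw [norm_mul, Real.norm_eq_abs, Real.norm_eq_abs]
    have := abs_gradProd_le (T := T) s t x
    have := hκ x hx
    gcongr
  have hsum (s : Plane) (Q : Finset Plane) :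
      ∑ t : Q, ∫ x in subdomain E, k * (‖∇ (hat T s) x‖ * ‖∇ (hat T t) x‖) ≤
        3 * Real.pi / γ ^ 4 * k := by
    rw [← integral_finsetSum _ fun (t : Q) _ => (hprod s t).const_mul k]
    calc _ ≤ ∫ x in subdomain E, ‖∇ (hat T s) x‖ * (k * (3 * (γ ^ 2 * h)⁻¹)) := by
          refine integral_mono_ae (integrable_finsetSum _ fun t _ => (hprod s t).const_mul k)
            ((hi s).mul_const _) ?_
          filter_upwards [hT.ae_sum_norm_gradient_le hγ hh hE Q] with x hx
          simp_rw [← Finset.mul_sum]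
          rw [mul_left_comm]
          gcongr
      _ ≤ (Real.pi * h / γ ^ 2) * (k * (3 * (γ ^ 2 * h)⁻¹)) := by
          rw [integral_mul_const]
          gcongr
          exact (hT.integral_norm_gradient_le hγ hh hE s).2
      _ = _ := by field_simp
  refine norm_matrix_le_of_row_col _ (by positivity) (fun s => ?_) (fun t => ?_)
  · exact (Finset.sum_le_sum fun (t : S) _ => hentry s t).trans (hsum s S)
  · refine (Finset.sum_le_sum fun (s : R) _ => hentry s t).trans ?_
    simp_rw [mul_comm (‖∇ (hat T _) _‖) (‖∇ (hat T t) _‖)]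
    exact hsum t R

end Mesh

/-! ### The Gaussian Hilbert space of the field -/

section GaussianSpace

variable {Θ : Type*} [MeasurableSpace Θ] {P : Measure Θ}

theorem toLp_inner_toLp {f g : Θ → ℝ} (hf : MemLp f 2 P) (hg : MemLp g 2 P) :
    inner ℝ (hf.toLp f) (hg.toLp g) = ∫ θ, f θ * g θ ∂P := by
  rw [L2.inner_def]
  refine integral_congr_ae ?_
  filter_upwards [hf.coeFn_toLp, hg.coeFn_toLp] with θ h1 h2
  rw [h1, h2]
  simp [mul_comm]

theorem norm_toLp_sq {f : Θ → ℝ} (hf : MemLp f 2 P) :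
    ‖hf.toLp f‖ ^ 2 = ∫ θ, f θ ^ 2 ∂P := by
  rw [← real_inner_self_eq_norm_sq, toLp_inner_toLp]
  simp_rw [sq]

theorem norm_cexp_sub_le (t z w : ℝ) :
    ‖Complex.exp (t * z * Complex.I) - Complex.exp (t * w * Complex.I)‖ ≤ |t| * |z - w| := by
  have h1 : Complex.exp (t * z * Complex.I) - Complex.exp (t * w * Complex.I) =
      Complex.exp ((t * w : ℝ) * Complex.I) *
        (Complex.exp (Complex.I * (t * (z - w) : ℝ)) - 1) := by
    rw [mul_sub, ← Complex.exp_add, mul_one]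
    push_cast
    ring_nf
  rw [h1, norm_mul, Complex.norm_exp_ofReal_mul_I, one_mul, ← abs_mul]
  exact Real.norm_exp_I_mul_ofReal_sub_one_le

variable [IsProbabilityMeasure P]

theorem integrable_cexp {f : Θ → ℝ} (hf : AEMeasurable f P) (t : ℝ) :
    Integrable (fun θ => Complex.exp (t * f θ * Complex.I)) P := by
  refine Integrable.of_bound (C := 1) (by fun_prop) (.of_forall fun θ => ?_)
  have := Complex.norm_exp_ofReal_mul_I (t * f θ)
  push_cast at this
  exact this.le

theorem integral_abs_le_norm (f : Lp ℝ 2 P) : ∫ θ, |f θ| ∂P ≤ ‖f‖ := by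
  have h := sq_integral_mul_le (f := fun θ => |f θ|) (Lp.memLp f).abs (memLp_const (1 : ℝ))
  simp only [mul_one, sq_abs, one_pow, integral_const, probReal_univ, smul_eq_mul] at h
  rw [← norm_toLp_sq (Lp.memLp f), Lp.toLp_coeFn] at h
  exact (le_abs_self _).trans (abs_le_of_sq_le_sq h (norm_nonneg _))

/-- The map is Lipschitz with constant |t|, since the L¹ norm is below the L² norm on a probability
space. This carries Gaussianity from the linear span to its closure. -/
theorem continuous_charFun_Lp (t : ℝ) :
    Continuous fun f : Lp ℝ 2 P => ∫ θ, Complex.exp (t * f θ * Complex.I) ∂P := by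
  refine (LipschitzWith.of_dist_le_mul (K := ⟨|t|, abs_nonneg t⟩) fun f g => ?_).continuous
  rw [dist_eq_norm, dist_eq_norm, ← integral_sub
    (integrable_cexp (Lp.stronglyMeasurable f).measurable.aemeasurable t)
    (integrable_cexp (Lp.stronglyMeasurable g).measurable.aemeasurable t)]
  have hi : Integrable (fun θ => |t| * |(f - g : Lp ℝ 2 P) θ|) P :=
    (((Lp.memLp (f - g)).integrable one_le_two).abs).const_mul _
  refine (norm_integral_le_of_norm_le hi ?_).trans ?_
  · filter_upwards [Lp.coeFn_sub f g] with θ h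
    rw [h]
    exact norm_cexp_sub_le t _ _
  · rw [integral_const_mul]
    exact mul_le_mul_of_nonneg_left (integral_abs_le_norm _) (abs_nonneg t)

end GaussianSpace

section Field

variable {Θ : Type*} [MeasurableSpace Θ] {P : Measure Θ}
  {σ l : ℝ} {Ω : Set Plane} {a : Plane → Θ → ℝ}

theorem IsGaussianField.memLp (ha : IsGaussianField P σ l Ω a) (x : Ω) : MemLp (a x) 2 P :=
  (ha.gaussian.hasGaussianLaw_eval x).memLp_two

theorem IsGaussianField.integral_sq (ha : IsGaussianField P σ l Ω a) {x : Plane} (hx : x ∈ Ω) :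
    ∫ θ, a x θ ^ 2 ∂P = σ ^ 2 := by
  have h := ha.covariance x hx x hx
  simpa [covKernel, sq] using h

/-- The linear span of the field in `L²(P)`. -/
def fieldSpan (ha : IsGaussianField P σ l Ω a) : Submodule ℝ (Lp ℝ 2 P) :=
  Submodule.span ℝ (range fun x : Ω => (ha.memLp x).toLp (a x))

theorem charFun_of_mem_fieldSpan (ha : IsGaussianField P σ l Ω a) {f : Lp ℝ 2 P}
    (hf : f ∈ fieldSpan ha) (t : ℝ) :
    ∫ θ, Complex.exp (t * f θ * Complex.I) ∂P =
      Complex.exp ((-(‖f‖ ^ 2 * t ^ 2 / 2) : ℝ) : ℂ) := by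
  have := ha.gaussian.isProbabilityMeasure
  obtain ⟨c, rfl⟩ := Finsupp.mem_span_range_iff_exists_finsupp.1 hf
  set X : Θ → ℝ := fun θ => ∑ x ∈ c.support, c x • a x θ with hX
  have hlaw : HasGaussianLaw X P := (ha.gaussian.smul c).hasGaussianLaw_fun_sum
  have hmem : MemLp X 2 P := hlaw.memLp_two
  have heq : (c.sum fun x r => r • (ha.memLp x).toLp (a x)) = hmem.toLp X := by
    refine Lp.ext ?_
    refine EventuallyEq.trans ?_ hmem.coeFn_toLp.symm
    rw [Finsupp.sum]
    have hall : ∀ᵐ θ ∂P, ∀ x ∈ c.support,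
        (c x • (ha.memLp x).toLp (a x) : Lp ℝ 2 P) θ = c x • a x θ :=
      (Filter.eventually_all_finset _).2 fun x _ => by
        filter_upwards [Lp.coeFn_smul (c x) ((ha.memLp x).toLp (a x)),
          (ha.memLp x).coeFn_toLp] with θ h1 h2
        rw [h1, Pi.smul_apply, h2]
    filter_upwards [Lp.coeFn_finsetSum c.support fun x => c x • (ha.memLp x).toLp (a x),
      hall] with θ h1 h2
    rw [h1, Finset.sum_apply]
    exact Finset.sum_congr rfl h2
  have hmean : ∫ θ, X θ ∂P = 0 := by
    rw [hX, integral_finsetSum]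
    · refine Finset.sum_eq_zero fun x _ => ?_
      rw [integral_smul, ha.centred x x.2, smul_zero]
    · exact fun x _ => ((ha.memLp x).integrable one_le_two).smul (c x)
  have hvar : Var[X; P] = ‖hmem.toLp X‖ ^ 2 := by
    rw [variance_of_integral_eq_zero hlaw.aemeasurable hmean, norm_toLp_sq]
  rw [heq]
  have h1 : ∫ θ, Complex.exp (t * (hmem.toLp X) θ * Complex.I) ∂P = charFun (P.map X) t := by
    rw [charFun_apply_real, integral_map hlaw.aemeasurable (by fun_prop)]
    refine integral_congr_ae ?_
    filter_upwards [hmem.coeFn_toLp] with θ h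
    rw [h]
  rw [h1, hlaw.map_eq_gaussianReal, charFun_gaussianReal, hmean, hvar]
  rw [Real.coe_toNNReal _ (by positivity)]
  push_cast
  congr 1
  ring

/-- `X` belongs to the closed linear span of the field in `L²(P)`. -/
def InField (ha : IsGaussianField P σ l Ω a) (X : Θ → ℝ) : Prop :=
  ∃ hX : MemLp X 2 P, hX.toLp X ∈ (fieldSpan ha).topologicalClosure

variable {ha : IsGaussianField P σ l Ω a}

theorem InField.memLp {X : Θ → ℝ} (h : InField ha X) : MemLp X 2 P := h.1

theorem inField_field (ha : IsGaussianField P σ l Ω a) {x : Plane} (hx : x ∈ Ω) :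
    InField ha (a x) :=
  ⟨ha.memLp ⟨x, hx⟩, Submodule.le_topologicalClosure _ (Submodule.subset_span ⟨⟨x, hx⟩, rfl⟩)⟩

theorem InField.add {X Y : Θ → ℝ} (hX : InField ha X) (hY : InField ha Y) :
    InField ha (fun θ => X θ + Y θ) := by
  obtain ⟨hX, hX'⟩ := hX
  obtain ⟨hY, hY'⟩ := hY
  exact ⟨hX.add hY, (MemLp.toLp_add hX hY) ▸ Submodule.add_mem _ hX' hY'⟩

theorem InField.const_mul {X : Θ → ℝ} (hX : InField ha X) (c : ℝ) :
    InField ha (fun θ => c * X θ) := by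
  obtain ⟨hX, hX'⟩ := hX
  exact ⟨hX.const_smul c, (MemLp.toLp_const_smul c hX) ▸ Submodule.smul_mem _ c hX'⟩

theorem inField_zero (ha : IsGaussianField P σ l Ω a) : InField ha (fun _ => 0) :=
  ⟨MemLp.zero', by
    have h : (MemLp.zero' : MemLp (fun _ : Θ => (0 : ℝ)) 2 P).toLp _ = 0 := MemLp.toLp_zero _
    rw [h]
    exact Submodule.zero_mem _⟩

theorem InField.sum {ι : Type*} (s : Finset ι) {X : ι → Θ → ℝ} (h : ∀ i, InField ha (X i)) :
    InField ha (fun θ => ∑ i ∈ s, X i θ) := by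
  classical
  induction s using Finset.induction_on with
  | empty => simpa using inField_zero ha
  | insert i s hi ih => simpa [Finset.sum_insert hi] using (h i).add ih

/-- The closed span is the double orthogonal complement of the span. Membership can thus be tested
by Fubini, without approximating integrals of the field by sums. -/
theorem inField_of_orthogonal (ha : IsGaussianField P σ l Ω a) {X : Θ → ℝ} (hX : MemLp X 2 P)
    (h : ∀ Z : Θ → ℝ, MemLp Z 2 P → (∀ x ∈ Ω, ∫ θ, Z θ * a x θ ∂P = 0) →
      ∫ θ, Z θ * X θ ∂P = 0) : InField ha X := by
  refine ⟨hX, ?_⟩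
  rw [← Submodule.orthogonal_orthogonal_eq_closure, Submodule.mem_orthogonal]
  intro Z hZ
  rw [← Lp.toLp_coeFn Z (Lp.memLp Z), toLp_inner_toLp]
  refine h Z (Lp.memLp Z) fun x hx => ?_
  rw [← toLp_inner_toLp (Lp.memLp Z) (ha.memLp ⟨x, hx⟩), Lp.toLp_coeFn, real_inner_comm]
  exact (Submodule.mem_orthogonal _ _).1 hZ _ (Submodule.subset_span ⟨⟨x, hx⟩, rfl⟩)

variable [IsProbabilityMeasure P]

/-- The formula for the characteristic function of a centred Gaussian is a closed condition in
L²(P), so it survives passage to the closure. -/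
theorem InField.map_eq {X : Θ → ℝ} (h : InField ha X) :
    P.map X = gaussianReal 0 (∫ θ, X θ ^ 2 ∂P).toNNReal := by
  obtain ⟨hX, hX'⟩ := h
  have hclosed (t : ℝ) : IsClosed {f : Lp ℝ 2 P |
      ∫ θ, Complex.exp (t * f θ * Complex.I) ∂P =
        Complex.exp ((-(‖f‖ ^ 2 * t ^ 2 / 2) : ℝ) : ℂ)} :=
    isClosed_eq (continuous_charFun_Lp t) (by fun_prop)
  have hmem (t : ℝ) := (hclosed t).closure_subset_iff.2
    (fun f (hf : f ∈ (fieldSpan ha : Set (Lp ℝ 2 P))) => charFun_of_mem_fieldSpan ha hf t) hX'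
  have : IsProbabilityMeasure (P.map X) := Measure.isProbabilityMeasure_map hX.1.aemeasurable
  refine Measure.ext_of_charFun ?_
  ext t
  have h1 : ∫ θ, Complex.exp (t * (hX.toLp X) θ * Complex.I) ∂P = charFun (P.map X) t := by
    rw [charFun_apply_real, integral_map hX.1.aemeasurable (by fun_prop)]
    refine integral_congr_ae ?_
    filter_upwards [hX.coeFn_toLp] with θ h
    rw [h]
  have h2 := hmem t
  simp only [mem_ofPred_eq] at h2
  rw [← h1, h2, charFun_gaussianReal, norm_toLp_sq, Real.coe_toNNReal _
    (integral_nonneg fun θ => sq_nonneg _)]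
  push_cast
  congr 1
  ring

theorem InField.integrable_exp {X : Θ → ℝ} (h : InField ha X) :
    Integrable (fun θ => Real.exp (X θ)) P := by
  have h1 := integrable_exp_mul_gaussianReal (μ := 0) (v := (∫ θ, X θ ^ 2 ∂P).toNNReal) 1
  rw [← h.map_eq] at h1
  simpa using! h1.comp_aemeasurable h.1.1.aemeasurable

theorem InField.integral_exp {X : Θ → ℝ} (h : InField ha X) :
    ∫ θ, Real.exp (X θ) ∂P = Real.exp ((∫ θ, X θ ^ 2 ∂P) / 2) := by
  have h1 := mgf_gaussianReal h.map_eq 1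
  rw [Real.coe_toNNReal _ (integral_nonneg fun θ => sq_nonneg _)] at h1
  simpa [mgf] using h1

/-- An orthonormal system in the Gaussian space of the field is a standard Gaussian vector. -/
theorem map_eq_stdGaussianPi {M : ℕ} {X : Fin M → Θ → ℝ} (h : ∀ m, InField ha (X m))
    (horth : ∀ m n, ∫ θ, X m θ * X n θ ∂P = if m = n then 1 else 0) :
    P.map (fun θ m => X m θ) = stdGaussianPi M := by
  have hmeas : AEMeasurable (fun θ m => X m θ) P :=
    aemeasurable_pi_lambda _ fun m => (h m).1.1.aemeasurable
  have : IsProbabilityMeasure (P.map fun θ m => X m θ) := Measure.isProbabilityMeasure_map hmeas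
  -- The joint law is determined by linear forms: t · X stays in the Gaussian space and has variance
  -- |t|² by orthonormality.
  refine charFun_eq_pi_iff.1 fun t => ?_
  have hmap : (P.map fun θ m => X m θ).map (WithLp.toLp 2) = P.map (fun θ =>
      WithLp.toLp 2 (fun m => X m θ)) := by
    rw [AEMeasurable.map_map_of_aemeasurable (by fun_prop) hmeas]
    rfl
  have hF : InField ha (fun θ => ∑ m, t m * X m θ) := InField.sum _ fun m => (h m).const_mul _
  have hsq : ∫ θ, (∑ m, t m * X m θ) ^ 2 ∂P = ∑ m, t m ^ 2 := by
    have hexp (θ : Θ) : (∑ m, t m * X m θ) ^ 2 =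
        ∑ m, ∑ n, (t m * t n) * (X m θ * X n θ) := by
      rw [sq, Finset.sum_mul_sum]
      refine Finset.sum_congr rfl fun m _ => Finset.sum_congr rfl fun n _ => by ring
    have hi (m n : Fin M) : Integrable (fun θ => (t m * t n) * (X m θ * X n θ)) P :=
      ((h m).1.integrable_mul (h n).1).const_mul _
    simp_rw [hexp]
    rw [integral_finsetSum _ fun m _ => integrable_finsetSum _ fun n _ => hi m n]
    refine Finset.sum_congr rfl fun m _ => ?_
    rw [integral_finsetSum _ fun n _ => hi m n]
    simp [integral_const_mul, horth, sq]
  have h1 : charFun ((P.map fun θ m => X m θ).map (WithLp.toLp 2)) t =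
      charFun (P.map fun θ => ∑ m, t m * X m θ) 1 := by
    have hm : AEMeasurable (fun θ => WithLp.toLp 2 (fun m => X m θ)) P :=
      (WithLp.measurable_toLp 2 (Fin M → ℝ)).comp_aemeasurable hmeas
    rw [hmap, charFun_apply, charFun_apply_real, integral_map hm (by fun_prop),
      integral_map hF.1.1.aemeasurable (by fun_prop)]
    simp [PiLp.inner_apply]
  rw [h1, hF.map_eq, hsq, charFun_gaussianReal, Real.coe_toNNReal _
    (Finset.sum_nonneg fun _ _ => sq_nonneg _)]
  simp_rw [charFun_gaussianReal]
  rw [← Complex.exp_sum]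
  push_cast
  simp [Finset.sum_div, Finset.sum_neg_distrib]

end Field

/-! ### The Karhunen-Loève expansion -/

section KL

variable {Θ : Type*} [MeasurableSpace Θ] {P : Measure Θ}
  {σ l : ℝ} {Ω D : Set Plane} {a : Plane → Θ → ℝ} {lam : ℕ → ℝ} {e : ℕ → Plane → ℝ}

theorem covKernel_comm (σ l : ℝ) (x y : Plane) : covKernel σ l x y = covKernel σ l y x := by
  rw [covKernel, covKernel, norm_sub_rev]

theorem continuous_covKernel (σ l : ℝ) : Continuous fun p : Plane × Plane =>
    covKernel σ l p.1 p.2 := by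
  unfold covKernel
  fun_prop

variable [IsProbabilityMeasure P]

theorem memLp_field_prod (ha : IsGaussianField P σ l Ω a) (hDm : MeasurableSet D)
    (hD : D ⊆ Ω) (hDf : volume D ≠ ⊤) :
    MemLp (fun p : Plane × Θ => a p.1 p.2) 2 ((volume.restrict D).prod P) := by
  have : IsFiniteMeasure (volume.restrict D) := ⟨by simpa using hDf.lt_top⟩
  have hm : AEStronglyMeasurable (fun p : Plane × Θ => a p.1 p.2) ((volume.restrict D).prod P) :=
    ha.measurable.aestronglyMeasurable
  refine (memLp_two_iff_integrable_sq hm).2 ((integrable_prod_iff (hm.pow 2)).2 ⟨?_, ?_⟩)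
  · filter_upwards [ae_restrict_mem hDm] with x hx
    exact (ha.memLp ⟨x, hD hx⟩).integrable_sq
  · refine (integrable_const (σ ^ 2)).congr ?_
    filter_upwards [ae_restrict_mem hDm] with x hx
    simp [ha.integral_sq (hD hx)]

theorem integrable_mul_field_mul (ha : IsGaussianField P σ l Ω a) (hDm : MeasurableSet D)
    (hD : D ⊆ Ω) (hDf : volume D ≠ ⊤) {f : Plane → ℝ} (hf : MemLp f 2 (volume.restrict D))
    {Z : Θ → ℝ} (hZ : MemLp Z 2 P) :
    Integrable (fun p : Plane × Θ => Z p.2 * (a p.1 p.2 * f p.1)) ((volume.restrict D).prod P) := by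
  have h1 := memLp_field_prod ha hDm hD hDf
  have h2 : MemLp (fun p : Plane × Θ => f p.1 * Z p.2) 2 ((volume.restrict D).prod P) := by
    refine (memLp_two_iff_integrable_sq (hf.1.comp_fst.mul hZ.1.comp_snd)).2 ?_
    refine (hf.integrable_sq.mul_prod hZ.integrable_sq).congr (.of_forall fun p => ?_)
    simp [mul_pow]
  have h3 : Integrable (fun p : Plane × Θ => a p.1 p.2 * (f p.1 * Z p.2))
    ((volume.restrict D).prod P) := h1.integrable_mul h2
  refine h3.congr (.of_forall fun p => ?_)
  ring

/-- Almost every sample path is square integrable on D, so Cauchy-Schwarz in x bounds the square by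
an integrable function of θ. -/
theorem memLp_integral_field_mul (ha : IsGaussianField P σ l Ω a) (hDm : MeasurableSet D)
    (hD : D ⊆ Ω) (hDf : volume D ≠ ⊤) {f : Plane → ℝ} (hf : MemLp f 2 (volume.restrict D)) :
    MemLp (fun θ => ∫ x in D, a x θ * f x) 2 P := by
  have : IsFiniteMeasure (volume.restrict D) := ⟨by simpa using hDf.lt_top⟩
  have h1 := memLp_field_prod ha hDm hD hDf
  have h2 : Integrable (fun p : Plane × Θ => a p.1 p.2 * f p.1) ((volume.restrict D).prod P) := by
    simpa using integrable_mul_field_mul ha hDm hD hDf hf (memLp_const (1 : ℝ))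
  have hm : AEStronglyMeasurable (fun θ => ∫ x in D, a x θ * f x) P :=
    h2.aestronglyMeasurable.prod_swap.integral_prod_right'
  rw [memLp_two_iff_integrable_sq hm]
  refine (h1.integrable_sq.integral_prod_right.mul_const (∫ x in D, f x ^ 2)).mono' (hm.pow 2) ?_
  filter_upwards [h1.integrable_sq.prod_left_ae, h1.1.prod_swap.prodMk_left] with θ hθ hθm
  rw [Real.norm_eq_abs, abs_of_nonneg (sq_nonneg _)]
  exact sq_integral_mul_le ((memLp_two_iff_integrable_sq hθm).2 hθ) hf

theorem integral_mul_integral_field (ha : IsGaussianField P σ l Ω a) (hDm : MeasurableSet D)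
    (hD : D ⊆ Ω) (hDf : volume D ≠ ⊤) {f : Plane → ℝ} (hf : MemLp f 2 (volume.restrict D))
    {Z : Θ → ℝ} (hZ : MemLp Z 2 P) :
    ∫ θ, Z θ * (∫ x in D, a x θ * f x) ∂P = ∫ x in D, (∫ θ, Z θ * a x θ ∂P) * f x := by
  have : IsFiniteMeasure (volume.restrict D) := ⟨by simpa using hDf.lt_top⟩
  have h := integrable_mul_field_mul ha hDm hD hDf hf hZ
  simp_rw [← integral_const_mul]
  rw [← integral_integral_swap h]
  simp_rw [← mul_assoc, integral_mul_const]

/-- If Z is orthogonal to every a(x), Fubini makes it orthogonal to the integral of the field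
against f. -/
theorem inField_integral_field (ha : IsGaussianField P σ l Ω a) (hDm : MeasurableSet D)
    (hD : D ⊆ Ω) (hDf : volume D ≠ ⊤) {f : Plane → ℝ} (hf : MemLp f 2 (volume.restrict D)) :
    InField ha (fun θ => ∫ x in D, a x θ * f x) := by
  refine inField_of_orthogonal ha (memLp_integral_field_mul ha hDm hD hDf hf) fun Z hZ h0 => ?_
  rw [integral_mul_integral_field ha hDm hD hDf hf hZ,
    setIntegral_congr_fun hDm (g := fun _ => (0 : ℝ)) fun x hx => ?_, integral_zero]
  simp only
  rw [h0 x (hD hx), zero_mul]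

theorem inField_klVar (ha : IsGaussianField P σ l Ω a) (hDm : MeasurableSet D)
    (hD : D ⊆ Ω) (hDf : volume D ≠ ⊤) (hKL : IsKLSystem σ l D lam e) (m : ℕ) :
    InField ha (klVar D lam e a m) :=
  (inField_integral_field ha hDm hD hDf (hKL.memLp m)).const_mul _

theorem integral_mul_klVar (ha : IsGaussianField P σ l Ω a) (hDm : MeasurableSet D)
    (hD : D ⊆ Ω) (hDf : volume D ≠ ⊤) (hKL : IsKLSystem σ l D lam e) (m : ℕ)
    {Z : Θ → ℝ} (hZ : MemLp Z 2 P) :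
    ∫ θ, Z θ * klVar D lam e a m θ ∂P =
      (Real.sqrt (lam m))⁻¹ * ∫ x in D, (∫ θ, Z θ * a x θ ∂P) * e m x := by
  rw [← integral_mul_integral_field ha hDm hD hDf (hKL.memLp m) hZ, ← integral_const_mul]
  refine integral_congr_ae (.of_forall fun θ => ?_)
  simp only [klVar]
  exact mul_left_comm _ _ _

/-- Fubini turns the expectation into the covariance operator applied to `e m`. The eigenvalue
equation is needed at the point y itself, not merely almost everywhere. -/
theorem integral_field_mul_klVar (ha : IsGaussianField P σ l Ω a) (hDm : MeasurableSet D)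
    (hD : D ⊆ Ω) (hDf : volume D ≠ ⊤) (hKL : IsKLSystem σ l D lam e) (m : ℕ) {y : Plane}
    (hy : y ∈ D) :
    ∫ θ, a y θ * klVar D lam e a m θ ∂P = Real.sqrt (lam m) * e m y := by
  rw [integral_mul_klVar ha hDm hD hDf hKL m (ha.memLp ⟨y, hD hy⟩)]
  have h : ∫ x in D, (∫ θ, a y θ * a x θ ∂P) * e m x = lam m * e m y := by
    rw [← hKL.eigen m y hy]
    refine setIntegral_congr_fun hDm fun x hx => ?_
    rw [ha.covariance y (hD hy) x (hD hx), covKernel_comm]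
  rw [h]
  have hp := Real.sqrt_pos.2 (hKL.pos m)
  field_simp
  rw [Real.sq_sqrt (hKL.pos m).le]

theorem integral_klVar_mul_klVar (ha : IsGaussianField P σ l Ω a) (hDm : MeasurableSet D)
    (hD : D ⊆ Ω) (hDf : volume D ≠ ⊤) (hKL : IsKLSystem σ l D lam e) (m n : ℕ) :
    ∫ θ, klVar D lam e a m θ * klVar D lam e a n θ ∂P = if m = n then 1 else 0 := by
  rw [integral_mul_klVar ha hDm hD hDf hKL n (inField_klVar ha hDm hD hDf hKL m).memLp]
  have h : ∫ x in D, (∫ θ, klVar D lam e a m θ * a x θ ∂P) * e n x =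
      ∫ x in D, Real.sqrt (lam m) * (e m x * e n x) := by
    refine setIntegral_congr_fun hDm fun x hx => ?_
    simp_rw [mul_comm (klVar D lam e a m _)]
    rw [integral_field_mul_klVar ha hDm hD hDf hKL m hx]
    ring
  rw [h, integral_const_mul, hKL.orthonormal]
  have hp := Real.sqrt_pos.2 (hKL.pos n)
  split_ifs with hmn
  · subst hmn
    field_simp
  · simp

theorem map_klVar (ha : IsGaussianField P σ l Ω a) (hDm : MeasurableSet D)
    (hD : D ⊆ Ω) (hDf : volume D ≠ ⊤) (hKL : IsKLSystem σ l D lam e) (M : ℕ) :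
    P.map (fun θ (m : Fin M) => klVar D lam e a m θ) = stdGaussianPi M :=
  map_eq_stdGaussianPi (fun m => inField_klVar ha hDm hD hDf hKL m) fun m n => by
    rw [integral_klVar_mul_klVar ha hDm hD hDf hKL]
    simp [Fin.ext_iff]

/-- The variance `∑_{m < M} λ_m e_m(x)²` of the truncated expansion at `x`. -/
def klVariance (lam : ℕ → ℝ) (e : ℕ → Plane → ℝ) (M : ℕ) (x : Plane) : ℝ :=
  ∑ m : Fin M, lam m * e m x ^ 2

theorem inField_klSum (ha : IsGaussianField P σ l Ω a) (hDm : MeasurableSet D)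
    (hD : D ⊆ Ω) (hDf : volume D ≠ ⊤) (hKL : IsKLSystem σ l D lam e) (M : ℕ) (x : Plane) :
    InField ha (fun θ => klSum lam e (fun m : Fin M => klVar D lam e a m θ) x) :=
  InField.sum _ fun m => (inField_klVar ha hDm hD hDf hKL m).const_mul _

theorem integral_field_mul_klSum (ha : IsGaussianField P σ l Ω a) (hDm : MeasurableSet D)
    (hD : D ⊆ Ω) (hDf : volume D ≠ ⊤) (hKL : IsKLSystem σ l D lam e) (M : ℕ) {x : Plane}
    (hx : x ∈ D) :
    ∫ θ, a x θ * klSum lam e (fun m : Fin M => klVar D lam e a m θ) x ∂P =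
      klVariance lam e M x := by
  simp only [klSum, Finset.mul_sum, klVariance]
  have hi (m : Fin M) : Integrable (fun θ => a x θ * klVar D lam e a m θ) P :=
    (ha.memLp ⟨x, hD hx⟩).integrable_mul (inField_klVar ha hDm hD hDf hKL m).memLp
  simp_rw [mul_left_comm (a x _)]
  rw [integral_finsetSum _ fun m _ => (hi m).const_mul _]
  refine Finset.sum_congr rfl fun m _ => ?_
  rw [integral_const_mul, integral_field_mul_klVar ha hDm hD hDf hKL m hx]
  have := Real.mul_self_sqrt (hKL.pos m).le
  linear_combination e m x ^ 2 * this

theorem integral_klSum_sq (ha : IsGaussianField P σ l Ω a) (hDm : MeasurableSet D)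
    (hD : D ⊆ Ω) (hDf : volume D ≠ ⊤) (hKL : IsKLSystem σ l D lam e) (M : ℕ) (x : Plane) :
    ∫ θ, klSum lam e (fun m : Fin M => klVar D lam e a m θ) x ^ 2 ∂P = klVariance lam e M x := by
  have hi (m n : Fin M) : Integrable (fun θ => (Real.sqrt (lam m) * e m x) *
      (Real.sqrt (lam n) * e n x) * (klVar D lam e a m θ * klVar D lam e a n θ)) P :=
    ((inField_klVar ha hDm hD hDf hKL m).memLp.integrable_mul
      (inField_klVar ha hDm hD hDf hKL n).memLp).const_mul _
  have hexp (θ : Θ) : klSum lam e (fun m : Fin M => klVar D lam e a m θ) x ^ 2 =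
      ∑ m : Fin M, ∑ n : Fin M, (Real.sqrt (lam m) * e m x) *
      (Real.sqrt (lam n) * e n x) * (klVar D lam e a m θ * klVar D lam e a n θ) := by
    rw [klSum, sq, Finset.sum_mul_sum]
    refine Finset.sum_congr rfl fun m _ => Finset.sum_congr rfl fun n _ => by ring
  simp_rw [hexp]
  rw [integral_finsetSum _ fun m _ => integrable_finsetSum _ fun n _ => hi m n]
  refine Finset.sum_congr rfl fun m _ => ?_
  rw [integral_finsetSum _ fun n _ => hi m n]
  simp_rw [integral_const_mul, integral_klVar_mul_klVar ha hDm hD hDf hKL, ← Fin.ext_iff]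
  simp only [mul_ite, mul_one, mul_zero, Finset.sum_ite_eq, Finset.mem_univ, if_true]
  have := Real.mul_self_sqrt (hKL.pos m).le
  linear_combination e m x ^ 2 * this

theorem klVariance_nonneg (hKL : IsKLSystem σ l D lam e) (M : ℕ) (x : Plane) :
    0 ≤ klVariance lam e M x :=
  Finset.sum_nonneg fun m _ => mul_nonneg (hKL.pos m).le (sq_nonneg _)

/-- Pointwise Bessel inequality: the truncation b satisfies E(ab) = E(b²) = v, so v² ≤ σ²v. Being
uniform in x, it allows the chaos remainder to be bounded simultaneously at all points. -/
theorem klVariance_le (ha : IsGaussianField P σ l Ω a) (hDm : MeasurableSet D)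
    (hD : D ⊆ Ω) (hDf : volume D ≠ ⊤) (hKL : IsKLSystem σ l D lam e) (M : ℕ) {x : Plane}
    (hx : x ∈ D) : klVariance lam e M x ≤ σ ^ 2 := by
  have hb := (inField_klSum ha hDm hD hDf hKL M x).memLp
  have hax := ha.memLp ⟨x, hD hx⟩
  have h := sq_integral_mul_le hax hb
  rw [integral_field_mul_klSum ha hDm hD hDf hKL M hx, integral_klSum_sq ha hDm hD hDf hKL M x,
    ha.integral_sq (hD hx)] at h
  have h0 := klVariance_nonneg hKL M x
  rcases h0.eq_or_lt with h1 | h1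
  · rw [← h1]; positivity
  · rw [sq (klVariance lam e M x)] at h
    exact le_of_mul_le_mul_right h h1

theorem integrable_exp_sq_of_inField {ha : IsGaussianField P σ l Ω a} {X : Θ → ℝ}
    (hX : InField ha X) : Integrable (fun θ => Real.exp (X θ) ^ 2) P := by
  refine (hX.const_mul 2).integrable_exp.congr (.of_forall fun θ => ?_)
  simp only
  rw [← Real.exp_nat_mul]
  norm_num

theorem integral_exp_sq_of_inField {ha : IsGaussianField P σ l Ω a} {X : Θ → ℝ}
    (hX : InField ha X) : ∫ θ, Real.exp (X θ) ^ 2 ∂P = Real.exp (2 * ∫ θ, X θ ^ 2 ∂P) := by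
  have h := (hX.const_mul 2).integral_exp
  simp_rw [mul_pow, integral_const_mul] at h
  simp_rw [← Real.exp_nat_mul]
  norm_num at h ⊢
  rw [h]
  ring_nf

/-- Since a + b has variance σ² + 3v, the error equals exp(2σ²) - 2 exp((σ²+3v)/2) + exp(2v). As v ≤
σ², the last term is at most one copy of the middle exponential, and 1 + x ≤ exp(x) handles the
remaining difference. -/
theorem integral_exp_sub_sq_le (ha : IsGaussianField P σ l Ω a) (hDm : MeasurableSet D)
    (hD : D ⊆ Ω) (hDf : volume D ≠ ⊤) (hKL : IsKLSystem σ l D lam e) (M : ℕ) {x : Plane}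
    (hx : x ∈ D) :
    ∫ θ, (Real.exp (a x θ) -
      Real.exp (klSum lam e (fun m : Fin M => klVar D lam e a m θ) x)) ^ 2 ∂P ≤
      3 / 2 * Real.exp (2 * σ ^ 2) * (σ ^ 2 - klVariance lam e M x) := by
  set b : Θ → ℝ := fun θ => klSum lam e (fun m : Fin M => klVar D lam e a m θ) x with hb
  have hA : InField ha (a x) := inField_field ha (hD hx)
  have hB : InField ha b := inField_klSum ha hDm hD hDf hKL M x
  have hAB := hA.add hB
  set v := klVariance lam e M x
  have hBB : ∫ θ, b θ ^ 2 ∂P = v := integral_klSum_sq ha hDm hD hDf hKL M x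
  have hABv : ∫ θ, a x θ * b θ ∂P = v := integral_field_mul_klSum ha hDm hD hDf hKL M hx
  have hAA := ha.integral_sq (hD hx)
  have hv : v ≤ σ ^ 2 := klVariance_le ha hDm hD hDf hKL M hx
  have hi1 : Integrable (fun θ => a x θ ^ 2) P := hA.memLp.integrable_sq
  have hi2 : Integrable (fun θ => b θ ^ 2) P := hB.memLp.integrable_sq
  have hi3 : Integrable (fun θ => a x θ * b θ) P := hA.memLp.integrable_mul hB.memLp
  have hsum : ∫ θ, (a x θ + b θ) ^ 2 ∂P = σ ^ 2 + 3 * v := by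
    have h1 (θ : Θ) : (a x θ + b θ) ^ 2 = (a x θ ^ 2 + 2 * (a x θ * b θ)) + b θ ^ 2 := by ring
    simp_rw [h1]
    rw [integral_add (f := fun θ => a x θ ^ 2 + 2 * (a x θ * b θ)) (hi1.add (hi3.const_mul 2)) hi2,
      integral_add hi1 (hi3.const_mul 2), integral_const_mul, hAA, hBB, hABv]
    ring
  have hE1 := integral_exp_sq_of_inField hA
  have hE2 := integral_exp_sq_of_inField hB
  have hE3 := hAB.integral_exp
  have hj1 := integrable_exp_sq_of_inField hA
  have hj2 := integrable_exp_sq_of_inField hB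
  have hj3 := hAB.integrable_exp
  rw [hAA] at hE1
  rw [hBB] at hE2
  rw [hsum] at hE3
  have hexpand : ∫ θ, (Real.exp (a x θ) - Real.exp (b θ)) ^ 2 ∂P =
      Real.exp (2 * σ ^ 2) - 2 * Real.exp ((σ ^ 2 + 3 * v) / 2) + Real.exp (2 * v) := by
    have h1 (θ : Θ) : (Real.exp (a x θ) - Real.exp (b θ)) ^ 2 =
        (Real.exp (a x θ) ^ 2 - 2 * Real.exp (a x θ + b θ)) + Real.exp (b θ) ^ 2 := by
      rw [Real.exp_add]; ring
    simp_rw [h1]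
    rw [integral_add (f := fun θ => Real.exp (a x θ) ^ 2 - 2 * Real.exp (a x θ + b θ))
      (hj1.sub (hj3.const_mul 2)) hj2, integral_sub hj1 (hj3.const_mul 2), integral_const_mul,
      hE1, hE2, hE3]
  rw [hexpand]
  have h1 : Real.exp (2 * v) ≤ Real.exp ((σ ^ 2 + 3 * v) / 2) := Real.exp_le_exp.2 (by linarith)
  have h2 : Real.exp ((σ ^ 2 + 3 * v) / 2) =
      Real.exp (2 * σ ^ 2) * Real.exp (-(3 / 2 * (σ ^ 2 - v))) := by
    rw [← Real.exp_add]; congr 1; ring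
  have h3 := Real.add_one_le_exp (-(3 / 2 * (σ ^ 2 - v)))
  have h4 := mul_le_mul_of_nonneg_left h3 (Real.exp_pos (2 * σ ^ 2)).le
  rw [← h2] at h4
  linarith

end KL

/-! ### The trace formula and the truncation error -/

section Regular

variable {σ l : ℝ} {D : Set Plane} {lam : ℕ → ℝ} {e e' : ℕ → Plane → ℝ}

theorem IsKLSystem.congr (hKL : IsKLSystem σ l D lam e) (hDm : MeasurableSet D)
    (h : ∀ m, ∀ x ∈ D, e' m x = e m x) : IsKLSystem σ l D lam e' where
  pos := hKL.pos
  antitone := hKL.antitone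
  memLp m := (hKL.memLp m).ae_eq (by
    filter_upwards [ae_restrict_mem hDm] with x hx using (h m x hx).symm)
  orthonormal m n := by
    rw [← hKL.orthonormal m n]
    exact setIntegral_congr_fun hDm fun x hx => by simp only [h _ x hx]
  complete f hf h0 := hKL.complete f hf fun m => by
    rw [← h0 m]
    exact setIntegral_congr_fun hDm fun x hx => by simp only [h _ x hx]
  eigen m y hy := by
    rw [h m y hy, ← hKL.eigen m y hy]
    exact setIntegral_congr_fun hDm fun x hx => by simp only [h _ x hx]

theorem covKernel_nonneg (σ l : ℝ) (x y : Plane) : 0 ≤ covKernel σ l x y := by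
  unfold covKernel; positivity

theorem covKernel_le (σ : ℝ) (hl : 0 < l) (x y : Plane) : covKernel σ l x y ≤ σ ^ 2 := by
  unfold covKernel
  refine mul_le_of_le_one_right (sq_nonneg _) (Real.exp_le_one_iff.2 ?_)
  rw [neg_div]
  exact neg_nonpos.2 (by positivity)

/-- The eigenfunctions may be taken measurable and bounded on the whole plane. -/
theorem IsKLSystem.exists_regular (hKL : IsKLSystem σ l D lam e) (hl : 0 < l)
    (hDm : MeasurableSet D) (hDf : volume D ≠ ⊤) :
    ∃ e' : ℕ → Plane → ℝ, (∀ m, Measurable (e' m)) ∧ (∀ m, ∃ C, ∀ x, |e' m x| ≤ C) ∧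
      (∀ m, ∀ x ∈ D, e' m x = e m x) ∧ IsKLSystem σ l D lam e' := by
  have : IsFiniteMeasure (volume.restrict D) := ⟨by simpa using hDf.lt_top⟩
  -- The eigenvalue equation itself extends the eigenfunction off D; continuity and boundedness are
  -- inherited from the kernel.
  let e' : ℕ → Plane → ℝ := fun m y => (lam m)⁻¹ * ∫ x in D, covKernel σ l x y * e m x
  have heq : ∀ m, ∀ x ∈ D, e' m x = e m x := fun m y hy => by
    simp only [e']
    rw [hKL.eigen m y hy, inv_mul_cancel_left₀ (hKL.pos m).ne']
  have hint (m : ℕ) : Integrable (fun x => σ ^ 2 * |e m x|) (volume.restrict D) :=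
    ((hKL.memLp m).integrable one_le_two).abs.const_mul _
  have hle (m : ℕ) (x y : Plane) : ‖covKernel σ l x y * e m x‖ ≤ σ ^ 2 * |e m x| := by
    rw [norm_mul, Real.norm_eq_abs, Real.norm_eq_abs, abs_of_nonneg (covKernel_nonneg _ _ _ _)]
    gcongr
    exact covKernel_le σ hl x y
  refine ⟨e', fun m => ?_, fun m => ?_, heq, hKL.congr hDm heq⟩
  · refine Continuous.measurable (continuous_const.mul ?_)
    refine continuous_of_dominated (fun y => ?_) (fun y => .of_forall fun x => hle m x y)
      (hint m) (.of_forall fun x => ?_)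
    · exact ((continuous_covKernel σ l).comp
        (continuous_id.prodMk continuous_const)).aestronglyMeasurable.mul (hKL.memLp m).1
    · exact ((continuous_covKernel σ l).comp
        (continuous_const.prodMk continuous_id)).mul continuous_const
  · refine ⟨|(lam m)⁻¹| * ∫ x in D, σ ^ 2 * |e m x|, fun y => ?_⟩
    simp only [e', abs_mul]
    gcongr
    rw [← Real.norm_eq_abs]
    exact norm_integral_le_of_norm_le (hint m) (.of_forall fun x => hle m x y)

/-- Parseval: completeness says that the span has trivial orthogonal complement, so the
eigenfunctions form a Hilbert basis. -/
theorem IsKLSystem.hasSum_sq_integral (hKL : IsKLSystem σ l D lam e) {f : Plane → ℝ}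
    (hf : MemLp f 2 (volume.restrict D)) :
    HasSum (fun m => (∫ x in D, f x * e m x) ^ 2) (∫ x in D, f x ^ 2) := by
  let v : ℕ → Lp ℝ 2 (volume.restrict D) := fun m => (hKL.memLp m).toLp (e m)
  have hv : Orthonormal ℝ v := orthonormal_iff_ite.2 fun m n => by
    simp only [v]
    rw [toLp_inner_toLp, hKL.orthonormal]
  have hsp : (Submodule.span ℝ (Set.range v))ᗮ = ⊥ := by
    refine (Submodule.eq_bot_iff _).2 fun g hg => ?_
    refine Lp.ext ((hKL.complete g (Lp.memLp g) fun m => ?_).trans (Lp.coeFn_zero _ _ _).symm)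
    have h := (Submodule.mem_orthogonal' _ _).1 hg (v m) (Submodule.subset_span ⟨m, rfl⟩)
    rwa [← Lp.toLp_coeFn g (Lp.memLp g), toLp_inner_toLp] at h
  have h := (HilbertBasis.mkOfOrthogonalEqBot hv hsp).hasSum_inner_mul_inner (hf.toLp f)
    (hf.toLp f)
  rw [toLp_inner_toLp] at h
  simp only [HilbertBasis.coe_mkOfOrthogonalEqBot] at h
  simp_rw [sq]
  refine h.congr_fun fun m => ?_
  rw [real_inner_comm (hf.toLp f) (v m), toLp_inner_toLp]

theorem klTail_eq (hKL : IsKLSystem σ l D lam e) (M : ℕ) :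
    klTail D lam e M = ∑' m, lam (M + m) := by
  rw [klTail]
  refine tsum_congr fun m => ?_
  have h := hKL.orthonormal (M + m) (M + m)
  simp only [if_true, ← sq] at h
  rw [h, mul_one]

theorem aestronglyMeasurable_klSum {Θ : Type*} [MeasurableSpace Θ] {P : Measure Θ} [SFinite P]
    {M : ℕ} (he : ∀ m, Measurable (e m))
    {η : Θ → Fin M → ℝ} (hη : AEMeasurable η P) :
    AEStronglyMeasurable (fun p : Plane × Θ => klSum lam e (η p.2) p.1)
      ((volume.restrict D).prod P) := by
  have h1 : AEMeasurable (fun p : Plane × Θ => (p.1, η p.2)) ((volume.restrict D).prod P) :=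
    measurable_fst.aemeasurable.prodMk hη.comp_snd
  have h2 : Measurable fun q : Plane × (Fin M → ℝ) => klSum lam e q.2 q.1 := by
    unfold klSum
    fun_prop
  exact (h2.comp_aemeasurable h1).aestronglyMeasurable

end Regular

section KL

variable {Θ : Type*} [MeasurableSpace Θ] {P : Measure Θ}
  {σ l : ℝ} {Ω D : Set Plane} {a : Plane → Θ → ℝ} {lam : ℕ → ℝ} {e : ℕ → Plane → ℝ}
  [IsProbabilityMeasure P]

theorem integral_sq_integral_field_mul (ha : IsGaussianField P σ l Ω a) (hDm : MeasurableSet D)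
    (hD : D ⊆ Ω) (hDf : volume D ≠ ⊤) (hKL : IsKLSystem σ l D lam e) (m : ℕ) :
    ∫ θ, (∫ x in D, a x θ * e m x) ^ 2 ∂P = lam m := by
  have h := integral_klVar_mul_klVar ha hDm hD hDf hKL m m
  simp only [if_true, ← sq, klVar, mul_pow, integral_const_mul, inv_pow,
    Real.sq_sqrt (hKL.pos m).le] at h
  field_simp [(hKL.pos m).ne'] at h
  exact h

/-- Parseval for almost every sample path, then expectation: the coefficients have second moments
λ_m and the squared path norm has mean σ²|D|. This replaces Mercer's theorem. Working in `ENNReal`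
lets Tonelli apply before summability is known. -/
theorem hasSum_eigenvalues (ha : IsGaussianField P σ l Ω a) (hDm : MeasurableSet D)
    (hD : D ⊆ Ω) (hDf : volume D ≠ ⊤) (hKL : IsKLSystem σ l D lam e) :
    HasSum lam (σ ^ 2 * volume.real D) := by
  have : IsFiniteMeasure (volume.restrict D) := ⟨by simpa using hDf.lt_top⟩
  have h1 := memLp_field_prod ha hDm hD hDf
  have hL (m : ℕ) := memLp_integral_field_mul ha hDm hD hDf (hKL.memLp m)
  have hae : ∀ᵐ θ ∂P, ENNReal.ofReal (∫ x in D, a x θ ^ 2) =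
      ∑' m, ENNReal.ofReal ((∫ x in D, a x θ * e m x) ^ 2) := by
    filter_upwards [h1.integrable_sq.prod_left_ae, h1.1.prod_swap.prodMk_left] with θ hθ hθm
    have hθm' : AEStronglyMeasurable (fun x => a x θ) (volume.restrict D) := hθm
    have h := hKL.hasSum_sq_integral ((memLp_two_iff_integrable_sq hθm').2 hθ)
    rw [← ENNReal.ofReal_tsum_of_nonneg (fun m => sq_nonneg _) h.summable, h.tsum_eq]
  have hsum : ENNReal.ofReal (σ ^ 2 * volume.real D) = ∑' m, ENNReal.ofReal (lam m) := by
    have h2 := lintegral_congr_ae hae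
    rw [lintegral_tsum fun m => ((hL m).1.aemeasurable.pow_const 2).ennreal_ofReal,
      ← ofReal_integral_eq_lintegral_ofReal h1.integrable_sq.integral_prod_right
        (.of_forall fun θ => integral_nonneg fun x => sq_nonneg _),
      ← integral_integral_swap (f := fun x θ => a x θ ^ 2) h1.integrable_sq] at h2
    have h3 : ∫ x in D, ∫ θ, a x θ ^ 2 ∂P = σ ^ 2 * volume.real D := by
      rw [setIntegral_congr_fun hDm (g := fun _ => σ ^ 2) fun x hx => ha.integral_sq (hD hx)]
      simp [mul_comm]
    rw [h3] at h2
    rw [h2]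
    refine tsum_congr fun m => ?_
    rw [← ofReal_integral_eq_lintegral_ofReal (hL m).integrable_sq
      (.of_forall fun θ => sq_nonneg _), integral_sq_integral_field_mul ha hDm hD hDf hKL]
  have hs : Summable lam := by
    have h4 := ENNReal.summable_toReal (f := fun m => ENNReal.ofReal (lam m))
      (hsum ▸ ENNReal.ofReal_ne_top)
    simpa [ENNReal.toReal_ofReal (hKL.pos _).le] using h4
  rw [← ENNReal.ofReal_tsum_of_nonneg (fun m => (hKL.pos m).le) hs] at hsum
  have h5 := (ENNReal.ofReal_eq_ofReal_iff (by positivity)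
    (tsum_nonneg fun m => (hKL.pos m).le)).1 hsum
  rw [h5]
  exact hs.hasSum

theorem integral_klVariance (hKL : IsKLSystem σ l D lam e) (M : ℕ) :
    Integrable (klVariance lam e M) (volume.restrict D) ∧
    ∫ x in D, klVariance lam e M x = ∑ m ∈ Finset.range M, lam m := by
  have hi (m : ℕ) : Integrable (fun x => lam m * e m x ^ 2) (volume.restrict D) :=
    (hKL.memLp m).integrable_sq.const_mul _
  refine ⟨integrable_finsetSum _ fun m _ => hi m, ?_⟩
  unfold klVariance
  rw [integral_finsetSum _ fun (m : Fin M) _ => hi m, ← Fin.sum_univ_eq_sum_range]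
  refine Finset.sum_congr rfl fun m _ => ?_
  have h := hKL.orthonormal m m
  simp only [if_true, ← sq] at h
  rw [integral_const_mul, h, mul_one]

/-- The truncated variance integrates to the partial sum of the eigenvalues, so the trace formula
leaves precisely the tail. -/
theorem integral_variance_sub (ha : IsGaussianField P σ l Ω a) (hDm : MeasurableSet D)
    (hD : D ⊆ Ω) (hDf : volume D ≠ ⊤) (hKL : IsKLSystem σ l D lam e) (M : ℕ) :
    ∫ x in D, (σ ^ 2 - klVariance lam e M x) = klTail D lam e M := by
  have : IsFiniteMeasure (volume.restrict D) := ⟨by simpa using hDf.lt_top⟩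
  obtain ⟨hi, hI⟩ := integral_klVariance hKL M
  have hs := hasSum_eigenvalues ha hDm hD hDf hKL
  have h := hs.summable.sum_add_tsum_nat_add M
  rw [hs.tsum_eq] at h
  rw [integral_sub (integrable_const _) hi, hI, klTail_eq hKL]
  simp_rw [add_comm M]
  simp only [integral_const, smul_eq_mul, measureReal_restrict_apply MeasurableSet.univ, univ_inter]
  linarith

theorem klTail_le (ha : IsGaussianField P σ l Ω a) (hDm : MeasurableSet D)
    (hD : D ⊆ Ω) (hDf : volume D ≠ ⊤) (hKL : IsKLSystem σ l D lam e) (M : ℕ) :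
    klTail D lam e M ≤ σ ^ 2 * volume.real D := by
  have hs := hasSum_eigenvalues ha hDm hD hDf hKL
  have h := hs.summable.sum_add_tsum_nat_add M
  rw [hs.tsum_eq] at h
  rw [klTail_eq hKL]
  simp_rw [add_comm M]
  have := Finset.sum_nonneg fun m (_ : m ∈ Finset.range M) => (hKL.pos m).le
  linarith

theorem memLp_prod_of_integral_sq_le {F : Plane × Θ → ℝ} (hDm : MeasurableSet D)
    (hDf : volume D ≠ ⊤) (hF : AEStronglyMeasurable F ((volume.restrict D).prod P))
    (hi : ∀ x ∈ D, Integrable (fun θ => F (x, θ) ^ 2) P) {C : ℝ}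
    (hC : ∀ x ∈ D, ∫ θ, F (x, θ) ^ 2 ∂P ≤ C) :
    MemLp F 2 ((volume.restrict D).prod P) := by
  have : IsFiniteMeasure (volume.restrict D) := ⟨by simpa using hDf.lt_top⟩
  refine (memLp_two_iff_integrable_sq hF).2 ((integrable_prod_iff (hF.pow 2)).2 ⟨?_, ?_⟩)
  · filter_upwards [ae_restrict_mem hDm] with x hx using hi x hx
  · refine Integrable.of_bound (C := C) (hF.pow 2).norm.integral_prod_right' ?_
    filter_upwards [ae_restrict_mem hDm] with x hx
    rw [Real.norm_eq_abs, abs_of_nonneg (integral_nonneg fun θ => norm_nonneg _)]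
    simpa using hC x hx

theorem aemeasurable_klVar (ha : IsGaussianField P σ l Ω a) (hDm : MeasurableSet D)
    (hD : D ⊆ Ω) (hDf : volume D ≠ ⊤) (hKL : IsKLSystem σ l D lam e) (M : ℕ) :
    AEMeasurable (fun θ (m : Fin M) => klVar D lam e a m θ) P :=
  aemeasurable_pi_lambda _ fun m => (inField_klVar ha hDm hD hDf hKL m).memLp.1.aemeasurable

theorem memLp_exp_field (ha : IsGaussianField P σ l Ω a) (hDm : MeasurableSet D)
    (hD : D ⊆ Ω) (hDf : volume D ≠ ⊤) :
    MemLp (fun p : Plane × Θ => Real.exp (a p.1 p.2)) 2 ((volume.restrict D).prod P) := by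
  refine memLp_prod_of_integral_sq_le hDm hDf (C := Real.exp (2 * σ ^ 2))
    ha.measurable.exp.aestronglyMeasurable
    (fun x hx => integrable_exp_sq_of_inField (inField_field ha (hD hx))) fun x hx => ?_
  simp only
  rw [integral_exp_sq_of_inField (inField_field ha (hD hx)), ha.integral_sq (hD hx)]

theorem memLp_exp_klSum (ha : IsGaussianField P σ l Ω a) (hDm : MeasurableSet D)
    (hD : D ⊆ Ω) (hDf : volume D ≠ ⊤) (hKL : IsKLSystem σ l D lam e)
    (he : ∀ m, Measurable (e m)) (M : ℕ) :
    MemLp (fun p : Plane × Θ =>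
      Real.exp (klSum lam e (fun m : Fin M => klVar D lam e a m p.2) p.1)) 2
      ((volume.restrict D).prod P) := by
  refine memLp_prod_of_integral_sq_le hDm hDf (C := Real.exp (2 * σ ^ 2))
    (Real.continuous_exp.comp_aestronglyMeasurable
      (aestronglyMeasurable_klSum he (aemeasurable_klVar ha hDm hD hDf hKL M)))
    (fun x hx => integrable_exp_sq_of_inField (inField_klSum ha hDm hD hDf hKL M x))
    fun x hx => ?_
  simp only
  rw [integral_exp_sq_of_inField (inField_klSum ha hDm hD hDf hKL M x),
    integral_klSum_sq ha hDm hD hDf hKL M x]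
  gcongr
  exact klVariance_le ha hDm hD hDf hKL M hx

theorem integral_prod_exp_sub_sq_le (ha : IsGaussianField P σ l Ω a) (hDm : MeasurableSet D)
    (hD : D ⊆ Ω) (hDf : volume D ≠ ⊤) (hKL : IsKLSystem σ l D lam e)
    (he : ∀ m, Measurable (e m)) (M : ℕ) :
    ∫ p : Plane × Θ, (Real.exp (a p.1 p.2) -
      Real.exp (klSum lam e (fun m : Fin M => klVar D lam e a m p.2) p.1)) ^ 2
      ∂((volume.restrict D).prod P) ≤ 3 / 2 * Real.exp (2 * σ ^ 2) * klTail D lam e M := by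
  have : IsFiniteMeasure (volume.restrict D) := ⟨by simpa using hDf.lt_top⟩
  have hm := ((memLp_exp_field ha hDm hD hDf).sub
    (memLp_exp_klSum ha hDm hD hDf hKL he M)).integrable_sq
  simp only [Pi.sub_apply] at hm
  rw [integral_prod _ hm, ← integral_variance_sub ha hDm hD hDf hKL M, ← integral_const_mul]
  refine setIntegral_mono_on hm.integral_prod_left ?_ hDm fun x hx =>
    integral_exp_sub_sq_le ha hDm hD hDf hKL M hx
  exact ((integrable_const _).sub (integral_klVariance hKL M).1).const_mul _

end KL

/-! ### Random local matrices -/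

section Bessel

variable {Θ : Type*} [MeasurableSpace Θ] {P : Measure Θ}

/-- For the projection F of Z one has E(ZF) = E(F²), so E(Z - F)² ≥ 0 is the claim. -/
theorem integral_sq_orthogonal_sum_le {ι : Type*} [DecidableEq ι] (I : Finset ι)
    {u : ι → Θ → ℝ} (hu : ∀ i, MemLp (u i) 2 P)
    (ho : ∀ i j, ∫ θ, u i θ * u j θ ∂P = if i = j then 1 else 0) {Z : Θ → ℝ} (hZ : MemLp Z 2 P) :
    ∫ θ, (∑ i ∈ I, u i θ * ∫ ω, Z ω * u i ω ∂P) ^ 2 ∂P ≤ ∫ θ, Z θ ^ 2 ∂P := by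
  set c : ι → ℝ := fun i => ∫ ω, Z ω * u i ω ∂P with hc
  set F : Θ → ℝ := fun θ => ∑ i ∈ I, u i θ * c i with hF
  have hFm : MemLp F 2 P := memLp_finsetSum I fun i _ => (hu i).mul_const (c i)
  have hZu (i : ι) : Integrable (fun θ => Z θ * u i θ) P := hZ.integrable_mul (hu i)
  have huu (i j : ι) : Integrable (fun θ => u i θ * u j θ) P := (hu i).integrable_mul (hu j)
  have huF' (i : ι) : Integrable (fun θ => u i θ * F θ) P := (hu i).integrable_mul hFm
  have hZF : ∫ θ, Z θ * F θ ∂P = ∑ i ∈ I, c i ^ 2 := by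
    simp only [hF, Finset.mul_sum, ← mul_assoc]
    rw [integral_finsetSum _ fun i _ => (hZu i).mul_const _]
    refine Finset.sum_congr rfl fun i _ => ?_
    rw [integral_mul_const, sq]
  have huF (i : ι) (hi : i ∈ I) : ∫ θ, u i θ * F θ ∂P = c i := by
    simp only [hF, Finset.mul_sum, ← mul_assoc]
    rw [integral_finsetSum _ fun j _ => (huu i j).mul_const _]
    simp_rw [integral_mul_const]
    simp [ho, hi]
  have hFF : ∫ θ, F θ ^ 2 ∂P = ∑ i ∈ I, c i ^ 2 := by
    have h (θ : Θ) : F θ ^ 2 = ∑ i ∈ I, (u i θ * F θ) * c i := by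
      rw [sq]
      nth_rw 1 [hF]
      simp only [Finset.sum_mul]
      exact Finset.sum_congr rfl fun i _ => by ring
    simp_rw [h]
    rw [integral_finsetSum _ fun i _ => (huF' i).mul_const _]
    refine Finset.sum_congr rfl fun i hi => ?_
    rw [integral_mul_const, sq]
    congr 1
    exact huF i hi
  have h0 : 0 ≤ ∫ θ, (Z θ - F θ) ^ 2 ∂P := integral_nonneg fun θ => sq_nonneg _
  have h1 : ∫ θ, (Z θ - F θ) ^ 2 ∂P =
      ∫ θ, Z θ ^ 2 ∂P - 2 * ∫ θ, Z θ * F θ ∂P + ∫ θ, F θ ^ 2 ∂P := by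
    have hi : Integrable (fun θ => Z θ * F θ) P := hZ.integrable_mul hFm
    have h2 : Integrable (fun θ => Z θ ^ 2 - 2 * (Z θ * F θ)) P :=
      hZ.integrable_sq.sub (hi.const_mul 2)
    rw [← integral_const_mul, ← integral_sub hZ.integrable_sq (hi.const_mul 2),
      ← integral_add h2 hFm.integrable_sq]
    congr 1
    ext θ
    ring
  linarith

variable {M : ℕ} {ξ : Θ → Fin M → ℝ}

theorem memLp_psi_comp (hξm : AEMeasurable ξ P) (hξ : P.map ξ = stdGaussianPi M)
    (α : Fin M → ℕ) : MemLp (fun θ => psi α (ξ θ)) 2 P := by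
  have h := memLp_psi α
  rw [← hξ] at h
  exact (memLp_map_measure_iff h.1 hξm).1 h

theorem integral_comp_eq (hξm : AEMeasurable ξ P) (hξ : P.map ξ = stdGaussianPi M)
    {f : (Fin M → ℝ) → ℝ} (hf : Continuous f) :
    ∫ θ, f (ξ θ) ∂P = ∫ y, f y ∂(stdGaussianPi M) := by
  rw [← hξ, integral_map hξm hf.aestronglyMeasurable]

theorem pcTrunc_apply {R S : Finset Plane} (d : ℕ) (B : Θ → Matrix R S ℝ) (θ : Θ) (s : R)
    (t : S) : pcTrunc P d ξ B θ s t =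
      ∑ α ∈ multiIdx M d, psi α (ξ θ) * ∫ ω, B ω s t * psi α (ξ ω) ∂P := by
  simp [pcTrunc, Matrix.sum_apply]

theorem memLp_pcTrunc_apply (hξm : AEMeasurable ξ P) (hξ : P.map ξ = stdGaussianPi M)
    {R S : Finset Plane} (d : ℕ) (B : Θ → Matrix R S ℝ) (s : R) (t : S) :
    MemLp (fun θ => pcTrunc P d ξ B θ s t) 2 P := by
  simp only [pcTrunc_apply]
  exact memLp_finsetSum _ fun α _ => (memLp_psi_comp hξm hξ α).mul_const _

/-- The chaos projection is a contraction in `L²`. -/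
theorem integral_sq_pcTrunc_apply_le (hξm : AEMeasurable ξ P) (hξ : P.map ξ = stdGaussianPi M)
    {R S : Finset Plane} (d : ℕ) {B : Θ → Matrix R S ℝ} (s : R) (t : S)
    (hB : MemLp (fun θ => B θ s t) 2 P) :
    ∫ θ, pcTrunc P d ξ B θ s t ^ 2 ∂P ≤ ∫ θ, B θ s t ^ 2 ∂P := by
  simp only [pcTrunc_apply]
  refine integral_sq_orthogonal_sum_le _ (memLp_psi_comp hξm hξ) (fun α β => ?_) hB
  rw [← integral_psi_mul_psi α β]
  exact integral_comp_eq hξm hξ ((continuous_psi α).mul (continuous_psi β))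

theorem pcTrunc_sub (hξm : AEMeasurable ξ P) (hξ : P.map ξ = stdGaussianPi M)
    {R S : Finset Plane} (d : ℕ) {B B' : Θ → Matrix R S ℝ}
    (hB : ∀ s t, MemLp (fun θ => B θ s t) 2 P) (hB' : ∀ s t, MemLp (fun θ => B' θ s t) 2 P)
    (θ : Θ) : pcTrunc P d ξ (fun θ => B θ - B' θ) θ = pcTrunc P d ξ B θ - pcTrunc P d ξ B' θ := by
  ext s t
  rw [Matrix.sub_apply]
  simp only [pcTrunc_apply, ← Finset.sum_sub_distrib, ← mul_sub, Matrix.sub_apply, sub_mul]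
  refine Finset.sum_congr rfl fun α _ => ?_
  congr 1
  exact integral_sub ((hB s t).integrable_mul (memLp_psi_comp hξm hξ α))
    ((hB' s t).integrable_mul (memLp_psi_comp hξm hξ α))

theorem aestronglyMeasurable_matrix {m n : Type*} [Fintype m] [Fintype n] [DecidableEq m]
    [DecidableEq n] {A : Θ → Matrix m n ℝ} (hA : ∀ i j, AEStronglyMeasurable (fun θ => A θ i j) P) :
    AEStronglyMeasurable A P := by
  have h : A = fun θ => ∑ i, ∑ j, A θ i j • Matrix.single i j (1 : ℝ) := by
    ext1 θ
    refine (Matrix.matrix_eq_sum_single (A θ)).trans ?_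
    simp [Matrix.smul_single]
  rw [h]
  exact Finset.aestronglyMeasurable_fun_sum _ fun i _ =>
    Finset.aestronglyMeasurable_fun_sum _ fun j _ => (hA i j).smul_const _

theorem lintegral_norm_matrix_sq_le {m n : Type*} [Fintype m] [Fintype n] [DecidableEq n]
    {A : Θ → Matrix m n ℝ} (hA : ∀ i j, MemLp (fun θ => A θ i j) 2 P) :
    ∫⁻ θ, ENNReal.ofReal (‖A θ‖ ^ 2) ∂P ≤
      ENNReal.ofReal (∑ i, ∑ j, ∫ θ, A θ i j ^ 2 ∂P) := by
  have hi (i : m) : Integrable (fun θ => ∑ j, A θ i j ^ 2) P :=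
    integrable_finsetSum _ fun j _ => (hA i j).integrable_sq
  have h : ∑ i, ∑ j, ∫ θ, A θ i j ^ 2 ∂P = ∫ θ, ∑ i, ∑ j, A θ i j ^ 2 ∂P := by
    rw [integral_finsetSum _ fun i _ => hi i]
    refine Finset.sum_congr rfl fun i _ => ?_
    rw [integral_finsetSum _ fun j _ => (hA i j).integrable_sq]
  rw [h, ofReal_integral_eq_lintegral_ofReal (integrable_finsetSum _ fun i _ => hi i)
    (.of_forall fun θ => Finset.sum_nonneg fun _ _ => Finset.sum_nonneg fun _ _ => sq_nonneg _)]
  exact lintegral_mono fun θ => ENNReal.ofReal_le_ofReal (norm_matrix_sq_le_sum_sq _)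

end Bessel

/-! ### Mean square bounds for local matrices with random coefficients -/

section Random

variable {Θ : Type*} [MeasurableSpace Θ] {P : Measure Θ} [IsProbabilityMeasure P]
  {T : Geometry.SimplicialComplex ℝ Plane} {Ω : Set Plane} {γ h : ℝ} {E : Set (Finset Plane)}

theorem localMatrix_apply (D : Set Plane) (R S : Finset Plane) (κ : Plane → ℝ) (s : R) (t : S) :
    localMatrix T D R S κ s t = ∫ x in D, κ x * gradProd T s t x := rfl

theorem localMatrix_congr {D : Set Plane} (hD : MeasurableSet D) (R S : Finset Plane)
    {κ κ' : Plane → ℝ} (hκ : ∀ x ∈ D, κ x = κ' x) :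
    localMatrix T D R S κ = localMatrix T D R S κ' := by
  ext s t
  exact setIntegral_congr_fun hD fun x hx => by simp only [hκ x hx]

variable {κ κ' : Plane × Θ → ℝ}

theorem ae_memLp_left {D : Set Plane} [SFinite (volume.restrict D)]
    (hκ : MemLp κ 2 ((volume.restrict D).prod P)) :
    ∀ᵐ θ ∂P, MemLp (fun x => κ (x, θ)) 2 (volume.restrict D) := by
  filter_upwards [hκ.integrable_sq.prod_left_ae, hκ.1.prod_swap.prodMk_left] with θ h1 h2
  have h3 : AEStronglyMeasurable (fun x => κ (x, θ)) (volume.restrict D) := h2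
  exact (memLp_two_iff_integrable_sq h3).2 h1

theorem aestronglyMeasurable_localMatrix (hκ : MemLp κ 2 ((volume.restrict (subdomain E)).prod P))
    (R S : Finset Plane) (s : R) (t : S) :
    AEStronglyMeasurable
      (fun θ => localMatrix T (subdomain E) R S (fun x => κ (x, θ)) s t) P := by
  have h : AEStronglyMeasurable (fun p : Plane × Θ => κ p * gradProd T s t p.1)
      ((volume.restrict (subdomain E)).prod P) :=
    hκ.1.mul ((measurable_gradProd s t).comp measurable_fst).aestronglyMeasurable
  exact h.prod_swap.integral_prod_right'

theorem IsTriangulation.integral_sum_sq_localMatrix_le (hT : IsTriangulation T Ω γ h) (hγ : 0 < γ)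
    (hh : 0 < h) (hE : E ⊆ elements T) (R S : Finset Plane)
    (hκ : MemLp κ 2 ((volume.restrict (subdomain E)).prod P)) :
    (∀ (s : R) (t : S),
      MemLp (fun θ => localMatrix T (subdomain E) R S (fun x => κ (x, θ)) s t) 2 P) ∧
    ∑ s, ∑ t, ∫ θ, localMatrix T (subdomain E) R S (fun x => κ (x, θ)) s t ^ 2 ∂P ≤
      9 * Real.pi / γ ^ 8 / h ^ 2 *
        ∫ p, κ p ^ 2 ∂((volume.restrict (subdomain E)).prod P) := by
  set c := 9 * Real.pi / γ ^ 8 / h ^ 2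
  have hI : Integrable (fun θ => c * ∫ x in subdomain E, κ (x, θ) ^ 2) P :=
    hκ.integrable_sq.integral_prod_right.const_mul _
  have hle : ∀ᵐ θ ∂P, ∑ s, ∑ t, localMatrix T (subdomain E) R S (fun x => κ (x, θ)) s t ^ 2 ≤
      c * ∫ x in subdomain E, κ (x, θ) ^ 2 := by
    filter_upwards [ae_memLp_left hκ] with θ hθ
    exact hT.sum_sq_localMatrix_le hγ hh hE R S hθ
  have hL (s : R) (t : S) :
      MemLp (fun θ => localMatrix T (subdomain E) R S (fun x => κ (x, θ)) s t) 2 P := by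
    have hm := aestronglyMeasurable_localMatrix (T := T) hκ R S s t
    refine (memLp_two_iff_integrable_sq hm).2 (hI.mono' (hm.pow 2) ?_)
    filter_upwards [hle] with θ hθ
    rw [Real.norm_eq_abs, abs_of_nonneg (sq_nonneg _)]
    refine le_trans ?_ hθ
    refine le_trans ?_ (Finset.single_le_sum (fun s _ => Finset.sum_nonneg fun t _ => sq_nonneg _)
      (Finset.mem_univ s))
    exact Finset.single_le_sum
      (f := fun t => localMatrix T (subdomain E) R S (fun x => κ (x, θ)) s t ^ 2)
      (fun t _ => sq_nonneg _) (Finset.mem_univ t)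
  refine ⟨hL, ?_⟩
  have hi (s : R) : Integrable (fun θ => ∑ t : S,
      localMatrix T (subdomain E) R S (fun x => κ (x, θ)) s t ^ 2) P :=
    integrable_finsetSum _ fun t _ => (hL s t).integrable_sq
  calc _ = ∫ θ, ∑ s : R, ∑ t : S,
        localMatrix T (subdomain E) R S (fun x => κ (x, θ)) s t ^ 2 ∂P := by
        rw [integral_finsetSum _ fun s _ => hi s]
        refine Finset.sum_congr rfl fun s _ => ?_
        rw [integral_finsetSum _ fun t _ => (hL s t).integrable_sq]
    _ ≤ ∫ θ, c * (∫ x in subdomain E, κ (x, θ) ^ 2) ∂P :=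
        integral_mono_ae (integrable_finsetSum _ fun s _ => hi s) hI hle
    _ = _ := by
        rw [integral_const_mul, integral_prod_symm _ hκ.integrable_sq]

theorem IsTriangulation.ae_localMatrix_sub (hT : IsTriangulation T Ω γ h) (hγ : 0 < γ)
    (hh : 0 < h) (hE : E ⊆ elements T) (hEf : volume (subdomain E) ≠ ⊤) (R S : Finset Plane)
    (hκ : MemLp κ 2 ((volume.restrict (subdomain E)).prod P))
    (hκ' : MemLp κ' 2 ((volume.restrict (subdomain E)).prod P)) :
    ∀ᵐ θ ∂P, localMatrix T (subdomain E) R S (fun x => κ (x, θ)) -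
      localMatrix T (subdomain E) R S (fun x => κ' (x, θ)) =
      localMatrix T (subdomain E) R S (fun x => κ (x, θ) - κ' (x, θ)) := by
  have : IsFiniteMeasure (volume.restrict (subdomain E)) := ⟨by simpa using hEf.lt_top⟩
  filter_upwards [ae_memLp_left hκ, ae_memLp_left hκ'] with θ h1 h2
  ext s t
  have hb (f : Plane → ℝ) (hf : MemLp f 2 (volume.restrict (subdomain E))) :
      Integrable (fun x => f x * gradProd T s t x) (volume.restrict (subdomain E)) :=
    (hf.integrable one_le_two).mul_bdd (c := ((γ ^ 2 * h)⁻¹) ^ 2)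
      (measurable_gradProd s t).aestronglyMeasurable
      (by simpa using hT.ae_abs_gradProd_le hγ hh hE s t)
  rw [Matrix.sub_apply]
  simp only [localMatrix_apply, sub_mul]
  rw [integral_sub (hb _ h1) (hb _ h2)]

theorem IsTriangulation.lintegral_norm_localMatrix_sub_le (hT : IsTriangulation T Ω γ h)
    (hγ : 0 < γ) (hh : 0 < h) (hE : E ⊆ elements T) (hEf : volume (subdomain E) ≠ ⊤)
    (R S : Finset Plane) (hκ : MemLp κ 2 ((volume.restrict (subdomain E)).prod P))
    (hκ' : MemLp κ' 2 ((volume.restrict (subdomain E)).prod P)) :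
    ∫⁻ θ, ENNReal.ofReal (‖localMatrix T (subdomain E) R S (fun x => κ (x, θ)) -
      localMatrix T (subdomain E) R S (fun x => κ' (x, θ))‖ ^ 2) ∂P ≤
      ENNReal.ofReal (9 * Real.pi / γ ^ 8 / h ^ 2 *
        ∫ p, (κ p - κ' p) ^ 2 ∂((volume.restrict (subdomain E)).prod P)) := by
  have h1 := hT.integral_sum_sq_localMatrix_le hγ hh hE R S (hκ.sub hκ')
  rw [lintegral_congr_ae (g := fun θ => ENNReal.ofReal
    (‖localMatrix T (subdomain E) R S (fun x => (κ - κ') (x, θ))‖ ^ 2)) ?_]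
  · exact (lintegral_norm_matrix_sq_le h1.1).trans (ENNReal.ofReal_le_ofReal h1.2)
  · filter_upwards [hT.ae_localMatrix_sub hγ hh hE hEf R S hκ hκ'] with θ hθ
    rw [hθ]
    rfl

/-- The chaos projection contracts single entries in L²(P), not the spectral norm. Hence the passage
through the Frobenius norm, which gives the same constant as without projection. -/
theorem IsTriangulation.lintegral_norm_pcTrunc_localMatrix_sub_le (hT : IsTriangulation T Ω γ h)
    (hγ : 0 < γ) (hh : 0 < h) (hE : E ⊆ elements T) (hEf : volume (subdomain E) ≠ ⊤)
    (R S : Finset Plane) (hκ : MemLp κ 2 ((volume.restrict (subdomain E)).prod P))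
    (hκ' : MemLp κ' 2 ((volume.restrict (subdomain E)).prod P)) {M : ℕ} {ξ : Θ → Fin M → ℝ}
    (hξm : AEMeasurable ξ P) (hξ : P.map ξ = stdGaussianPi M) (d : ℕ) :
    ∫⁻ θ, ENNReal.ofReal
      (‖pcTrunc P d ξ (fun θ => localMatrix T (subdomain E) R S (fun x => κ (x, θ))) θ -
        pcTrunc P d ξ (fun θ => localMatrix T (subdomain E) R S (fun x => κ' (x, θ))) θ‖ ^ 2) ∂P ≤
      ENNReal.ofReal (9 * Real.pi / γ ^ 8 / h ^ 2 *
        ∫ p, (κ p - κ' p) ^ 2 ∂((volume.restrict (subdomain E)).prod P)) := by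
  have h0 := hT.integral_sum_sq_localMatrix_le hγ hh hE R S hκ
  have h0' := hT.integral_sum_sq_localMatrix_le hγ hh hE R S hκ'
  have h1 := hT.integral_sum_sq_localMatrix_le hγ hh hE R S (hκ.sub hκ')
  have hs := hT.ae_localMatrix_sub hγ hh hE hEf R S hκ hκ'
  simp_rw [← pcTrunc_sub hξm hξ d h0.1 h0'.1]
  refine (lintegral_norm_matrix_sq_le fun s t => memLp_pcTrunc_apply hξm hξ d _ s t).trans
    (ENNReal.ofReal_le_ofReal (le_trans ?_ h1.2))
  refine Finset.sum_le_sum fun s _ => Finset.sum_le_sum fun t _ => ?_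
  refine (integral_sq_pcTrunc_apply_le hξm hξ d s t ?_).trans (le_of_eq ?_)
  · exact (h0.1 s t).sub (h0'.1 s t)
  · refine integral_congr_ae ?_
    filter_upwards [hs] with θ hθ
    rw [hθ]
    rfl

end Random

/-! ### The chaos remainder of a local matrix -/

section Chaos

variable {Θ : Type*} [MeasurableSpace Θ] {P : Measure Θ} [IsProbabilityMeasure P]
  {T : Geometry.SimplicialComplex ℝ Plane} {Ω : Set Plane} {γ h : ℝ} {E : Set (Finset Plane)}
  {lam : ℕ → ℝ} {e : ℕ → Plane → ℝ} {M : ℕ} {ξ : Θ → Fin M → ℝ}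

/-- The coefficients of `klSum lam e v x`, as a linear form in `v`. -/
def klCoeff (lam : ℕ → ℝ) (e : ℕ → Plane → ℝ) (M : ℕ) (x : Plane) (m : Fin M) : ℝ :=
  Real.sqrt (lam m) * e m x

theorem klSum_eq (v : Fin M → ℝ) (x : Plane) :
    klSum lam e v x = ∑ m, klCoeff lam e M x m * v m := rfl

theorem sum_klCoeff_sq (hlam : ∀ m, 0 ≤ lam m) (x : Plane) :
    ∑ m, klCoeff lam e M x m ^ 2 = klVariance lam e M x := by
  simp only [klCoeff, klVariance, mul_pow, Real.sq_sqrt (hlam _)]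

/-- By Fubini, the chaos coefficient of a matrix entry is the entry formed with the pointwise chaos
coefficient of the exponential. -/
theorem IsTriangulation.integral_localMatrix_mul_psi (hT : IsTriangulation T Ω γ h) (hγ : 0 < γ)
    (hh : 0 < h) (hE : E ⊆ elements T) (hEf : volume (subdomain E) ≠ ⊤) (R S : Finset Plane)
    (hκ : MemLp (fun p : Plane × Θ => Real.exp (klSum lam e (ξ p.2) p.1)) 2
      ((volume.restrict (subdomain E)).prod P))
    (hξm : AEMeasurable ξ P) (hξ : P.map ξ = stdGaussianPi M) (α : Fin M → ℕ) (s : R) (t : S) :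
    Integrable (fun x => expCoeff α (klCoeff lam e M x) * gradProd T s t x)
      (volume.restrict (subdomain E)) ∧
    ∫ ω, localMatrix T (subdomain E) R S (fun x => Real.exp (klSum lam e (ξ ω) x)) s t *
      psi α (ξ ω) ∂P =
      ∫ x in subdomain E, expCoeff α (klCoeff lam e M x) * gradProd T s t x := by
  have : IsFiniteMeasure (volume.restrict (subdomain E)) := ⟨by simpa using hEf.lt_top⟩
  have hψ : MemLp (fun p : Plane × Θ => psi α (ξ p.2)) 2
      ((volume.restrict (subdomain E)).prod P) :=
    (memLp_psi_comp hξm hξ α).comp_snd _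
  have hI : Integrable (fun p : Plane × Θ => Real.exp (klSum lam e (ξ p.2) p.1) *
      psi α (ξ p.2) * gradProd T s t p.1) ((volume.restrict (subdomain E)).prod P) := by
    refine (hκ.integrable_mul hψ).mul_bdd (c := ((γ ^ 2 * h)⁻¹) ^ 2)
      ((measurable_gradProd s t).comp measurable_fst).aestronglyMeasurable ?_
    have := Measure.quasiMeasurePreserving_fst (μ := volume.restrict (subdomain E)) (ν := P)
    simpa using this.ae (hT.ae_abs_gradProd_le hγ hh hE s t)
  have hx (x : Plane) : ∫ ω, Real.exp (klSum lam e (ξ ω) x) * psi α (ξ ω) * gradProd T s t x ∂P =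
      expCoeff α (klCoeff lam e M x) * gradProd T s t x := by
    rw [integral_mul_const, ← integral_exp_mul_psi]
    congr 1
    refine integral_comp_eq hξm hξ
      (f := fun y => Real.exp (∑ m, klCoeff lam e M x m * y m) * psi α y) ?_
    have := continuous_psi α
    fun_prop
  refine ⟨hI.integral_prod_left.congr (.of_forall hx), ?_⟩
  have hs := integral_integral_swap (f := fun x ω => Real.exp (klSum lam e (ξ ω) x) *
      psi α (ξ ω) * gradProd T s t x) hI
  simp_rw [hx] at hs
  rw [hs]
  refine integral_congr_ae (.of_forall fun ω => ?_)
  simp only [localMatrix_apply]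
  rw [← integral_mul_const]
  congr 1
  ext x
  ring

/-- Truncating the chaos of the matrix amounts to truncating the chaos of its coefficient at each x,
so the error is again a local matrix. -/
theorem IsTriangulation.ae_localMatrix_sub_pcTrunc (hT : IsTriangulation T Ω γ h) (hγ : 0 < γ)
    (hh : 0 < h) (hE : E ⊆ elements T) (hEf : volume (subdomain E) ≠ ⊤) (R S : Finset Plane)
    (hκ : MemLp (fun p : Plane × Θ => Real.exp (klSum lam e (ξ p.2) p.1)) 2
      ((volume.restrict (subdomain E)).prod P))
    (hξm : AEMeasurable ξ P) (hξ : P.map ξ = stdGaussianPi M) (d : ℕ) :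
    ∀ᵐ θ ∂P, localMatrix T (subdomain E) R S (fun x => Real.exp (klSum lam e (ξ θ) x)) -
      pcTrunc P d ξ (fun ω => localMatrix T (subdomain E) R S
        (fun x => Real.exp (klSum lam e (ξ ω) x))) θ =
      localMatrix T (subdomain E) R S (fun x => expRem d (klCoeff lam e M x) (ξ θ)) := by
  have : IsFiniteMeasure (volume.restrict (subdomain E)) := ⟨by simpa using hEf.lt_top⟩
  filter_upwards [ae_memLp_left hκ] with θ hθ
  ext s t
  have hα (α : Fin M → ℕ) :=
    hT.integral_localMatrix_mul_psi hγ hh hE hEf R S hκ hξm hξ α s t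
  have hi : Integrable (fun x => Real.exp (klSum lam e (ξ θ) x) * gradProd T s t x)
      (volume.restrict (subdomain E)) :=
    (hθ.integrable one_le_two).mul_bdd (c := ((γ ^ 2 * h)⁻¹) ^ 2)
      (measurable_gradProd s t).aestronglyMeasurable
      (by simpa using hT.ae_abs_gradProd_le hγ hh hE s t)
  rw [Matrix.sub_apply, pcTrunc_apply]
  simp_rw [(hα _).2, ← integral_const_mul]
  rw [← integral_finsetSum _ fun α _ => (hα α).1.const_mul _, localMatrix_apply, localMatrix_apply,
    ← integral_sub hi (integrable_finsetSum _ fun α _ => (hα α).1.const_mul _)]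
  congr 1
  ext x
  rw [expRem, sub_mul, Finset.sum_mul, klSum_eq]
  congr 1
  exact Finset.sum_congr rfl fun α _ => by ring

theorem IsTriangulation.lintegral_norm_localMatrix_sub_pcTrunc_le (hT : IsTriangulation T Ω γ h)
    (hγ : 0 < γ) (hh : 0 < h) (hE : E ⊆ elements T) (hEf : volume (subdomain E) ≠ ⊤)
    (R S : Finset Plane)
    (hκ : MemLp (fun p : Plane × Θ => Real.exp (klSum lam e (ξ p.2) p.1)) 2
      ((volume.restrict (subdomain E)).prod P))
    (hξm : AEMeasurable ξ P) (hξ : P.map ξ = stdGaussianPi M) (d : ℕ) {σ : ℝ}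
    (hlam : ∀ m, 0 ≤ lam m) (hv : ∀ x ∈ subdomain E, klVariance lam e M x ≤ σ ^ 2) :
    ∫⁻ θ, ENNReal.ofReal (‖localMatrix T (subdomain E) R S
        (fun x => Real.exp (klSum lam e (ξ θ) x)) -
      pcTrunc P d ξ (fun ω => localMatrix T (subdomain E) R S
        (fun x => Real.exp (klSum lam e (ξ ω) x))) θ‖ ^ 2) ∂P ≤
      ENNReal.ofReal ((3 * Real.pi / γ ^ 4) ^ 2 *
        ((2 * Real.exp (2 * σ ^ 2) + Real.exp 2) * pcTail σ M d)) := by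
  obtain ⟨G, hGm, hG, hGI⟩ := exists_expRem_bound σ M d
  set c := 3 * Real.pi / γ ^ 4 with hc
  have hc0 : 0 < c := by positivity
  calc _ ≤ ∫⁻ θ, ENNReal.ofReal (c ^ 2) * G (ξ θ) ∂P := by
        refine lintegral_mono_ae ?_
        filter_upwards [hT.ae_localMatrix_sub_pcTrunc hγ hh hE hEf R S hκ hξm hξ d] with θ hθ
        rw [hθ]
        -- Where the majorant is infinite the bound is trivial; elsewhere its square root bounds the
        -- coefficient at every x, as the Schur test requires.
        by_cases htop : G (ξ θ) = ⊤
        · rw [htop, ENNReal.mul_top (by simpa using hc0.ne')]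
          exact le_top
        have hb : ∀ x ∈ subdomain E, |expRem d (klCoeff lam e M x) (ξ θ)| ≤
            Real.sqrt (G (ξ θ)).toReal := fun x hx => by
          refine Real.abs_le_sqrt ?_
          refine (ENNReal.ofReal_le_iff_le_toReal htop).1 (hG _ ?_ _)
          rw [sum_klCoeff_sq hlam]
          exact hv x hx
        have hn := hT.norm_localMatrix_le hγ hh hE R S (Real.sqrt_nonneg _) hb
        calc _ ≤ ENNReal.ofReal ((c * Real.sqrt (G (ξ θ)).toReal) ^ 2) := by gcongr
          _ = _ := by
            rw [mul_pow, Real.sq_sqrt ENNReal.toReal_nonneg, ENNReal.ofReal_mul (by positivity),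
              ENNReal.ofReal_toReal htop]
    _ = ENNReal.ofReal (c ^ 2) * ∫⁻ y, G y ∂(stdGaussianPi M) := by
        rw [lintegral_const_mul'' (f := fun θ => G (ξ θ)) _ (hGm.comp_aemeasurable hξm), ← hξ,
          lintegral_map' hGm.aemeasurable hξm]
    _ ≤ _ := by
        rw [ENNReal.ofReal_mul (by positivity)]
        gcongr

end Chaos

/-! ### The error of the coefficient -/

section Coefficient

variable {Θ : Type*} [MeasurableSpace Θ] {P : Measure Θ} [IsProbabilityMeasure P]
  {D : Set Plane}

theorem integral_sub_sq_le {X : Type*} [MeasurableSpace X] {μ : Measure X} {f g k : X → ℝ}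
    (hf : MemLp f 2 μ) (hg : MemLp g 2 μ) (hk : MemLp k 2 μ) :
    ∫ x, (g x - k x) ^ 2 ∂μ ≤ 2 * ∫ x, (f x - g x) ^ 2 ∂μ + 2 * ∫ x, (f x - k x) ^ 2 ∂μ := by
  have h1 : Integrable (fun x => (f x - g x) ^ 2) μ := (hf.sub hg).integrable_sq
  have h2 : Integrable (fun x => (f x - k x) ^ 2) μ := (hf.sub hk).integrable_sq
  rw [← integral_const_mul, ← integral_const_mul,
    ← integral_add (h1.const_mul 2) (h2.const_mul 2)]
  refine integral_mono (hg.sub hk).integrable_sq ((h1.const_mul 2).add (h2.const_mul 2))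
    fun x => ?_
  simp only
  nlinarith [sq_nonneg ((f x - g x) + (f x - k x))]

/-- A coefficient `κ₂` that is, for almost every sample, at least as close to `κ` as `κ₁` is
square integrable and close to `κ₁`. -/
theorem memLp_of_integral_sub_sq_le {κ κ₁ κ₂ : Plane × Θ → ℝ}
    (hκ : MemLp κ 2 ((volume.restrict D).prod P)) (hκ₁ : MemLp κ₁ 2 ((volume.restrict D).prod P))
    (hκ₂ : AEStronglyMeasurable κ₂ ((volume.restrict D).prod P))
    (hi : ∀ᵐ θ ∂P, Integrable (fun x => (κ (x, θ) - κ₂ (x, θ)) ^ 2) (volume.restrict D))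
    (hle : ∀ᵐ θ ∂P, ∫ x in D, (κ (x, θ) - κ₂ (x, θ)) ^ 2 ≤
      ∫ x in D, (κ (x, θ) - κ₁ (x, θ)) ^ 2) :
    MemLp κ₂ 2 ((volume.restrict D).prod P) ∧
    ∫ p, (κ₁ p - κ₂ p) ^ 2 ∂((volume.restrict D).prod P) ≤
      4 * ∫ p, (κ p - κ₁ p) ^ 2 ∂((volume.restrict D).prod P) := by
  have h1 : Integrable (fun p => (κ p - κ₁ p) ^ 2) ((volume.restrict D).prod P) :=
    (hκ.sub hκ₁).integrable_sq
  have hm : AEStronglyMeasurable (fun p => (κ p - κ₂ p) ^ 2) ((volume.restrict D).prod P) :=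
    (hκ.1.sub hκ₂).pow 2
  have h2 : Integrable (fun p => (κ p - κ₂ p) ^ 2) ((volume.restrict D).prod P) := by
    -- Integrability on fibres has to come from `hi`: the integral of a nonintegrable square is 0,
    -- so the comparison alone would not give it.
    refine (integrable_prod_iff' hm).2 ⟨hi, ?_⟩
    refine h1.integral_prod_right.mono' hm.norm.prod_swap.integral_prod_right' ?_
    filter_upwards [hle] with θ hθ
    rw [Real.norm_eq_abs, abs_of_nonneg (integral_nonneg fun x => norm_nonneg _)]
    simpa using hθ
  have h3 : MemLp (fun p => κ p - κ₂ p) 2 ((volume.restrict D).prod P) :=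
    (memLp_two_iff_integrable_sq (hκ.1.sub hκ₂)).2 h2
  have h4 : MemLp κ₂ 2 ((volume.restrict D).prod P) := by
    have := hκ.sub h3
    refine this.ae_eq (.of_forall fun p => ?_)
    simp
  have hle' : ∫ p, (κ p - κ₂ p) ^ 2 ∂((volume.restrict D).prod P) ≤
      ∫ p, (κ p - κ₁ p) ^ 2 ∂((volume.restrict D).prod P) := by
    rw [integral_prod_symm _ h1, integral_prod_symm _ h2]
    exact integral_mono_ae h2.integral_prod_right h1.integral_prod_right hle
  refine ⟨h4, ?_⟩
  have := integral_sub_sq_le hκ hκ₁ h4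
  linarith

variable {σ l : ℝ} {Ω : Set Plane} {a : Plane → Θ → ℝ} {lam lamD : ℕ → ℝ} {e eD : ℕ → Plane → ℝ}

/-- Both truncations are compared with exp(a). The global one is estimated on all of Ω, and
restricting to D only decreases the error. -/
theorem integral_prod_exp_klSum_sub_sq_le (ha : IsGaussianField P σ l Ω a)
    (hΩm : MeasurableSet Ω) (hΩf : volume Ω ≠ ⊤) (hDm : MeasurableSet D) (hD : D ⊆ Ω)
    (hKL : IsKLSystem σ l Ω lam e) (he : ∀ m, Measurable (e m))
    (hKLD : IsKLSystem σ l D lamD eD) (heD : ∀ m, Measurable (eD m)) (M MD : ℕ) :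
    MemLp (fun p : Plane × Θ =>
      Real.exp (klSum lam e (fun m : Fin M => klVar Ω lam e a m p.2) p.1)) 2
      ((volume.restrict D).prod P) ∧
    MemLp (fun p : Plane × Θ =>
      Real.exp (klSum lamD eD (fun m : Fin MD => klVar D lamD eD a m p.2) p.1)) 2
      ((volume.restrict D).prod P) ∧
    ∫ p : Plane × Θ, (Real.exp (klSum lam e (fun m : Fin M => klVar Ω lam e a m p.2) p.1) -
      Real.exp (klSum lamD eD (fun m : Fin MD => klVar D lamD eD a m p.2) p.1)) ^ 2
      ∂((volume.restrict D).prod P) ≤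
      3 * Real.exp (2 * σ ^ 2) * (klTail Ω lam e M + klTail D lamD eD MD) := by
  have hDf : volume D ≠ ⊤ := measure_ne_top_of_subset hD hΩf
  have : IsFiniteMeasure (volume.restrict Ω) := ⟨by simpa using hΩf.lt_top⟩
  have hmono : (volume.restrict D).prod P ≤ (volume.restrict Ω).prod P :=
    Measure.prod_mono (Measure.restrict_mono hD le_rfl) le_rfl
  have ma := memLp_exp_field ha hDm hD hDf
  have ma' := memLp_exp_field ha hΩm subset_rfl hΩf
  have m1' := memLp_exp_klSum ha hΩm subset_rfl hΩf hKL he M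
  have m1 := m1'.mono_measure hmono
  have m2 := memLp_exp_klSum ha hDm hD hDf hKLD heD MD
  have b1 := integral_prod_exp_sub_sq_le ha hΩm subset_rfl hΩf hKL he M
  have b2 := integral_prod_exp_sub_sq_le ha hDm hD hDf hKLD heD MD
  have b1' := (integral_mono_measure hmono (.of_forall fun p => sq_nonneg _)
    (ma'.sub m1').integrable_sq).trans b1
  refine ⟨m1, m2, ?_⟩
  have := integral_sub_sq_le ma m1 m2
  simp only [Pi.sub_apply] at b1'
  linarith

/-- A quantity below X² and below Y² is below XY. This trades one factor ε h₀(h₀/d)³ for σ√V, and h₀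
≤ h ≤ d gives h₀(h₀/d)³ ≤ h²/d. -/
theorem le_of_le_sq_of_le_mesh {t σ V ε h₀ h d : ℝ} (hσ : 0 < σ) (hV : 0 ≤ V) (hε : 0 < ε)
    (h0 : 0 < h₀) (h01 : h₀ ≤ h) (hd : h ≤ d) (ht1 : t ≤ ε ^ 2 * h₀ ^ 2 * (h₀ / d) ^ 6)
    (ht2 : t ≤ σ ^ 2 * V) : t ≤ σ * Real.sqrt V / d * ε * h ^ 2 := by
  have hh : 0 < h := h0.trans_le h01
  have hd0 : 0 < d := hh.trans_le hd
  have hX : t ≤ (ε * h₀ * (h₀ / d) ^ 3) ^ 2 := ht1.trans (le_of_eq (by ring))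
  have hY : t ≤ (σ * Real.sqrt V) ^ 2 := by rwa [mul_pow, Real.sq_sqrt hV]
  have h1 : t ≤ (ε * h₀ * (h₀ / d) ^ 3) * (σ * Real.sqrt V) := by
    rcases le_or_gt t 0 with h | h
    · exact h.trans (by positivity)
    · refine le_of_sq_le_sq ?_ (by positivity)
      rw [mul_pow, sq t]
      gcongr
  refine h1.trans ?_
  have h2 : h₀ * (h₀ / d) ^ 3 ≤ h ^ 2 / d := by
    have h3 : h₀ / d ≤ 1 := (div_le_one hd0).2 (h01.trans hd)
    calc h₀ * (h₀ / d) ^ 3 = h₀ ^ 2 / d * (h₀ / d) ^ 2 := by field_simp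
      _ ≤ h₀ ^ 2 / d * 1 := by
          gcongr
          exact pow_le_one₀ (by positivity) h3
      _ ≤ h ^ 2 / d := by rw [mul_one]; gcongr
  calc _ = (h₀ * (h₀ / d) ^ 3) * (ε * (σ * Real.sqrt V)) := by ring
    _ ≤ (h ^ 2 / d) * (ε * (σ * Real.sqrt V)) := by gcongr
    _ = _ := by ring

end Coefficient

/-! ### The error of the chaos approximation of a local matrix -/

theorem integrable_norm_sub_sq {X F : Type*} [MeasurableSpace X] {μ : Measure X}
    [NormedAddCommGroup F] {A₀ A₁ A₂ A₃ : X → F} (h₀ : AEStronglyMeasurable A₀ μ)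
    (h₁ : AEStronglyMeasurable A₁ μ) (h₂ : AEStronglyMeasurable A₂ μ)
    (h₃ : AEStronglyMeasurable A₃ μ) {c₁ c₂ c₃ : ℝ} (hc₁ : 0 ≤ c₁) (hc₂ : 0 ≤ c₂) (hc₃ : 0 ≤ c₃)
    (H₁ : ∫⁻ x, ENNReal.ofReal (‖A₀ x - A₁ x‖ ^ 2) ∂μ ≤ ENNReal.ofReal c₁)
    (H₂ : ∫⁻ x, ENNReal.ofReal (‖A₁ x - A₂ x‖ ^ 2) ∂μ ≤ ENNReal.ofReal c₂)
    (H₃ : ∫⁻ x, ENNReal.ofReal (‖A₂ x - A₃ x‖ ^ 2) ∂μ ≤ ENNReal.ofReal c₃) :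
    Integrable (fun x => ‖A₀ x - A₃ x‖ ^ 2) μ ∧
      ∫ x, ‖A₀ x - A₃ x‖ ^ 2 ∂μ ≤ 3 * (c₁ + c₂ + c₃) := by
  have hm {U V : X → F} (hU : AEStronglyMeasurable U μ) (hV : AEStronglyMeasurable V μ) :
      AEMeasurable (fun x => ENNReal.ofReal (‖U x - V x‖ ^ 2)) μ :=
    ((hU.sub hV).norm.aemeasurable.pow_const 2).ennreal_ofReal
  have hle : ∫⁻ x, ENNReal.ofReal (‖A₀ x - A₃ x‖ ^ 2) ∂μ ≤
      ENNReal.ofReal (3 * (c₁ + c₂ + c₃)) := by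
    calc _ ≤ ∫⁻ x, ENNReal.ofReal 3 * (ENNReal.ofReal (‖A₀ x - A₁ x‖ ^ 2) +
          ENNReal.ofReal (‖A₁ x - A₂ x‖ ^ 2) + ENNReal.ofReal (‖A₂ x - A₃ x‖ ^ 2)) ∂μ := by
          refine lintegral_mono fun x => ?_
          simp only
          rw [← ENNReal.ofReal_add (by positivity) (by positivity),
            ← ENNReal.ofReal_add (by positivity) (by positivity),
            ← ENNReal.ofReal_mul (by positivity)]
          refine ENNReal.ofReal_le_ofReal ?_
          have h : ‖A₀ x - A₃ x‖ ≤ ‖A₀ x - A₁ x‖ + ‖A₁ x - A₂ x‖ + ‖A₂ x - A₃ x‖ := by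
            rw [show A₀ x - A₃ x = (A₀ x - A₁ x) + (A₁ x - A₂ x) + (A₂ x - A₃ x) by abel]
            exact norm_add₃_le
          calc _ ≤ (‖A₀ x - A₁ x‖ + ‖A₁ x - A₂ x‖ + ‖A₂ x - A₃ x‖) ^ 2 := by gcongr
            _ ≤ _ := by
              nlinarith [sq_nonneg (‖A₀ x - A₁ x‖ - ‖A₁ x - A₂ x‖),
                sq_nonneg (‖A₀ x - A₁ x‖ - ‖A₂ x - A₃ x‖),
                sq_nonneg (‖A₁ x - A₂ x‖ - ‖A₂ x - A₃ x‖)]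
      _ = ENNReal.ofReal 3 * (∫⁻ x, ENNReal.ofReal (‖A₀ x - A₁ x‖ ^ 2) ∂μ +
          ∫⁻ x, ENNReal.ofReal (‖A₁ x - A₂ x‖ ^ 2) ∂μ +
          ∫⁻ x, ENNReal.ofReal (‖A₂ x - A₃ x‖ ^ 2) ∂μ) := by
          rw [lintegral_const_mul' _ _ ENNReal.ofReal_ne_top,
            lintegral_add_right' _ (hm h₂ h₃), lintegral_add_left' (hm h₀ h₁)]
      _ ≤ ENNReal.ofReal 3 * (ENNReal.ofReal c₁ + ENNReal.ofReal c₂ + ENNReal.ofReal c₃) := by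
          gcongr
      _ = _ := by
          rw [← ENNReal.ofReal_add hc₁ hc₂, ← ENNReal.ofReal_add (by positivity) hc₃,
            ← ENNReal.ofReal_mul (by positivity)]
  have hi : Integrable (fun x => ‖A₀ x - A₃ x‖ ^ 2) μ := by
    refine ⟨(h₀.sub h₃).norm.pow 2, ?_⟩
    rw [hasFiniteIntegral_iff_ofReal (.of_forall fun x => by positivity)]
    exact hle.trans_lt ENNReal.ofReal_lt_top
  refine ⟨hi, ?_⟩
  rw [← ofReal_integral_eq_lintegral_ofReal hi (.of_forall fun x => by positivity)] at hle
  exact (ENNReal.ofReal_le_ofReal_iff (by positivity)).1 hle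

/-- Bounded eigenfunctions keep every truncated sum bounded on a set of finite measure. This makes
the least squares functional a genuine integral for every coefficient vector. -/
theorem integrable_exp_sub_exp_klSum_sq {D : Set Plane} (hDf : volume D ≠ ⊤) {lam lam' : ℕ → ℝ}
    {e e' : ℕ → Plane → ℝ} (he : ∀ m, Measurable (e m)) (hb : ∀ m, ∃ C, ∀ x, |e m x| ≤ C)
    (he' : ∀ m, Measurable (e' m)) (hb' : ∀ m, ∃ C, ∀ x, |e' m x| ≤ C) {M M' : ℕ}
    (v : Fin M → ℝ) (v' : Fin M' → ℝ) :
    Integrable (fun x => (Real.exp (klSum lam e v x) - Real.exp (klSum lam' e' v' x)) ^ 2)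
      (volume.restrict D) := by
  have : IsFiniteMeasure (volume.restrict D) := ⟨by simpa using hDf.lt_top⟩
  have key {lam : ℕ → ℝ} {e : ℕ → Plane → ℝ} (he : ∀ m, Measurable (e m))
      (hb : ∀ m, ∃ C, ∀ x, |e m x| ≤ C) {M : ℕ} (v : Fin M → ℝ) :
      MemLp (fun x => Real.exp (klSum lam e v x)) 2 (volume.restrict D) := by
    choose C hC using hb
    refine MemLp.of_bound (C := Real.exp (∑ m : Fin M, |Real.sqrt (lam m)| * C m * |v m|)) ?_
      (.of_forall fun x => ?_)
    · have : Measurable fun x => Real.exp (klSum lam e v x) := by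
        unfold klSum
        fun_prop
      exact this.aestronglyMeasurable
    · rw [Real.norm_eq_abs, Real.abs_exp, Real.exp_le_exp, klSum]
      refine Finset.sum_le_sum fun m _ => (le_abs_self _).trans ?_
      rw [abs_mul, abs_mul]
      gcongr
      exact hC m x
  exact ((key he hb v).sub (key he' hb' v')).integrable_sq

section Main

variable {Θ : Type*} [MeasurableSpace Θ] {P : Measure Θ} [IsProbabilityMeasure P]
  {σ l : ℝ} {Ω : Set Plane} {a : Plane → Θ → ℝ} {lam lamD : ℕ → ℝ} {e eD : ℕ → Plane → ℝ}
  {T : Geometry.SimplicialComplex ℝ Plane} {γ h : ℝ} {E : Set (Finset Plane)}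

theorem IsTriangulation.integral_norm_sub_pcTrunc_sq_le (hT : IsTriangulation T Ω γ h)
    (hγ : 0 < γ) (hσ : 0 < σ) (hΩo : IsOpen Ω) (hΩb : Bornology.IsBounded Ω)
    (ha : IsGaussianField P σ l Ω a) {ε h₀ : ℝ} (hε : 0 < ε) (h0 : 0 < h₀) (h01 : h₀ < h)
    (hE : E ⊆ elements T)
    (hKL : IsKLSystem σ l Ω lam e) (he : ∀ m, Measurable (e m)) (hb : ∀ m, ∃ C, ∀ x, |e m x| ≤ C)
    (hKLD : IsKLSystem σ l (subdomain E) lamD eD) (heD : ∀ m, Measurable (eD m))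
    (hbD : ∀ m, ∃ C, ∀ x, |eD m x| ≤ C) (M MD d : ℕ)
    (ht : klTail Ω lam e M ≤ ε ^ 2 * h₀ ^ 2 * (h₀ / Metric.diam Ω) ^ 6)
    (htD : klTail (subdomain E) lamD eD MD ≤ ε ^ 2 * h₀ ^ 2 * (h₀ / Metric.diam Ω) ^ 6)
    (hpc : pcTail σ MD d ≤ ε * (1 / Metric.diam Ω ^ 2)) {aM : Plane → Θ → ℝ}
    (haM : aM = fun x θ => klSum lam e (fun m : Fin M => klVar Ω lam e a m θ) x)
    {ξ η : Θ → Fin MD → ℝ}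
    (hξ : ξ = fun θ (m : Fin MD) => klVar (subdomain E) lamD eD a m θ) (hηm : AEMeasurable η P)
    (hη : ∀ᵐ θ ∂P,
      ∫ x in subdomain E, (Real.exp (aM x θ) - Real.exp (klSum lamD eD (η θ) x)) ^ 2 ≤
      ∫ x in subdomain E, (Real.exp (aM x θ) - Real.exp (klSum lamD eD (ξ θ) x)) ^ 2)
    (R S : Finset Plane) {A B : Θ → Matrix R S ℝ}
    (hA : A = fun θ => localMatrix T (subdomain E) R S fun x => Real.exp (aM x θ))
    (hB : B = fun θ => localMatrix T (subdomain E) R S fun x =>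
      Real.exp (klSum lamD eD (η θ) x)) :
    (∀ (α : Fin MD → ℕ) (s : R) (t : S), Integrable (fun θ => B θ s t * psi α (ξ θ)) P) ∧
    Integrable (fun θ => ‖A θ - pcTrunc P d ξ B θ‖ ^ 2) P ∧
    ∫ θ, ‖A θ - pcTrunc P d ξ B θ‖ ^ 2 ∂P ≤
      3 * (5 * (9 * Real.pi / γ ^ 8 * (6 * Real.exp (2 * σ ^ 2) *
        (σ * Real.sqrt (volume.real Ω) / Metric.diam Ω))) + (3 * Real.pi / γ ^ 4) ^ 2 *
        ((2 * Real.exp (2 * σ ^ 2) + Real.exp 2) * (1 / Metric.diam Ω ^ 2))) * ε := by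
  have hh : 0 < h := h0.trans h01
  have hΩm := hΩo.measurableSet
  have hΩf : volume Ω ≠ ⊤ := hΩb.measure_lt_top.ne
  have hDm : MeasurableSet (subdomain E) := isOpen_interior.measurableSet
  have hD : subdomain E ⊆ Ω := hT.subdomain_subset hE
  have hDf : volume (subdomain E) ≠ ⊤ := measure_ne_top_of_subset hD hΩf
  have : IsFiniteMeasure (volume.restrict (subdomain E)) := ⟨by simpa using hDf.lt_top⟩
  have hd := hT.le_diam hγ hh hΩb
  have hξm : AEMeasurable ξ P := hξ ▸ aemeasurable_klVar ha hDm hD hDf hKLD MD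
  have hξl : P.map ξ = stdGaussianPi MD := hξ ▸ map_klVar ha hDm hD hDf hKLD MD
  set q := σ * Real.sqrt (volume.real Ω) / Metric.diam Ω with hq
  have hq0 : 0 ≤ q := by positivity
  have hV : volume.real (subdomain E) ≤ volume.real Ω := measureReal_mono hD hΩf
  -- Both eigenvalue tails become at most q ε h², with the same q because |D| ≤ |Ω|.
  have hq1 := le_of_le_sq_of_le_mesh hσ measureReal_nonneg hε h0 h01.le hd ht
    (klTail_le ha hΩm subset_rfl hΩf hKL M)
  have hq2 := le_of_le_sq_of_le_mesh (V := volume.real Ω) hσ measureReal_nonneg hε h0 h01.le hd htD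
    ((klTail_le ha hDm hD hDf hKLD MD).trans (by gcongr))
  obtain ⟨mM, mξ, hJ⟩ := integral_prod_exp_klSum_sub_sq_le ha hΩm hΩf hDm hD hKL he hKLD heD M MD
  let κM : Plane × Θ → ℝ := fun p => Real.exp (aM p.1 p.2)
  let κξ : Plane × Θ → ℝ := fun p => Real.exp (klSum lamD eD (ξ p.2) p.1)
  let κη : Plane × Θ → ℝ := fun p => Real.exp (klSum lamD eD (η p.2) p.1)
  replace mM : MemLp κM 2 ((volume.restrict (subdomain E)).prod P) := by
    simpa only [κM, haM] using mM
  replace mξ : MemLp κξ 2 ((volume.restrict (subdomain E)).prod P) := by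
    simpa only [κξ, hξ] using mξ
  have hJ' : ∫ p, (κM p - κξ p) ^ 2 ∂((volume.restrict (subdomain E)).prod P) ≤
      6 * Real.exp (2 * σ ^ 2) * q * ε * h ^ 2 := by
    have h1 : ∫ p, (κM p - κξ p) ^ 2 ∂((volume.restrict (subdomain E)).prod P) ≤
        3 * Real.exp (2 * σ ^ 2) * (klTail Ω lam e M + klTail (subdomain E) lamD eD MD) := by
      simpa only [κM, κξ, haM, hξ] using hJ
    refine h1.trans ?_
    calc _ ≤ 3 * Real.exp (2 * σ ^ 2) * (q * ε * h ^ 2 + q * ε * h ^ 2) := by gcongr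
      _ = _ := by ring
  obtain ⟨mη, hJη⟩ := memLp_of_integral_sub_sq_le (κ := κM) (κ₁ := κξ) (κ₂ := κη) mM mξ
    (Real.continuous_exp.comp_aestronglyMeasurable (aestronglyMeasurable_klSum heD hηm))
    (.of_forall fun θ => by
      simp only [κM, κη, haM]
      exact integrable_exp_sub_exp_klSum_sq hDf he hb heD hbD _ _) hη
  set Bξ : Θ → Matrix R S ℝ := fun θ => localMatrix T (subdomain E) R S fun x =>
    Real.exp (klSum lamD eD (ξ θ) x) with hBξ
  have LA := (hT.integral_sum_sq_localMatrix_le hγ hh hE R S mM).1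
  have LBξ := (hT.integral_sum_sq_localMatrix_le hγ hh hE R S mξ).1
  have LB := (hT.integral_sum_sq_localMatrix_le hγ hh hE R S mη).1
  have b1 : ∫⁻ θ, ENNReal.ofReal (‖A θ - Bξ θ‖ ^ 2) ∂P ≤
      ENNReal.ofReal (9 * Real.pi / γ ^ 8 * (6 * Real.exp (2 * σ ^ 2) * q) * ε) := by
    rw [hA]
    refine (hT.lintegral_norm_localMatrix_sub_le hγ hh hE hDf R S mM mξ).trans
      (ENNReal.ofReal_le_ofReal ?_)
    calc _ ≤ 9 * Real.pi / γ ^ 8 / h ^ 2 * (6 * Real.exp (2 * σ ^ 2) * q * ε * h ^ 2) := by gcongr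
      _ = _ := by field_simp
  have b2 := hT.lintegral_norm_localMatrix_sub_pcTrunc_le hγ hh hE hDf R S mξ hξm hξl d
    (fun m => (hKLD.pos m).le) fun x hx => klVariance_le ha hDm hD hDf hKLD MD hx
  -- The factor 4 comes from the least squares comparison; together with `b1` it accounts for the 5
  -- in the final constant.
  have b3 : ∫⁻ θ, ENNReal.ofReal (‖pcTrunc P d ξ Bξ θ - pcTrunc P d ξ B θ‖ ^ 2) ∂P ≤
      ENNReal.ofReal (4 * (9 * Real.pi / γ ^ 8 * (6 * Real.exp (2 * σ ^ 2) * q) * ε)) := by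
    rw [hB]
    refine (hT.lintegral_norm_pcTrunc_localMatrix_sub_le hγ hh hE hDf R S mξ mη hξm hξl d).trans
      (ENNReal.ofReal_le_ofReal ?_)
    calc _ ≤ 9 * Real.pi / γ ^ 8 / h ^ 2 * (4 * (6 * Real.exp (2 * σ ^ 2) * q * ε * h ^ 2)) := by
          gcongr
          linarith
      _ = _ := by field_simp
  have hpc0 := pcTail_nonneg σ MD d
  obtain ⟨hi, hI⟩ := integrable_norm_sub_sq (A₀ := A) (A₁ := Bξ) (A₂ := pcTrunc P d ξ Bξ)
    (A₃ := pcTrunc P d ξ B)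
    (aestronglyMeasurable_matrix fun s t => by rw [hA]; exact (LA s t).1)
    (aestronglyMeasurable_matrix fun s t => (LBξ s t).1)
    (aestronglyMeasurable_matrix fun s t => (memLp_pcTrunc_apply hξm hξl d _ s t).1)
    (aestronglyMeasurable_matrix fun s t => (memLp_pcTrunc_apply hξm hξl d _ s t).1)
    (by positivity) (by positivity) (by positivity) b1 b2 b3
  refine ⟨fun α s t => ?_, hi, hI.trans ?_⟩
  · rw [hB]
    exact (LB s t).integrable_mul (memLp_psi_comp hξm hξl α)
  · calc _ ≤ 3 * (9 * Real.pi / γ ^ 8 * (6 * Real.exp (2 * σ ^ 2) * q) * ε +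
          (3 * Real.pi / γ ^ 4) ^ 2 * ((2 * Real.exp (2 * σ ^ 2) + Real.exp 2) *
            (ε * (1 / Metric.diam Ω ^ 2))) +
          4 * (9 * Real.pi / γ ^ 8 * (6 * Real.exp (2 * σ ^ 2) * q) * ε)) := by gcongr
      _ = _ := by ring

end Main

/-! ### Changing the eigenfunctions off the domain -/

theorem klVar_congr {Θ : Type*} {D : Set Plane} (hD : MeasurableSet D) (lam : ℕ → ℝ)
    {e e' : ℕ → Plane → ℝ} (h : ∀ m, ∀ x ∈ D, e' m x = e m x) (a : Plane → Θ → ℝ) :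
    klVar D lam e' a = klVar D lam e a := by
  ext m θ
  simp only [klVar]
  congr 1
  exact setIntegral_congr_fun hD fun x hx => by simp only [h m x hx]

theorem klTail_congr {D : Set Plane} (hD : MeasurableSet D) (lam : ℕ → ℝ)
    {e e' : ℕ → Plane → ℝ} (h : ∀ m, ∀ x ∈ D, e' m x = e m x) (M : ℕ) :
    klTail D lam e' M = klTail D lam e M := by
  simp only [klTail]
  refine tsum_congr fun m => ?_
  congr 1
  exact setIntegral_congr_fun hD fun x hx => by simp only [h _ x hx]

theorem klSum_congr {lam : ℕ → ℝ} {e e' : ℕ → Plane → ℝ} {x : Plane}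
    (h : ∀ m, e' m x = e m x) {M : ℕ} (v : Fin M → ℝ) : klSum lam e' v x = klSum lam e v x := by
  simp only [klSum, h]

end StochBDDC

end

theorem lemma5p2 (σ l : ℝ) (hσ : 0 < σ) (hl : 0 < l) (Ω : Set StochBDDC.Plane)
    (hΩo : IsOpen Ω) (hΩb : Bornology.IsBounded Ω) (γ : ℝ) (hγ : 0 < γ) :
    ∃ C : ℝ, 0 < C ∧
      -- the probability space and the Gaussian field
      ∀ (Θ : Type*) [MeasurableSpace Θ] (P : Measure Θ) [IsProbabilityMeasure P]
        (a : StochBDDC.Plane → Θ → ℝ), StochBDDC.IsGaussianField P σ l Ω a →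
      -- the tolerance, the mesh, and a subdomain `D` made up of elements
      ∀ (ε h₀ h : ℝ), 0 < ε → 0 < h₀ → h₀ < h →
      ∀ (T : Geometry.SimplicialComplex ℝ StochBDDC.Plane),
        StochBDDC.IsTriangulation T Ω γ h →
      ∀ (E : Set (Finset StochBDDC.Plane)), E ⊆ StochBDDC.elements T → E.Nonempty →
      ∀ (D : Set StochBDDC.Plane), D = StochBDDC.subdomain E →
      -- the global and the local eigenpairs
      ∀ (lam : ℕ → ℝ) (e : ℕ → StochBDDC.Plane → ℝ), StochBDDC.IsKLSystem σ l Ω lam e →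
      ∀ (lamD : ℕ → ℝ) (eD : ℕ → StochBDDC.Plane → ℝ), StochBDDC.IsKLSystem σ l D lamD eD →
      -- the truncation parameters are large enough
      ∀ (M MD d : ℕ),
        StochBDDC.klTail Ω lam e M ≤ ε ^ 2 * h₀ ^ 2 * (h₀ / Metric.diam Ω) ^ 6 →
        StochBDDC.klTail D lamD eD MD ≤ ε ^ 2 * h₀ ^ 2 * (h₀ / Metric.diam Ω) ^ 6 →
        StochBDDC.pcTail σ MD d ≤ ε * (1 / Metric.diam Ω ^ 2) →
      -- `aM` is the global truncation, `ξ` are the local KL variables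
      ∀ (aM : StochBDDC.Plane → Θ → ℝ),
        (aM = fun x θ =>
          StochBDDC.klSum lam e (fun m : Fin M => StochBDDC.klVar Ω lam e a m θ) x) →
      ∀ (ξ : Θ → Fin MD → ℝ), (ξ = fun θ (m : Fin MD) => StochBDDC.klVar D lamD eD a m θ) →
      -- `η` are the coefficients of the truncated local KL expansion: the least squares fit
      -- to `aM`, or the KL variables themselves
      ∀ (η : Θ → Fin MD → ℝ),
        ((AEMeasurable η P ∧ ∀ᵐ θ ∂P,
          StochBDDC.IsLeastSquaresFit D lamD eD (fun x => aM x θ) (η θ)) ∨ η = ξ) →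
      -- any subdomain local matrix: rows `R` and columns `S` among the degrees of freedom
      ∀ (R S : Finset StochBDDC.Plane),
        (R : Set StochBDDC.Plane) ⊆ StochBDDC.dofs T Ω D →
        (S : Set StochBDDC.Plane) ⊆ StochBDDC.dofs T Ω D →
      ∀ (A B : Θ → Matrix R S ℝ),
        (A = fun θ => StochBDDC.localMatrix T D R S fun x => Real.exp (aM x θ)) →
        (B = fun θ => StochBDDC.localMatrix T D R S fun x =>
          Real.exp (StochBDDC.klSum lamD eD (η θ) x)) →
        (∀ (α : Fin MD → ℕ) (s : R) (t : S),
          Integrable (fun θ => B θ s t * StochBDDC.psi α (ξ θ)) P) ∧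
        Integrable (fun θ => ‖A θ - StochBDDC.pcTrunc P d ξ B θ‖ ^ 2) P ∧
        ∫ θ, ‖A θ - StochBDDC.pcTrunc P d ξ B θ‖ ^ 2 ∂P ≤ C * ε := by
  have hΩm := hΩo.measurableSet
  have hΩf : volume Ω ≠ ⊤ := hΩb.measure_lt_top.ne
  -- The summand 1 secures positivity when the diameter of Ω is 0, where every quotient by it is 0.
  refine ⟨3 * (5 * (9 * Real.pi / γ ^ 8 * (6 * Real.exp (2 * σ ^ 2) *
    (σ * Real.sqrt (volume.real Ω) / Metric.diam Ω))) + (3 * Real.pi / γ ^ 4) ^ 2 *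
    ((2 * Real.exp (2 * σ ^ 2) + Real.exp 2) * (1 / Metric.diam Ω ^ 2))) + 1, by positivity, ?_⟩
  intro Θ _ P _ a ha ε h₀ h hε h0 h01 T hT E hE _ D hDE lam e hKL lamD eD hKLD M MD d ht htD hpc
    aM haM ξ hξ η hη R S _ _ A B hA hB
  subst hDE
  have hDm : MeasurableSet (StochBDDC.subdomain E) := isOpen_interior.measurableSet
  have hD : StochBDDC.subdomain E ⊆ Ω := hT.subdomain_subset hE
  have hDf : volume (StochBDDC.subdomain E) ≠ ⊤ := measure_ne_top_of_subset hD hΩf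
  -- The eigenfunctions are arbitrary off their domains. Regular representatives agree with them
  -- there, and all integrals involved see only those values.
  obtain ⟨e', he', hb', hee, hKL'⟩ := hKL.exists_regular hl hΩm hΩf
  obtain ⟨eD', heD', hbD', heeD, hKLD'⟩ := hKLD.exists_regular hl hDm hDf
  have haM' : ∀ θ, ∀ x ∈ StochBDDC.subdomain E,
      StochBDDC.klSum lam e' (fun m : Fin M => StochBDDC.klVar Ω lam e' a m θ) x = aM x θ :=
    fun θ x hx => by
      rw [haM, StochBDDC.klVar_congr hΩm lam hee,
        StochBDDC.klSum_congr fun m => hee m x (hD hx)]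
  have hsD {v : Fin MD → ℝ} : ∀ x ∈ StochBDDC.subdomain E,
      StochBDDC.klSum lamD eD' v x = StochBDDC.klSum lamD eD v x :=
    fun x hx => StochBDDC.klSum_congr (fun m => heeD m x hx) v
  have hξ' : ξ = fun θ (m : Fin MD) => StochBDDC.klVar (StochBDDC.subdomain E) lamD eD' a m θ := by
    rw [hξ, StochBDDC.klVar_congr hDm lamD heeD]
  have hξm : AEMeasurable ξ P := hξ ▸ StochBDDC.aemeasurable_klVar ha hDm hD hDf hKLD MD
  have hηm : AEMeasurable η P := by
    rcases hη with hη | rfl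
    exacts [hη.1, hξm]
  have hfit : ∀ᵐ θ ∂P,
      ∫ x in StochBDDC.subdomain E,
        (Real.exp (aM x θ) - Real.exp (StochBDDC.klSum lamD eD (η θ) x)) ^ 2 ≤
      ∫ x in StochBDDC.subdomain E,
        (Real.exp (aM x θ) - Real.exp (StochBDDC.klSum lamD eD (ξ θ) x)) ^ 2 := by
    rcases hη with hη | rfl
    -- The only consequence of minimality in use is the comparison with the competitor `ξ`.
    · filter_upwards [hη.2] with θ hθ using hθ (mem_univ (ξ θ))
    · exact .of_forall fun θ => le_rfl
  have hcongr (θ : Θ) (v : Fin MD → ℝ) :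
      ∫ x in StochBDDC.subdomain E, (Real.exp (StochBDDC.klSum lam e'
        (fun m : Fin M => StochBDDC.klVar Ω lam e' a m θ) x) -
        Real.exp (StochBDDC.klSum lamD eD' v x)) ^ 2 =
      ∫ x in StochBDDC.subdomain E,
        (Real.exp (aM x θ) - Real.exp (StochBDDC.klSum lamD eD v x)) ^ 2 :=
    setIntegral_congr_fun hDm fun x hx => by simp only [haM' θ x hx, hsD x hx]
  obtain ⟨h1, h2, h3⟩ := hT.integral_norm_sub_pcTrunc_sq_le (A := A) (B := B) hγ hσ hΩo hΩb ha hε h0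
    h01 hE hKL' he' hb' hKLD' heD' hbD' M MD d
    (by rwa [StochBDDC.klTail_congr hΩm lam hee]) (by rwa [StochBDDC.klTail_congr hDm lamD heeD])
    hpc rfl hξ' hηm (by simpa only [hcongr] using hfit) R S
    (by
      rw [hA]
      ext1 θ
      exact StochBDDC.localMatrix_congr hDm R S fun x hx => by rw [haM' θ x hx])
    (by
      rw [hB]
      ext1 θ
      exact StochBDDC.localMatrix_congr hDm R S fun x hx => by rw [hsD x hx])
  refine ⟨h1, h2, h3.trans ?_⟩
  gcongr
  linarith
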